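/- **Setting.** Let $z_a=z-a$ for $a\in\mathbb C$ and $z_\infty=1/z$. An exponential factor at $a\in\mathbb P^1=\mathbb C\cup\{\infty\}$ is a finite sum $q=\sum_k c_k z_a^{-k}$, $k\in\mathbb Q_{>0}$, $c_k\in\mathbb C$; its Galois orbit (the set of its determinations, the *leaves*) is the circle $\langle q\rangle_a$. The ramification $\mathrm{ram}(q)$ is the smallest common denominator of its exponents, its slope is its largest exponent ($0$ if $q=0$), and $\mathrm{Irr}(q)=\mathrm{ram}(q)\,\mathrm{slope}(q)$. *Modified formal data* $(\breve\Theta,\breve{\mathcal C})$ assign to each circle $I$ a multiplicity $n_I\in\mathbb N$, nonzero for finitely many (*active*) circles only, and a conjugacy class $\mathcal C_I\subset GL_{n_I}(\mathbb C)$, the class of the monodromy of a rank $n_I$ local system on $I$, taken in the direction of increasing $\arg z_a$ if $a\in\mathbb C$ and of increasing $\arg z$ if $a=\infty$. In particular the modified formal data of any algebraic connection on a Zariski open subset of the affine line are of this kind. **Elementary operations.** * The twist $T_\lambda=\begin{pmatrix}1&\lambda\\0&1\end{pmatrix}$, $\lambda\in\mathbb C$, sends $\langle q\rangle_\infty$ to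 $\langle q-\tfrac\lambda2z^2\rangle_\infty$ and fixes the circles at finite distance; the classes do not change. * The scaling $S_\lambda=\begin{pmatrix}\lambda&0\\0&\lambda^{-1}\end{pmatrix}$, $\lambda\in\mathbb C^*$, is the change of variable $z\mapsto z/\lambda$: a circle at $a$ goes to a circle at $a/\lambda$ (at $\infty$ if $a=\infty$), with $\lambda z$ substituted for $z$ in $q$; the classes do not change. * The formal Fourier transform $F=\begin{pmatrix}0&1\\-1&0\end{pmatrix}$ moves circles by the Legendre transform: $\langle 0\rangle_a\mapsto\langle -az\rangle_\infty$ for $a\in\mathbb C$, $\langle\alpha z\rangle_\infty\mapsto\langle0\rangle_\alpha$ for $\alpha\in\mathbb C$, and otherwise $\langle q\rangle_a\mapsto\langle\tilde q\rangle_b$ where $\xi=dq/dz$, $b$ is the limit of $\xi$ as $z\to a$, and $\tilde q(\xi)=q(z)-\xi z$ up to terms bounded near $b$. The class of the circle is multiplied by $(-1)^s$, where $s=\mathrm{Irr}(q)$, the term of $q$ in $z^1$ being discarded first if $a=\infty$; and it is inverted when the circle passes from finite distance to infinity or conversely. For $A\in SL_2(\mathbb C)$, $A\cdot(\breve\Theta,\breve{\mathcal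 C})$ is obtained by writing $A$ as a product of such matrices and applying the corresponding operations successively, the rightmost first. **Diagrams.** For formal data with all active circles at infinity, the diagram $\Gamma^{BY}$ has as core nodes the active circles, with edge numbers $B_{IJ}=\mathrm{Irr}(\mathrm{Hom}(I,J))-\mathrm{ram}(I)\mathrm{ram}(J)$ for $I\ne J$ and $B_{II}=\mathrm{Irr}(\mathrm{End}(I))-\mathrm{ram}(I)^2+1$; here $\mathrm{Hom}(I,J)$ is the irregular class whose leaves are the differences of a leaf of $J$ and a leaf of $I$, counted with multiplicity. A marking of $\mathcal C_I$ is a list $\xi_1,\dots,\xi_w\in\mathbb C^*$ with $\prod_j(M-\xi_j)=0$ for $M\in\mathcal C_I$; it is minimal if $w$ is minimal. A marking of each $\mathcal C_I$ being chosen, a leg with $w-1$ nodes, joined by simple edges, is glued to each core node $I$. The dimension vector is $n_I$ at $I$ and $\mathrm{rank}\,(M-\xi_1)\cdots(M-\xi_i)$ at the $i$-th node of its leg. Isomorphisms of diagrams respect core nodes, edge numbers and dimension vectors. **Theorem.** Let $(\breve\Theta,\breve{\mathcal C})$ be modified formal data. 1. For every $A\in SL_2(\mathbb C)$ the data $A\cdot(\breve\Theta,\breve{\mathcal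 C})$ exist and do not depend on the factorization of $A$. 2. The set of $A\in SL_2(\mathbb C)$ such that $A\cdot(\breve\Theta,\breve{\mathcal C})$ is supported only at infinity is open and dense in $SL_2(\mathbb C)$. 3. For all such $A$ the diagram $\Gamma^{BY}(A\cdot(\breve\Theta,\breve{\mathcal C}))$ is the same: if $A_1,A_2$ are two such matrices, then for every choice of markings for $A_1\cdot(\breve\Theta,\breve{\mathcal C})$ there is a choice of markings for $A_2\cdot(\breve\Theta,\breve{\mathcal C})$, minimal if the first one is, such that the two full diagrams with their dimension vectors are isomorphic. 4. Hence the general diagram $\Gamma(\breve\Theta,\breve{\mathcal C}):=\Gamma^{BY}(A\cdot(\breve\Theta,\breve{\mathcal C}))$, for any such $A$ and minimal markings, exists, is well defined (up to isomorphism and the choice of minimal markings), and satisfies $\Gamma(B\cdot(\breve\Theta,\breve{\mathcal C}))=\Gamma(\breve\Theta,\breve{\mathcal C})$ for every $B\in SL_2(\mathbb C)$, in the sense that both are represented by the same diagrams. -/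

import Mathlib

open scoped OnePoint MatrixGroups

namespace WildDiagram

noncomputable section

/-! ### Exponential factors and circles -/

/-- The exponents `k > 0` that may occur in an exponential factor `∑ c_k z_a ^ (-k)`. -/
abbrev Exponent : Type := {k : ℚ≥0 // 0 < k}

/-- Exponential factors at a point `a`, on a fixed direction and for a fixed determination of the
roots of the local coordinate `z_a`: finite sums `∑ c_k z_a ^ (-k)` with `k ∈ ℚ`, `k > 0`.
The local coordinates are `z_a = z - a` at `a ∈ ℂ` and `z_∞ = 1 / z` at infinity. -/
abbrev ExpFactor : Type := Exponent →₀ ℂ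

/-- The exponent `n`, for a positive natural number `n`. -/
def natExp (n : ℕ) (hn : 0 < n) : Exponent := ⟨(n : ℚ≥0), by exact_mod_cast hn⟩

/-- The monomial `c z_a ^ (-n)`; at infinity this is `c z ^ n`. -/
def monomial (n : ℕ) (hn : 0 < n) (c : ℂ) : ExpFactor := Finsupp.single (natExp n hn) c

namespace ExpFactor

/-- Multiply the coefficient of `z_a ^ (-k)` by `u k`. -/
def rescale (u : Exponent → ℂ) (q : ExpFactor) : ExpFactor :=
  Finsupp.onFinset q.support (fun k => u k * q k) (by
    intro k hk
    rw [Finsupp.mem_support_iff]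
    exact right_ne_zero_of_mul hk)

/-- Analytic continuation of `q` along `m` positive turns around `a`, that is the effect of
`log z_a ↦ log z_a + 2 π i m`. -/
def rotate (m : ℤ) (q : ExpFactor) : ExpFactor :=
  q.rescale fun k => Complex.exp (-(2 * Real.pi * Complex.I * (k.1 : ℂ) * (m : ℂ)))

/-- The ramification index: the smallest common denominator of the exponents of `q`. -/
def ram (q : ExpFactor) : ℕ := q.support.lcm fun k => k.1.den

/-- The slope: the largest exponent of `q`, and `0` for `q = 0`. -/
def slope (q : ExpFactor) : ℚ≥0 := q.support.sup fun k => k.1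

/-- The irregularity `ram q * slope q` (this product is an integer): the degree of `q` as a
polynomial in `z_a ^ (-1 / ram q)`. -/
def irr (q : ExpFactor) : ℕ := ⌊(q.ram : ℚ≥0) * q.slope⌋₊

theorem rotate_apply (m : ℤ) (q : ExpFactor) (k : Exponent) :
    rotate m q k
      = Complex.exp (-(2 * Real.pi * Complex.I * (k.1 : ℂ) * (m : ℂ))) * q k := rfl

theorem rotate_zero (q : ExpFactor) : rotate 0 q = q := by
  ext k; simp [rotate_apply]

theorem rotate_rotate (m n : ℤ) (q : ExpFactor) : rotate m (rotate n q) = rotate (m + n) q := by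
  ext k
  simp only [rotate_apply]
  rw [← mul_assoc, ← Complex.exp_add]
  congr 2
  push_cast
  ring

theorem support_rotate (m : ℤ) (q : ExpFactor) : (rotate m q).support = q.support := by
  ext k; simp [rotate_apply, Complex.exp_ne_zero]

/-- Two exponential factors are equivalent if they are determinations of the same multivalued
function. -/
instance galois : Setoid ExpFactor where
  r p q := ∃ m : ℤ, rotate m p = q
  iseqv :=
    { refl := fun q => ⟨0, rotate_zero q⟩
      symm := by
        rintro p q ⟨m, rfl⟩
        exact ⟨-m, by rw [rotate_rotate, neg_add_cancel, rotate_zero]⟩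
      trans := by
        rintro p q r ⟨m, rfl⟩ ⟨n, rfl⟩
        exact ⟨n + m, by rw [rotate_rotate]⟩ }

end ExpFactor

/-- The connected components `⟨q⟩_a` of the exponential local system at one point `a`: the Galois
orbits of exponential factors. The elements of the orbit are the leaves of the circle. -/
abbrev LocalCircle : Type := Quotient ExpFactor.galois

/-- The circles `⟨q⟩_a`, `a ∈ ℙ¹ = ℂ ∪ {∞}`, of the global exponential local system. -/
abbrev ExpCircle : Type := OnePoint ℂ × LocalCircle

/-- The ramification index of a circle. -/
def LocalCircle.ram (I : LocalCircle) : ℕ :=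
  Quotient.lift ExpFactor.ram (by
    rintro p q ⟨m, rfl⟩
    simp [ExpFactor.ram, ExpFactor.support_rotate]) I

/-- The irregularity of a circle. -/
def LocalCircle.irr (I : LocalCircle) : ℕ :=
  Quotient.lift ExpFactor.irr (by
    rintro p q ⟨m, rfl⟩
    simp [ExpFactor.irr, ExpFactor.ram, ExpFactor.slope, ExpFactor.support_rotate]) I

/-! ### Edge multiplicities -/

/-- The irregular class `Hom(I, J)`: its leaves are the differences `q_J - q_I` of a leaf of `J`
and a leaf of `I`. The multiplicity of a circle `K` is the number of pairs of leaves whose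
difference is a given leaf of `K`. -/
def homClass (I J : LocalCircle) : LocalCircle → ℕ := fun K =>
  Set.ncard {x : ExpFactor × ExpFactor |
    (⟦x.1⟧ : LocalCircle) = I ∧ (⟦x.2⟧ : LocalCircle) = J ∧ x.2 - x.1 = K.out}

/-- The irregularity `∑ n_K Irr(K)` of an irregular class `∑ n_K K`. -/
def irrClass (Θ : LocalCircle → ℕ) : ℕ := ∑ᶠ K, Θ K * K.irr

open Classical in
/-- The number `B_{IJ}` of arrows between two circles `I`, `J` at infinity:
`Irr Hom(I, J) - ram I * ram J` if `I ≠ J`, and `Irr End(I) - (ram I)² + 1` if `I = J`. -/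
def edgeNumber (I J : LocalCircle) : ℤ :=
  if I = J then (irrClass (homClass I I) : ℤ) - (I.ram : ℤ) ^ 2 + 1
  else (irrClass (homClass I J) : ℤ) - (I.ram : ℤ) * (J.ram : ℤ)

/-! ### Formal data -/

/-- Isomorphism classes of local systems of finite dimensional complex vector spaces on a circle:
a rank `n` and the conjugacy class in `GL_n(ℂ)` of the monodromy. For a circle `⟨q⟩_a` the
monodromy is taken in the direction in which `arg (z - a)` increases if `a ∈ ℂ`, and in which
`arg z` increases if `a = ∞`. -/
abbrev LocSys : Type := Σ n : ℕ, ConjClasses (GL (Fin n) ℂ)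

namespace LocSys

/-- Tensor product with the rank one local system with monodromy `(-1) ^ s`. -/
def sign (s : ℕ) (c : LocSys) : LocSys :=
  ⟨c.1, Quotient.map (fun g : GL (Fin c.1) ℂ => (-1) ^ s * g) (by
    intro g h hgh
    obtain ⟨u, rfl⟩ := isConj_iff.1 hgh
    refine isConj_iff.2 ⟨u, ?_⟩
    rcases neg_one_pow_eq_or (GL (Fin c.1) ℂ) s with hs | hs <;> simp [hs]) c.2⟩

/-- The same local system, with monodromy taken in the opposite direction. -/
def inv (c : LocSys) : LocSys :=
  ⟨c.1, Quotient.map (fun g : GL (Fin c.1) ℂ => g⁻¹) (by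
    intro g h hgh
    obtain ⟨u, rfl⟩ := isConj_iff.1 hgh
    exact isConj_iff.2 ⟨u, by group⟩) c.2⟩

/-- A matrix in the conjugacy class. -/
def matrix (c : LocSys) : Matrix (Fin c.1) (Fin c.1) ℂ :=
  ((Quotient.out c.2 : GL (Fin c.1) ℂ) : Matrix (Fin c.1) (Fin c.1) ℂ)

/-- The product `∏ (M - ξ_j)` over the entries of a list `ξ`, where `M` is in the conjugacy
class. -/
def prodSub (c : LocSys) (ξ : List ℂ) : Matrix (Fin c.1) (Fin c.1) ℂ :=
  (ξ.map fun x => c.matrix - Matrix.scalar (Fin c.1) x).prod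

/-- A marking of a conjugacy class: an ordered list `ξ_1, …, ξ_w` of invertible complex numbers
with `∏ (M - ξ_j) = 0`. -/
def IsMarking (c : LocSys) (ξ : List ℂ) : Prop := (∀ x ∈ ξ, x ≠ 0) ∧ c.prodSub ξ = 0

/-- A marking of the smallest possible length: an ordering of the roots, with multiplicity, of the
minimal polynomial. -/
def IsMinimalMarking (c : LocSys) (ξ : List ℂ) : Prop :=
  c.IsMarking ξ ∧ ∀ η, c.IsMarking η → ξ.length ≤ η.length

end LocSys

/-- Modified formal data `(Θ, 𝒞)`: for every circle `I` the multiplicity `n_I = Θ(I)` and a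
conjugacy class `𝒞_I` in `GL_{n_I}(ℂ)`, with `n_I = 0` for all but finitely many circles.
Equivalently, an isomorphism class of local systems on the union of all circles. -/
@[ext]
structure FormalData where
  /-- multiplicity and monodromy class of each circle -/
  loc : ExpCircle → LocSys
  finite_support : {I | (loc I).1 ≠ 0}.Finite

namespace FormalData

/-- The active circles. -/
abbrev Active (D : FormalData) : Type := {I : ExpCircle // (D.loc I).1 ≠ 0}

/-- All active circles are at infinity. -/
def AtInfinity (D : FormalData) : Prop := ∀ I : ExpCircle, (D.loc I).1 ≠ 0 → I.1 = ∞

end FormalData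

/-! ### The formal Fourier transform -/

/-- The value at `z_a = τ ^ r` of an exponential factor whose ramification index divides `r`: the
sum of the `c_k τ ^ (-k r)`. -/
def ExpFactor.along (q : ExpFactor) (r : ℕ) (τ : LaurentSeries ℂ) : LaurentSeries ℂ :=
  q.sum fun k c => HahnSeries.C c * τ ^ (-(⌊k.1 * (r : ℚ≥0)⌋₊ : ℤ))

/-- The coordinate `z` along the ramified arc `z_a = τ ^ r`: `z = a + τ ^ r` if `a ∈ ℂ`, and
`z = τ ^ (-r)` if `a = ∞`. -/
def coordAlong (a : OnePoint ℂ) (r : ℕ) (τ : LaurentSeries ℂ) : LaurentSeries ℂ :=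
  a.elim (τ ^ (-(r : ℤ))) fun x => HahnSeries.C x + τ ^ r

/-- `LegendreTransform a q b p`: the Legendre transform sends the circle `⟨q⟩_a` to `⟨p⟩_b`.

For the tame circles at finite distance, `⟨0⟩_a ↦ ⟨-a ξ⟩_∞`, and for the pure circles at infinity,
`⟨α z⟩_∞ ↦ ⟨0⟩_α`. For every other circle, write `z_a = t ^ r` with `r = ram q`; the dual variable
is `ξ = dq/dz`, the local coordinate at the point `b` of the `ξ`-line to which `ξ` tends is
`τ ^ r'` for another uniformizer `τ`, and `p(ξ) = q(z) - ξ z` up to terms that stay bounded at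
`t = 0`. -/
inductive LegendreTransform : OnePoint ℂ → ExpFactor → OnePoint ℂ → ExpFactor → Prop
  | tame (a : ℂ) : LegendreTransform (a : OnePoint ℂ) 0 ∞ (monomial 1 one_pos (-a))
  | pure (α : ℂ) : LegendreTransform ∞ (monomial 1 one_pos α) (α : OnePoint ℂ) 0
  | stationary (a : OnePoint ℂ) (q : ExpFactor) (b : OnePoint ℂ) (p : ExpFactor)
      (r' : ℕ) (hr' : 0 < r') (hp : p.ram ∣ r')
      (t τ z ξ Q P : LaurentSeries ℂ)
      (ht : t = HahnSeries.single 1 1) (hτ : τ.order = 1)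
      (hz : z = coordAlong a q.ram t) (hQ : Q = q.along q.ram t)
      (hξ : ξ = coordAlong b r' τ) (hP : P = p.along r' τ)
      (hderiv : ξ * LaurentSeries.derivative ℂ z = LaurentSeries.derivative ℂ Q)
      (hvalue : ∃ f : PowerSeries ℂ, P - (Q - ξ * z) = (f : LaurentSeries ℂ)) :
      LegendreTransform a q b p

open Classical in
/-- The irregularity of the part of `q` with nonzero second derivative in `z`: at infinity the
term in `z` is discarded. -/
def hessianIrr (a : OnePoint ℂ) (q : ExpFactor) : ℕ :=
  if a = ∞ then ExpFactor.irr (q.erase (natExp 1 one_pos)) else q.irr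

open Classical in
/-- The effect of the Legendre transform `⟨q⟩_a ↦ ⟨p⟩_b` and of the Gaussian factor
`(d²q/dz²)^(-1/2)`, whose monodromy is `(-1) ^ hessianIrr a q`, on local systems. A circle that
passes from finite distance to infinity or back has its sense of rotation reversed. -/
def legendreLocSys (a : OnePoint ℂ) (q : ExpFactor) (b : OnePoint ℂ) (c : LocSys) : LocSys :=
  if a = ∞ ∧ b = ∞ then c.sign (hessianIrr a q) else (c.sign (hessianIrr a q)).inv

/-- `D'` is the formal Fourier transform of `D`. -/
def IsFourier (D D' : FormalData) : Prop :=
  ∀ a q b p, LegendreTransform a q b p →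
    D'.loc (b, ⟦p⟧) = legendreLocSys a q b (D.loc (a, ⟦q⟧))

/-! ### Twists, scalings, and the action of `SL₂(ℂ)` -/

/-- `D'` is the twist of `D` by `lam`, the tensor product with the rank one module
`(ℂ[z], ∂ + lam z)`: the exponential factors at infinity change by `q ↦ q - (lam / 2) z²`, and
nothing changes at finite distance. -/
def IsTwist (lam : ℂ) (D D' : FormalData) : Prop :=
  (∀ q : ExpFactor, D'.loc (∞, ⟦q - monomial 2 two_pos (lam / 2)⟧) = D.loc (∞, ⟦q⟧)) ∧
  ∀ (a : ℂ) (q : ExpFactor), D'.loc ((a : OnePoint ℂ), ⟦q⟧) = D.loc ((a : OnePoint ℂ), ⟦q⟧)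

/-- `D'` is the image of `D` under the scaling `z ↦ z / lam`: substitute `lam z` for `z` in the
exponential factors. A factor `∑ c_k (z - a) ^ (-k)` at `a ∈ ℂ` becomes
`∑ c_k (lam (z - a / lam)) ^ (-k)` at `a / lam`, and `∑ c_k z ^ k` at infinity becomes
`∑ c_k (lam z) ^ k`. -/
def IsScaling (lam : ℂˣ) (D D' : FormalData) : Prop :=
  (∀ q : ExpFactor,
    D'.loc (∞, ⟦q.rescale fun k => (lam : ℂ) ^ (k.1 : ℂ)⟧) = D.loc (∞, ⟦q⟧)) ∧
  ∀ (a : ℂ) (q : ExpFactor),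
    D'.loc (((a / (lam : ℂ) : ℂ) : OnePoint ℂ), ⟦q.rescale fun k => (lam : ℂ) ^ (-(k.1 : ℂ))⟧)
      = D.loc ((a : OnePoint ℂ), ⟦q⟧)

/-- The matrix of the Fourier transform. -/
def fourierMatrix : SL(2, ℂ) := ⟨!![0, 1; -1, 0], by simp [Matrix.det_fin_two]⟩

/-- The matrix of the twist by `lam`. -/
def twistMatrix (lam : ℂ) : SL(2, ℂ) := ⟨!![1, lam; 0, 1], by simp [Matrix.det_fin_two]⟩

/-- The matrix of the scaling `z ↦ z / lam`. -/
def scalingMatrix (lam : ℂˣ) : SL(2, ℂ) :=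
  ⟨!![(lam : ℂ), 0; 0, ((lam⁻¹ : ℂˣ) : ℂ)], by simp [Matrix.det_fin_two]⟩

/-- `Acts A D D'`: the formal data `D'` are obtained from `D` by applying elementary operations
(Fourier transform, twists, scalings) whose matrices have product `A`, that is `D' = A · D`. -/
inductive Acts : SL(2, ℂ) → FormalData → FormalData → Prop
  | one (D : FormalData) : Acts 1 D D
  | fourier {A : SL(2, ℂ)} {D D' D'' : FormalData} :
      Acts A D D' → IsFourier D' D'' → Acts (fourierMatrix * A) D D''
  | twist {A : SL(2, ℂ)} {D D' D'' : FormalData} (lam : ℂ) :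
      Acts A D D' → IsTwist lam D' D'' → Acts (twistMatrix lam * A) D D''
  | scaling {A : SL(2, ℂ)} {D D' D'' : FormalData} (lam : ℂˣ) :
      Acts A D D' → IsScaling lam D' D'' → Acts (scalingMatrix lam * A) D D''

/-- The matrices `A` such that `A · D` is supported only at infinity. -/
def genericSet (D : FormalData) : Set SL(2, ℂ) := {A | ∃ D', Acts A D D' ∧ D'.AtInfinity}

/-! ### Diagrams -/

/-- A diagram with its dimension vector: finitely many nodes, some of which form the core, integer
edge multiplicities (possibly negative; `edges v v` counts the oriented loops at `v`), and a
dimension at each node. -/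
structure Diagram where
  /-- nodes -/
  Node : Type
  finite : Finite Node
  /-- the nodes of the core -/
  core : Set Node
  /-- edge multiplicities -/
  edges : Node → Node → ℤ
  /-- dimension vector -/
  dim : Node → ℕ

/-- Isomorphism of diagrams. -/
def Diagram.Isomorphic (G H : Diagram) : Prop :=
  ∃ e : G.Node ≃ H.Node,
    (∀ v, e v ∈ H.core ↔ v ∈ G.core) ∧
    (∀ v w, H.edges (e v) (e w) = G.edges v w) ∧
    ∀ v, H.dim (e v) = G.dim v

/-- A choice of a marking of the conjugacy class of each active circle. -/
structure MarkingChoice (D : FormalData) where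
  /-- the chosen lists -/
  seq : D.Active → List ℂ
  isMarking : ∀ I, (D.loc I.1).IsMarking (seq I)

/-- All markings of the family have minimal length. -/
def MarkingChoice.IsMinimal {D : FormalData} (m : MarkingChoice D) : Prop :=
  ∀ I, (D.loc I.1).IsMinimalMarking (m.seq I)

open Classical in
/-- The full diagram of formal data `D` supported at infinity. The nodes are the pairs `(I, i)`
with `I` active and `0 ≤ i < w`, `w` being the length of the marking `ξ_1, …, ξ_w` of `𝒞_I`. The
nodes `(I, 0)` form the core, with edge multiplicities `edgeNumber`; the leg `(I, 1), …,
(I, w - 1)` is glued to `(I, 0)` by simple edges between consecutive nodes. The dimension at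
`(I, i)` is the rank of `(M - ξ_1) ⋯ (M - ξ_i)` for `M ∈ 𝒞_I`, in particular `n_I` at `(I, 0)`. -/
def fullDiagram (D : FormalData) (_ : D.AtInfinity) (m : MarkingChoice D) : Diagram where
  Node := Σ I : D.Active, Fin (m.seq I).length
  finite := by
    have : Finite D.Active := D.finite_support.to_subtype
    infer_instance
  core := {v | (v.2 : ℕ) = 0}
  edges v w :=
    if (v.2 : ℕ) = 0 ∧ (w.2 : ℕ) = 0 then edgeNumber v.1.1.2 w.1.1.2
    else if v.1 = w.1 ∧ ((v.2 : ℕ) + 1 = w.2 ∨ (w.2 : ℕ) + 1 = v.2) then 1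
    else 0
  dim v := ((D.loc v.1.1).prodSub ((m.seq v.1).take v.2)).rank

/-- `G` is the diagram `Γ(D)` of general formal data: `Γ(D) = Γ^BY(A · D)` for some `A` such that
`A · D` is supported at infinity, the legs being formed with minimal markings. -/
def IsDiagramOf (D : FormalData) (G : Diagram) : Prop :=
  ∃ (A : SL(2, ℂ)) (D' : FormalData) (h : D'.AtInfinity) (m : MarkingChoice D'),
    Acts A D D' ∧ m.IsMinimal ∧ G.Isomorphic (fullDiagram D' h m)

end

end WildDiagram

open WildDiagram

namespace WildDiagram

noncomputable section

/-! ### Orders and leading coefficients of Laurent series -/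

/-! The idea is to replace circles by parametrized curves in the phase plane, on which `SL₂(ℂ)` acts
linearly. A curve is a pair `v = (z, ξ)` of Laurent series. It represents `⟨q⟩_a` when `z` is a
ramified coordinate at `a` and `ξ dz - dq` has no pole (`Rep`). For `q = 0` at a finite point this
condition would not control the Fourier transform, so tame circles are represented by curves for
which `ξ` has a pole and `(z - x) dξ` has none (`Tame`). Every circle has a representing curve
(`exists_represents`), and a curve represents at most one circle (`Represents.unique`). Each
elementary operation carries every curve representing a circle to a curve representing its image,
through the linear map `rho`. Twists and scalings are direct; for the Legendre transform this is
stationary phase with an error estimate (`Stationary.rep`). Since `rho` is multiplicative, the group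
acts on circles by `act`, whatever the factorization.

On local systems the only obstruction is the sign `(-1)^s` and the change of orientation. Comparing
orders in `ξ dz = dq` gives `s ≡ ram q + ram p` mod 2 for dual circles, so twisting by `(-1)^ram`,
and inverting at finite distance, turns the action into a pure permutation of the circles
(`normalize_eq_iff`, `acts_iff`).

The image of a circle under `A` is at infinity exactly when `A 1 1 * z - A 1 0 * ξ` has a pole,
which is an open condition. A representing curve never has both coordinates regular, so on a line of
lower unipotent matrices at most one parameter is bad for a given circle; density follows
(`dense_genericSet`).

For the diagram, two generic images of the data differ by a matrix that moves circles from infinity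
to infinity. Such a matrix is a product of twists and scalings with at most one Fourier transform,
and the circles on both sides of the latter are at infinity. The invariance of `Irr Hom(I, J) - ram
I * ram J` under Fourier is the heart of the matter (`Stationary.irrClass_homClass_eq`). If the
slopes differ, both irregularities are explicit. If they agree, the two curves get common
ramifications `N` and `N'`. Differences of branches with the same `z` are then matched with
differences of dual branches with the same `ξ`: for a matched pair, both measure the contact of the
same branches (`Dual.pol_eq`), and unmatched ones all have pole order `N + N'`. Finally, the classes
change only by signs, so markings are multiplied by the same signs, which preserves lengths and
ranks. -/

/-- All coefficients of `f` in degrees `< n` vanish. -/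
def OrdGE (n : ℤ) (f : LaurentSeries ℂ) : Prop := ∀ k < n, f.coeff k = 0

/-- `f` has no term of degree `< n`, and the coefficient of degree `n` is `c` (possibly zero). -/
def Lead (f : LaurentSeries ℂ) (n : ℤ) (c : ℂ) : Prop := OrdGE n f ∧ f.coeff n = c

/-- The inclusion of power series into Laurent series. -/
abbrev ofPS : PowerSeries ℂ →+* LaurentSeries ℂ := HahnSeries.ofPowerSeries ℤ ℂ

/-- The derivation `d/dt` on Laurent series, as a linear map. -/
def dt : LaurentSeries ℂ →ₗ[ℂ] LaurentSeries ℂ := LaurentSeries.derivative ℂ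

theorem ordGE_iff {n : ℤ} {f : LaurentSeries ℂ} :
    OrdGE n f ↔ ∃ g : PowerSeries ℂ, f = HahnSeries.single n 1 * ofPS g := by
  constructor
  · intro h
    refine ⟨PowerSeries.mk fun k => f.coeff (n + k), ?_⟩
    ext k
    rw [HahnSeries.coeff_single_mul, PowerSeries.coeff_coe]
    split_ifs with hk
    · simp [h k (by omega)]
    · rw [PowerSeries.coeff_mk, one_mul]
      congr 1
      omega
  · rintro ⟨g, rfl⟩ k hk
    rw [HahnSeries.coeff_single_mul, PowerSeries.coeff_coe, if_pos (by omega), mul_zero]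

theorem lead_iff {n : ℤ} {c : ℂ} {f : LaurentSeries ℂ} :
    Lead f n c ↔
      ∃ g : PowerSeries ℂ, PowerSeries.constantCoeff g = c ∧ f = HahnSeries.single n 1 * ofPS g := by
  unfold Lead
  rw [ordGE_iff]
  constructor
  · rintro ⟨⟨g, rfl⟩, rfl⟩
    refine ⟨g, ?_, rfl⟩
    rw [HahnSeries.coeff_single_mul, PowerSeries.coeff_coe]
    simp
  · rintro ⟨g, rfl, rfl⟩
    refine ⟨⟨g, rfl⟩, ?_⟩
    rw [HahnSeries.coeff_single_mul, PowerSeries.coeff_coe]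
    simp

theorem ordGE_zero_iff {f : LaurentSeries ℂ} : OrdGE 0 f ↔ ∃ g : PowerSeries ℂ, f = ofPS g := by
  rw [ordGE_iff]
  simp [HahnSeries.single_zero_one]

theorem ordGE_ofPS (g : PowerSeries ℂ) : OrdGE 0 (ofPS g) := ordGE_zero_iff.2 ⟨g, rfl⟩

theorem OrdGE.mono {m n : ℤ} {f : LaurentSeries ℂ} (h : OrdGE n f) (hm : m ≤ n) : OrdGE m f :=
  fun k hk => h k (by omega)

theorem ordGE_zero (n : ℤ) : OrdGE n 0 := fun _ _ => rfl

theorem OrdGE.add {n : ℤ} {f g : LaurentSeries ℂ} (hf : OrdGE n f) (hg : OrdGE n g) :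
    OrdGE n (f + g) := fun k hk => by simp [hf k hk, hg k hk]

theorem OrdGE.neg {n : ℤ} {f : LaurentSeries ℂ} (hf : OrdGE n f) : OrdGE n (-f) :=
  fun k hk => by simp [hf k hk]

theorem OrdGE.sub {n : ℤ} {f g : LaurentSeries ℂ} (hf : OrdGE n f) (hg : OrdGE n g) :
    OrdGE n (f - g) := fun k hk => by simp [hf k hk, hg k hk]

theorem OrdGE.mul {m n : ℤ} {f g : LaurentSeries ℂ} (hf : OrdGE m f) (hg : OrdGE n g) :
    OrdGE (m + n) (f * g) := by
  obtain ⟨a, rfl⟩ := ordGE_iff.1 hf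
  obtain ⟨b, rfl⟩ := ordGE_iff.1 hg
  refine ordGE_iff.2 ⟨a * b, ?_⟩
  rw [map_mul, mul_mul_mul_comm, HahnSeries.single_mul_single, one_mul]

theorem ordGE_C (c : ℂ) : OrdGE 0 (HahnSeries.C c : LaurentSeries ℂ) := fun k hk => by
  simp [HahnSeries.C_apply, HahnSeries.coeff_single_of_ne hk.ne]

theorem OrdGE.C_mul {n : ℤ} {f : LaurentSeries ℂ} (hf : OrdGE n f) (c : ℂ) :
    OrdGE n (HahnSeries.C c * f) := by simpa using (ordGE_C c).mul hf

theorem ordGE_sum {ι : Type*} (s : Finset ι) {n : ℤ} {f : ι → LaurentSeries ℂ}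
    (h : ∀ i ∈ s, OrdGE n (f i)) : OrdGE n (∑ i ∈ s, f i) := by
  classical
  induction s using Finset.induction_on with
  | empty => exact ordGE_zero n
  | insert i s hi ih =>
    rw [Finset.sum_insert hi]
    exact (h i (by simp)).add (ih fun j hj => h j (by simp [hj]))

theorem Lead.ne_zero {f : LaurentSeries ℂ} {n : ℤ} {c : ℂ} (h : Lead f n c) (hc : c ≠ 0) :
    f ≠ 0 := by
  rintro rfl
  exact hc h.2.symm

theorem OrdGE.lead {f : LaurentSeries ℂ} {n m : ℤ} (h : OrdGE n f) (hm : m < n) : Lead f m 0 :=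
  ⟨h.mono hm.le, h m hm⟩

theorem Lead.ordGE_succ {f : LaurentSeries ℂ} {n : ℤ} (h : Lead f n 0) : OrdGE (n + 1) f := by
  intro k hk
  rcases (show k < n ∨ k = n by omega) with h' | rfl
  · exact h.1 k h'
  · exact h.2

theorem Lead.le_of_ordGE {f : LaurentSeries ℂ} {n m : ℤ} {c : ℂ} (h : Lead f n c) (hc : c ≠ 0)
    (h' : OrdGE m f) : m ≤ n := by
  by_contra! hlt
  exact hc (h.2 ▸ h' n hlt)

theorem Lead.unique {f : LaurentSeries ℂ} {n m : ℤ} {c d : ℂ} (h : Lead f n c) (h' : Lead f m d)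
    (hc : c ≠ 0) (hd : d ≠ 0) : n = m ∧ c = d := by
  have h1 := h.le_of_ordGE hc h'.1
  have h2 := h'.le_of_ordGE hd h.1
  obtain rfl : n = m := by omega
  exact ⟨rfl, h.2.symm.trans h'.2⟩

theorem lead_order (f : LaurentSeries ℂ) : Lead f f.order (f.coeff f.order) :=
  ⟨fun _ hk => HahnSeries.coeff_eq_zero_of_lt_order hk, rfl⟩

theorem coeff_order_ne_zero {f : LaurentSeries ℂ} (hf : f ≠ 0) : f.coeff f.order ≠ 0 :=
  fun h => hf (HahnSeries.coeff_order_eq_zero.1 h)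

theorem exists_lead {f : LaurentSeries ℂ} (hf : f ≠ 0) : ∃ n c, c ≠ 0 ∧ Lead f n c :=
  ⟨_, _, coeff_order_ne_zero hf, lead_order f⟩

theorem Lead.order_eq {f : LaurentSeries ℂ} {n : ℤ} {c : ℂ} (h : Lead f n c) (hc : c ≠ 0) :
    f.order = n :=
  ((lead_order f).unique h (coeff_order_ne_zero (h.ne_zero hc)) hc).1

theorem lead_single (n : ℤ) (c : ℂ) : Lead (HahnSeries.single n c : LaurentSeries ℂ) n c :=
  ⟨fun _ hk => HahnSeries.coeff_single_of_ne hk.ne, HahnSeries.coeff_single_same _ _⟩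

theorem lead_C (c : ℂ) : Lead (HahnSeries.C c : LaurentSeries ℂ) 0 c := lead_single 0 c

theorem lead_one : Lead (1 : LaurentSeries ℂ) 0 1 := lead_single 0 1

theorem Lead.mul {f g : LaurentSeries ℂ} {n m : ℤ} {c d : ℂ} (hf : Lead f n c) (hg : Lead g m d) :
    Lead (f * g) (n + m) (c * d) := by
  obtain ⟨a, rfl, rfl⟩ := lead_iff.1 hf
  obtain ⟨b, rfl, rfl⟩ := lead_iff.1 hg
  refine lead_iff.2 ⟨a * b, map_mul _ _ _, ?_⟩
  rw [map_mul, mul_mul_mul_comm, HahnSeries.single_mul_single, one_mul]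

theorem Lead.neg {f : LaurentSeries ℂ} {n : ℤ} {c : ℂ} (hf : Lead f n c) : Lead (-f) n (-c) :=
  ⟨hf.1.neg, by simp [hf.2]⟩

theorem Lead.add {f g : LaurentSeries ℂ} {n : ℤ} {c d : ℂ} (hf : Lead f n c) (hg : Lead g n d) :
    Lead (f + g) n (c + d) := ⟨hf.1.add hg.1, by simp [hf.2, hg.2]⟩

theorem Lead.sub {f g : LaurentSeries ℂ} {n : ℤ} {c d : ℂ} (hf : Lead f n c) (hg : Lead g n d) :
    Lead (f - g) n (c - d) := ⟨hf.1.sub hg.1, by simp [hf.2, hg.2]⟩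

theorem Lead.add_ordGE {f g : LaurentSeries ℂ} {n m : ℤ} {c : ℂ} (hf : Lead f n c)
    (hg : OrdGE m g) (hm : n < m) : Lead (f + g) n c := by
  simpa using hf.add (hg.lead hm)

theorem Lead.C_mul {f : LaurentSeries ℂ} {n : ℤ} {c : ℂ} (hf : Lead f n c) (a : ℂ) :
    Lead (HahnSeries.C a * f) n (a * c) := by simpa using (lead_C a).mul hf

theorem Lead.inv {f : LaurentSeries ℂ} {n : ℤ} {c : ℂ} (hf : Lead f n c) (hc : c ≠ 0) :
    Lead f⁻¹ (-n) c⁻¹ := by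
  have hf0 := hf.ne_zero hc
  obtain ⟨m, d, hd, hg⟩ := exists_lead (inv_ne_zero hf0)
  have h := hf.mul hg
  rw [mul_inv_cancel₀ hf0] at h
  obtain ⟨h1, h2⟩ := lead_one.unique h one_ne_zero (mul_ne_zero hc hd)
  obtain rfl : m = -n := by omega
  rwa [← eq_inv_of_mul_eq_one_right h2.symm]

theorem Lead.pow {f : LaurentSeries ℂ} {n : ℤ} {c : ℂ} (hf : Lead f n c) (k : ℕ) :
    Lead (f ^ k) (n * k) (c ^ k) := by
  induction k with
  | zero => simpa using lead_one
  | succ k ih =>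
    rw [pow_succ, pow_succ]
    convert ih.mul hf using 1
    push_cast
    ring

theorem Lead.zpow {f : LaurentSeries ℂ} {n : ℤ} {c : ℂ} (hf : Lead f n c) (hc : c ≠ 0) (k : ℤ) :
    Lead (f ^ k) (n * k) (c ^ k) := by
  obtain ⟨k, rfl | rfl⟩ := k.eq_nat_or_neg
  · simpa using hf.pow k
  · rw [zpow_neg, zpow_neg, zpow_natCast, zpow_natCast]
    convert (hf.pow k).inv (pow_ne_zero k hc) using 1
    ring

theorem lead_of_order {f : LaurentSeries ℂ} {n : ℤ} (hn : n ≠ 0) (h : f.order = n) :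
    ∃ c ≠ 0, Lead f n c := by
  have hf : f ≠ 0 := by
    rintro rfl
    simp at h
    exact hn h.symm
  subst h
  exact ⟨_, coeff_order_ne_zero hf, lead_order f⟩

/-! ### The derivative -/

theorem coeff_dt (f : LaurentSeries ℂ) (n : ℤ) : (dt f).coeff n = (n + 1) * f.coeff (n + 1) := by
  rw [dt, LaurentSeries.derivative_apply, LaurentSeries.hasseDeriv_coeff]
  simp

theorem dt_ofPS (g : PowerSeries ℂ) : dt (ofPS g) = ofPS (PowerSeries.derivative ℂ g) := by
  ext n
  rw [coeff_dt, PowerSeries.coeff_coe, PowerSeries.coeff_coe]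
  rcases lt_trichotomy n (-1) with h | rfl | h
  · rw [if_pos (by omega), if_pos (by omega), mul_zero]
  · simp
  · lift n to ℕ using by omega
    rw [if_neg (by omega), if_neg (by omega), Int.natAbs_natCast, PowerSeries.coeff_derivative,
      mul_comm]
    rfl

theorem dt_single_mul (n : ℤ) (f : LaurentSeries ℂ) :
    dt (HahnSeries.single n 1 * f)
      = HahnSeries.single (n - 1) (n : ℂ) * f + HahnSeries.single n 1 * dt f := by
  ext k
  rw [coeff_dt, HahnSeries.coeff_add, HahnSeries.coeff_single_mul, HahnSeries.coeff_single_mul,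
    HahnSeries.coeff_single_mul, coeff_dt]
  rw [show k + 1 - n = k - (n - 1) by ring, show k - n + 1 = k - (n - 1) by ring]
  push_cast
  ring

theorem dt_mul (f g : LaurentSeries ℂ) : dt (f * g) = f * dt g + g * dt f := by
  obtain ⟨m, a, rfl⟩ : ∃ m a, f = HahnSeries.single m 1 * ofPS a :=
    ⟨_, _, (LaurentSeries.single_order_mul_powerSeriesPart f).symm⟩
  obtain ⟨n, b, rfl⟩ : ∃ n b, g = HahnSeries.single n 1 * ofPS b :=
    ⟨_, _, (LaurentSeries.single_order_mul_powerSeriesPart g).symm⟩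
  -- Writing `k t^(k-1)` as `k * t⁻¹ * t^k` makes the monomials multiplicative in `k`, so the final
  -- identity is pure ring algebra.
  have key : ∀ k : ℤ, (HahnSeries.single (k - 1) (k : ℂ) : LaurentSeries ℂ)
      = HahnSeries.C (k : ℂ) * HahnSeries.single (-1) 1 * HahnSeries.single k 1 := by
    intro k
    rw [HahnSeries.C_apply, HahnSeries.single_mul_single, HahnSeries.single_mul_single]
    congr 1
    · ring_nf
    · simp
  have hs : (HahnSeries.single (m + n) 1 : LaurentSeries ℂ)
      = HahnSeries.single m 1 * HahnSeries.single n 1 := by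
    rw [HahnSeries.single_mul_single, one_mul]
  rw [mul_mul_mul_comm, ← hs, ← map_mul, dt_single_mul, dt_single_mul, dt_single_mul, dt_ofPS,
    dt_ofPS, dt_ofPS, Derivation.leibniz, key, key, key, hs]
  simp only [map_mul, map_add, smul_eq_mul, Int.cast_add]
  ring

theorem dt_C (c : ℂ) : dt (HahnSeries.C c) = 0 := by
  ext n
  rw [coeff_dt, HahnSeries.C_apply]
  by_cases h : n + 1 = 0
  · have : (n : ℂ) + 1 = 0 := by exact_mod_cast h
    simp [this]
  · simp [HahnSeries.coeff_single_of_ne h]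

theorem dt_C_mul (c : ℂ) (f : LaurentSeries ℂ) :
    dt (HahnSeries.C c * f) = HahnSeries.C c * dt f := by
  rw [dt_mul, dt_C, mul_zero, add_zero]

theorem dt_one : dt 1 = 0 := by
  simpa using dt_C 1

/-- Multiplying by `f` avoids the exponent `n - 1`, so the formula keeps its shape for `n = 0` and
for the integer exponents of `dt_zpow`. -/
theorem dt_pow (f : LaurentSeries ℂ) (n : ℕ) :
    dt (f ^ n) * f = HahnSeries.C (n : ℂ) * f ^ n * dt f := by
  induction n with
  | zero => simp [dt_one]
  | succ n ih =>
    rw [pow_succ, dt_mul, add_mul, mul_assoc f, ih]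
    simp only [Nat.cast_succ, map_add, map_one]
    ring

theorem dt_inv (f : LaurentSeries ℂ) : dt f⁻¹ * f = -(f⁻¹ * dt f) := by
  rcases eq_or_ne f 0 with rfl | hf
  · simp
  have h := dt_mul f f⁻¹
  rw [mul_inv_cancel₀ hf, dt_one] at h
  linear_combination -h

theorem dt_zpow (f : LaurentSeries ℂ) (n : ℤ) :
    dt (f ^ n) * f = HahnSeries.C (n : ℂ) * f ^ n * dt f := by
  rcases eq_or_ne f 0 with rfl | hf
  · simp
  obtain ⟨n, rfl | rfl⟩ := n.eq_nat_or_neg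
  · simpa using dt_pow f n
  · have h1 := dt_pow f n
    have h2 := dt_inv (f ^ n)
    rw [zpow_neg, zpow_natCast]
    have hfn : f ^ n ≠ 0 := pow_ne_zero n hf
    have h3 : dt (f ^ n)⁻¹ * f * f ^ n = -((f ^ n)⁻¹ * (HahnSeries.C (n : ℂ) * f ^ n * dt f)) := by
      rw [← h1]
      linear_combination f * h2
    refine mul_right_cancel₀ hfn ?_
    rw [h3]
    simp only [Int.cast_neg, Int.cast_natCast, map_neg]
    ring

/-- For `n = 0` the new coefficient vanishes, so arguments that need a nonzero leading term must
treat that degree separately. -/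
theorem Lead.dt {f : LaurentSeries ℂ} {n : ℤ} {c : ℂ} (h : Lead f n c) :
    Lead (dt f) (n - 1) (n * c) := by
  refine ⟨fun k hk => ?_, ?_⟩
  · rw [coeff_dt, h.1 _ (by omega), mul_zero]
  · rw [coeff_dt, sub_add_cancel, h.2]
    push_cast
    ring

theorem OrdGE.dt {f : LaurentSeries ℂ} {n : ℤ} (h : OrdGE n f) : OrdGE (n - 1) (dt f) :=
  fun k hk => by rw [coeff_dt, h _ (by omega), mul_zero]

theorem OrdGE.dt_zero {f : LaurentSeries ℂ} (h : OrdGE 0 f) : OrdGE 0 (WildDiagram.dt f) := by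
  obtain ⟨g, rfl⟩ := ordGE_zero_iff.1 h
  rw [dt_ofPS]
  exact ordGE_ofPS _

/-- The bound `n ≤ 0` keeps degree `0`, the only one whose coefficient the derivative forgets, out
of the conclusion. -/
theorem ordGE_of_dt {f : LaurentSeries ℂ} {n : ℤ} (hn : n ≤ 0) (h : OrdGE (n - 1) (dt f)) :
    OrdGE n f := by
  intro k hk
  have := h (k - 1) (by omega)
  rw [coeff_dt, sub_add_cancel] at this
  refine (mul_eq_zero.1 this).resolve_left ?_
  push_cast
  rw [sub_add_cancel]
  exact_mod_cast (by omega : k ≠ 0)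

theorem eq_C_of_dt_eq_zero {f : LaurentSeries ℂ} (h : dt f = 0) : f = HahnSeries.C (f.coeff 0) := by
  ext n
  rw [HahnSeries.C_apply]
  by_cases hn : n = 0
  · subst hn
    simp
  · rw [HahnSeries.coeff_single_of_ne hn]
    have := congrArg (fun g => HahnSeries.coeff g (n - 1)) h
    simp only [coeff_dt, sub_add_cancel, HahnSeries.coeff_zero] at this
    refine (mul_eq_zero.1 this).resolve_left ?_
    push_cast
    rw [sub_add_cancel]
    exact_mod_cast hn

/-! ### Substitution and roots in Laurent series -/

/-- `φ` is the substitution `t ↦ σ`. -/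
def IsSub (φ : LaurentSeries ℂ →+* LaurentSeries ℂ) (σ : LaurentSeries ℂ) : Prop :=
  ∃ s : PowerSeries ℂ, σ = ofPS s ∧ PowerSeries.constantCoeff s = 0 ∧ s ≠ 0 ∧
    ∀ g, φ (ofPS g) = ofPS (g.subst s)

/-- Substitution into power series is defined because `σ` has positive order. It sends `X` to a
nonzero element of a field, hence extends to the localization at `X`. -/
theorem exists_isSub {σ : LaurentSeries ℂ} {e : ℤ} {c : ℂ} (h : Lead σ e c) (hc : c ≠ 0)
    (he : 0 < e) : ∃ φ, IsSub φ σ := by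
  obtain ⟨s, rfl⟩ := ordGE_zero_iff.1 (h.1.mono he.le)
  have h0 : PowerSeries.constantCoeff s = 0 := by
    have := h.1 0 he
    rw [PowerSeries.coeff_coe] at this
    simpa using this
  have hs : s ≠ 0 := by
    rintro rfl
    exact h.ne_zero hc (map_zero _)
  have hsub := PowerSeries.HasSubst.of_constantCoeff_zero' h0
  have hu : IsUnit ((ofPS.comp (PowerSeries.substAlgHom (R := ℂ) hsub).toRingHom)
      (PowerSeries.X : PowerSeries ℂ)) := by
    have hX : (PowerSeries.substAlgHom (R := ℂ) hsub) PowerSeries.X = s :=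
      PowerSeries.substAlgHom_X hsub
    rw [RingHom.comp_apply, isUnit_iff_ne_zero]
    change ofPS ((PowerSeries.substAlgHom (R := ℂ) hsub) PowerSeries.X) ≠ 0
    rw [hX]
    exact h.ne_zero hc
  have inst : IsLocalization.Away (PowerSeries.X : PowerSeries ℂ) (LaurentSeries ℂ) :=
    LaurentSeries.of_powerSeries_localization
  refine ⟨IsLocalization.Away.lift PowerSeries.X hu, s, rfl, h0, hs, fun g => ?_⟩
  have h1 := IsLocalization.Away.lift_eq (S := LaurentSeries ℂ) PowerSeries.X hu g
  rw [LaurentSeries.coe_algebraMap] at h1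
  rw [h1, RingHom.comp_apply]
  change ofPS ((PowerSeries.substAlgHom (R := ℂ) hsub) g) = _
  rw [PowerSeries.coe_substAlgHom]

section IsSub

variable {φ : LaurentSeries ℂ →+* LaurentSeries ℂ} {σ : LaurentSeries ℂ}

theorem IsSub.map_single (h : IsSub φ σ) : φ (HahnSeries.single 1 1) = σ := by
  obtain ⟨s, rfl, h0, -, hφ⟩ := h
  rw [← HahnSeries.ofPowerSeries_X, hφ, PowerSeries.subst_X (.of_constantCoeff_zero' h0)]

theorem IsSub.map_C (h : IsSub φ σ) (c : ℂ) : φ (HahnSeries.C c) = HahnSeries.C c := by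
  obtain ⟨s, rfl, h0, -, hφ⟩ := h
  rw [← HahnSeries.ofPowerSeries_C, hφ, PowerSeries.subst_C]
  rfl

theorem single_eq_zpow (n : ℤ) :
    (HahnSeries.single n 1 : LaurentSeries ℂ) = HahnSeries.single 1 1 ^ n := by
  have h (k : ℕ) : (HahnSeries.single (k : ℤ) 1 : LaurentSeries ℂ) = HahnSeries.single 1 1 ^ k := by
    rw [HahnSeries.single_pow]
    simp
  obtain ⟨n, rfl | rfl⟩ := n.eq_nat_or_neg
  · rw [zpow_natCast, h]
  · rw [zpow_neg, zpow_natCast, ← h]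
    refine eq_inv_of_mul_eq_one_left ?_
    rw [HahnSeries.single_mul_single]
    simp

theorem IsSub.ordGE (h : IsSub φ σ) {f : LaurentSeries ℂ} (hf : OrdGE 0 f) : OrdGE 0 (φ f) := by
  obtain ⟨g, rfl⟩ := ordGE_zero_iff.1 hf
  obtain ⟨s, rfl, h0, -, hφ⟩ := h
  rw [hφ]
  exact ordGE_ofPS _

theorem IsSub.lead (h : IsSub φ σ) {e n : ℤ} {c d : ℂ} (hσ : Lead σ e c) (hc : c ≠ 0)
    {f : LaurentSeries ℂ} (he : 0 < e) (hf : Lead f n d) : Lead (φ f) (e * n) (d * c ^ n) := by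
  obtain ⟨g, rfl, rfl⟩ := lead_iff.1 hf
  rw [map_mul, single_eq_zpow, map_zpow₀, h.map_single, mul_comm _ (c ^ n)]
  have : Lead (φ (ofPS g)) 0 (PowerSeries.constantCoeff g) := by
    obtain ⟨a, ha⟩ : ∃ a, g = PowerSeries.X * a + PowerSeries.C (PowerSeries.constantCoeff g) :=
      ⟨_, PowerSeries.eq_X_mul_shift_add_const g⟩
    have hX : ofPS PowerSeries.X = HahnSeries.single 1 1 := HahnSeries.ofPowerSeries_X
    have hC (x : ℂ) : ofPS (PowerSeries.C x) = HahnSeries.C x := HahnSeries.ofPowerSeries_C x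
    have h1 : φ (ofPS g) = HahnSeries.C (PowerSeries.constantCoeff g) + σ * φ (ofPS a) := by
      conv_lhs => rw [ha]
      rw [map_add, map_mul, hX, hC, map_add, map_mul, h.map_single, h.map_C, add_comm]
    rw [h1]
    exact (lead_C _).add_ordGE (hσ.1.mul (h.ordGE (ordGE_ofPS a))) (by omega)
  simpa using (hσ.zpow hc n).mul this

/-- The chain rule is checked on power series and on powers of `t`; every Laurent series is a
product of the two. -/
theorem IsSub.dt (h : IsSub φ σ) (f : LaurentSeries ℂ) :
    WildDiagram.dt (φ f) = φ (WildDiagram.dt f) * WildDiagram.dt σ := by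
  have hps (g : PowerSeries ℂ) :
      WildDiagram.dt (φ (ofPS g)) = φ (WildDiagram.dt (ofPS g)) * WildDiagram.dt σ := by
    obtain ⟨s, rfl, h0, -, hφ⟩ := h
    rw [hφ, dt_ofPS, dt_ofPS, dt_ofPS, hφ,
      PowerSeries.derivative_subst (.of_constantCoeff_zero' h0), map_mul]
  have hσ : σ ≠ 0 := by
    rw [← h.map_single]
    exact (map_ne_zero φ).2 (by simp)
  have hz (n : ℤ) : WildDiagram.dt (φ (HahnSeries.single n 1))
      = φ (WildDiagram.dt (HahnSeries.single n 1)) * WildDiagram.dt σ := by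
    have h1 : (HahnSeries.single 1 1 : LaurentSeries ℂ) ≠ 0 := by simp
    have h2 := dt_zpow σ n
    have h3 := congrArg φ (dt_zpow (HahnSeries.single 1 1) n)
    have h4 : WildDiagram.dt (HahnSeries.single 1 1) = 1 := by
      have := dt_single_mul 1 1
      rw [mul_one, ← map_one HahnSeries.C, dt_C, mul_zero, add_zero] at this
      rw [this]
      simp
    rw [h4] at h3
    simp only [map_mul, map_zpow₀, h.map_single, h.map_C, mul_one] at h3
    rw [single_eq_zpow n, map_zpow₀, h.map_single]
    refine mul_right_cancel₀ hσ ?_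
    rw [h2]
    linear_combination (-WildDiagram.dt σ) * h3
  rw [← LaurentSeries.single_order_mul_powerSeriesPart f, map_mul, dt_mul, dt_mul, map_add,
    map_mul, map_mul, hz, hps]
  ring

/-- Substituting nearby series gives nearby results. -/
theorem IsSub.ordGE_sub {ψ : LaurentSeries ℂ →+* LaurentSeries ℂ} {ρ : LaurentSeries ℂ}
    (h : IsSub φ σ) (h' : IsSub ψ ρ) (hρ : OrdGE 1 ρ) {k : ℤ} (hk : OrdGE k (σ - ρ))
    {f : LaurentSeries ℂ} (hf : OrdGE 0 f) : OrdGE k (φ f - ψ f) := by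
  rcases le_or_gt k 0 with hk0 | hk0
  · exact ((h.ordGE hf).sub (h'.ordGE hf)).mono hk0
  lift k to ℕ using hk0.le
  -- Induction on the precision: splitting off the constant term of `g` leaves a remainder
  -- multiplied by `ρ`, which gains one order.
  have main : ∀ j : ℕ, j ≤ k → ∀ g : PowerSeries ℂ, OrdGE j (φ (ofPS g) - ψ (ofPS g)) := by
    intro j
    induction j with
    | zero => exact fun _ g => (h.ordGE (ordGE_ofPS g)).sub (h'.ordGE (ordGE_ofPS g))
    | succ j ih =>
      intro hj g
      obtain ⟨a, ha⟩ : ∃ a, g = PowerSeries.X * a + PowerSeries.C (PowerSeries.constantCoeff g) :=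
        ⟨_, PowerSeries.eq_X_mul_shift_add_const g⟩
      have hX : ofPS PowerSeries.X = HahnSeries.single 1 1 := HahnSeries.ofPowerSeries_X
      have hC (x : ℂ) : ofPS (PowerSeries.C x) = HahnSeries.C x := HahnSeries.ofPowerSeries_C x
      have h1 : φ (ofPS g) - ψ (ofPS g)
          = (σ - ρ) * φ (ofPS a) + ρ * (φ (ofPS a) - ψ (ofPS a)) := by
        conv_lhs => rw [ha]
        simp only [map_add, map_mul, hX, hC, h.map_single, h.map_C, h'.map_single, h'.map_C]
        ring
      rw [h1]
      refine OrdGE.add ?_ ?_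
      · exact (hk.mul (h.ordGE (ordGE_ofPS a))).mono (by push_cast; omega)
      · exact (hρ.mul (ih (by omega) a)).mono (by push_cast; omega)
  obtain ⟨g, rfl⟩ := ordGE_zero_iff.1 hf
  exact main k le_rfl g

/-- The linear term `b t` of `τ` contributes `b (σ - ρ)`; everything else carries an additional
factor of positive order. -/
theorem IsSub.lead_sub {ψ : LaurentSeries ℂ →+* LaurentSeries ℂ} {ρ : LaurentSeries ℂ}
    (h : IsSub φ σ) (h' : IsSub ψ ρ) (hσ : OrdGE 1 σ) (hρ : OrdGE 1 ρ) {k : ℤ} {d : ℂ}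
    (hk : Lead (σ - ρ) k d) {τ : LaurentSeries ℂ} {b : ℂ} (hτ : Lead τ 1 b) :
    Lead (φ τ - ψ τ) k (b * d) := by
  obtain ⟨g, hg, rfl⟩ := lead_iff.1 hτ
  obtain ⟨a, ha⟩ : ∃ a, g = PowerSeries.X * a + PowerSeries.C (PowerSeries.constantCoeff g) :=
    ⟨_, PowerSeries.eq_X_mul_shift_add_const g⟩
  have hX : ofPS PowerSeries.X = HahnSeries.single 1 1 := HahnSeries.ofPowerSeries_X
  have hC (x : ℂ) : ofPS (PowerSeries.C x) = HahnSeries.C x := HahnSeries.ofPowerSeries_C x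
  rw [hg] at ha
  have h1 : φ (HahnSeries.single 1 1 * ofPS g) - ψ (HahnSeries.single 1 1 * ofPS g)
      = HahnSeries.C b * (σ - ρ) + ((σ - ρ) * ((σ + ρ) * φ (ofPS a))
        + ρ * ρ * (φ (ofPS a) - ψ (ofPS a))) := by
    rw [ha]
    simp only [map_add, map_mul, hX, hC, h.map_single, h.map_C, h'.map_single, h'.map_C]
    ring
  rw [h1]
  refine (hk.C_mul b).add_ordGE (m := k + 1) ?_ (by omega)
  refine OrdGE.add ?_ ?_
  · exact (hk.1.mul ((hσ.add hρ).mul (h.ordGE (ordGE_ofPS a)))).mono (by omega)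
  · exact ((hρ.mul hρ).mul (h.ordGE_sub h' hρ hk.1 (ordGE_ofPS a))).mono (by omega)

end IsSub

/-- Compositional inversion of uniformizers: the equation `τ(μ) = θ` has a solution. -/
theorem exists_isSub_eq {τ θ : LaurentSeries ℂ} {b c : ℂ} {e : ℤ} (hτ : Lead τ 1 b) (hb : b ≠ 0)
    (hθ : Lead θ e c) (hc : c ≠ 0) (he : 0 < e) :
    ∃ φ μ, IsSub φ μ ∧ φ τ = θ ∧ Lead μ e (c / b) := by
  obtain ⟨T, rfl⟩ := ordGE_zero_iff.1 (hτ.1.mono zero_le_one)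
  obtain ⟨Θ, rfl⟩ := ordGE_zero_iff.1 (hθ.1.mono he.le)
  have hT0 : PowerSeries.constantCoeff T = 0 := by
    have := hτ.1 0 one_pos
    rw [PowerSeries.coeff_coe] at this
    simpa using this
  have hΘ0 : PowerSeries.constantCoeff Θ = 0 := by
    have := hθ.1 0 he
    rw [PowerSeries.coeff_coe] at this
    simpa using this
  have hT1 : PowerSeries.coeff 1 T = b := by
    have := hτ.2
    rw [PowerSeries.coeff_coe] at this
    simpa using this
  have hTu : IsUnit (PowerSeries.coeff 1 T) := by
    rw [hT1]
    exact hb.isUnit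
  set R := T.substInvOfIsUnit hTu with hR
  have hRT : T.subst R = PowerSeries.X := PowerSeries.subst_substInvOfIsUnit_right T hT0 hTu
  have hR0 : PowerSeries.HasSubst R := PowerSeries.HasSubst.substInvOfIsUnit T hTu
  have hΘs : PowerSeries.HasSubst Θ := .of_constantCoeff_zero' hΘ0
  obtain ⟨ψ, hψ⟩ := exists_isSub hθ hc he
  have hRlead : Lead (ofPS R) 1 b⁻¹ := by
    refine ⟨fun k hk => ?_, ?_⟩
    · rw [PowerSeries.coeff_coe]
      split_ifs with hk0
      · rfl
      · obtain rfl : k = 0 := by omega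
        have h0 := PowerSeries.constantCoeff_substInvOfIsUnit T hTu
        rw [← hR] at h0
        simpa using h0
    · rw [PowerSeries.coeff_coe]
      have := PowerSeries.coeff_one_substInvOfIsUnit T hTu
      simp only [Int.one_nonneg.not_gt, if_false, Int.natAbs_one, hR]
      rw [this]
      refine eq_inv_of_mul_eq_one_left ?_
      rw [← hT1]
      exact hTu.val_inv_mul
  have hμ := hψ.lead hθ hc he hRlead
  have hμ' : Lead (ψ (ofPS R)) e (c / b) := by
    convert hμ using 1
    · ring
    · rw [zpow_one, div_eq_mul_inv, mul_comm]
  obtain ⟨s, hs, -, -, hψ'⟩ := id hψ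
  obtain rfl : Θ = s := HahnSeries.ofPowerSeries_injective hs
  obtain ⟨φ, hφ⟩ := exists_isSub hμ' (div_ne_zero hc hb) he
  refine ⟨φ, _, hφ, ?_, hμ'⟩
  obtain ⟨s, hs, -, -, hφ'⟩ := hφ
  rw [hψ'] at hs
  obtain rfl : _ = s := HahnSeries.ofPowerSeries_injective hs
  rw [hφ', ← PowerSeries.subst_comp_subst_apply hR0 hΘs, hRT, PowerSeries.subst_X hΘs]

/-- Roots of series close to `1`. -/
theorem exists_root_one_add {g : LaurentSeries ℂ} {h : ℤ} (hg : OrdGE h g) (hh : 0 < h) (r : ℤ)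
    (hr : r ≠ 0) : ∃ w, w ^ r = 1 + g ∧ OrdGE h (w - 1) := by
  have pos : ∀ g : LaurentSeries ℂ, OrdGE h g → ∀ n : ℕ, 0 < n →
      ∃ w, w ^ n = 1 + g ∧ OrdGE h (w - 1) := by
    intro g hg n hn
    rcases eq_or_ne g 0 with rfl | hg0
    · exact ⟨1, by simp, by simpa using ordGE_zero h⟩
    obtain ⟨k, c, hc, hk⟩ := exists_lead hg0
    have hhk := hk.le_of_ordGE hc hg
    obtain ⟨φ, hφ⟩ := exists_isSub hk hc (by omega)
    -- `B = (1 + X)^(1/n)`; the root is obtained by substituting `g` for `X`.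
    set B := PowerSeries.binomialSeries ℂ ((n : ℚ)⁻¹) with hB
    have hpow : ∀ j : ℕ, B ^ j = PowerSeries.binomialSeries ℂ ((j : ℚ) * (n : ℚ)⁻¹) := by
      intro j
      induction j with
      | zero => simp
      | succ j ih =>
        rw [pow_succ, ih, hB, ← PowerSeries.binomialSeries_add]
        congr 1
        push_cast
        ring
    have hn' : (n : ℚ) ≠ 0 := by exact_mod_cast hn.ne'
    have hBn : B ^ n = 1 + PowerSeries.X := by
      rw [hpow, mul_inv_cancel₀ hn']
      have := PowerSeries.binomialSeries_nat (R := ℚ) (A := ℂ) 1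
      simpa using this
    refine ⟨φ (ofPS B), ?_, ?_⟩
    · rw [← map_pow, ← map_pow, hBn, map_add, map_add, map_one, map_one]
      have hX : ofPS PowerSeries.X = HahnSeries.single 1 1 := HahnSeries.ofPowerSeries_X
      rw [hX, hφ.map_single]
    · obtain ⟨a, ha⟩ : ∃ a, B = PowerSeries.X * a + PowerSeries.C (PowerSeries.constantCoeff B) :=
        ⟨_, PowerSeries.eq_X_mul_shift_add_const B⟩
      have hB0 : PowerSeries.constantCoeff B = 1 :=
        PowerSeries.binomialSeries_constantCoeff _
      rw [hB0] at ha
      have hX : ofPS PowerSeries.X = HahnSeries.single 1 1 := HahnSeries.ofPowerSeries_X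
      have : φ (ofPS B) - 1 = g * φ (ofPS a) := by
        rw [ha, map_one, map_add, map_mul, map_one, hX, map_add, map_mul, hφ.map_single, map_one]
        ring
      rw [this]
      exact (hg.mul (hφ.ordGE (ordGE_ofPS a))).mono (by omega)
  obtain ⟨n, rfl | rfl⟩ := r.eq_nat_or_neg
  · obtain ⟨w, hw, hw'⟩ := pos g hg n (by omega)
    exact ⟨w, by simpa using hw, hw'⟩
  · have hl : Lead (1 + g) 0 1 := lead_one.add_ordGE hg hh
    have hne := hl.ne_zero one_ne_zero
    have hinv : (1 + g)⁻¹ = 1 + -(g * (1 + g)⁻¹) := by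
      field_simp
      ring
    obtain ⟨w, hw, hw'⟩ := pos (-(g * (1 + g)⁻¹))
      (OrdGE.neg (by simpa using hg.mul (hl.inv one_ne_zero).1)) n (by omega)
    refine ⟨w, ?_, hw'⟩
    rw [zpow_neg, zpow_natCast, hw, ← hinv, inv_inv]

/-- Roots of Laurent series. -/
theorem exists_root {f : LaurentSeries ℂ} {e r : ℤ} {c : ℂ} (hf : Lead f (e * r) c) (hc : c ≠ 0)
    (hr : r ≠ 0) : ∃ θ d, d ≠ 0 ∧ Lead θ e d ∧ θ ^ r = f := by
  obtain ⟨d, hd⟩ : ∃ d : ℂ, d ^ r = c := by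
    obtain ⟨n, rfl | rfl⟩ := r.eq_nat_or_neg
    · obtain ⟨d, hd⟩ := IsAlgClosed.exists_pow_nat_eq c (show 0 < n by omega)
      exact ⟨d, by simpa using hd⟩
    · obtain ⟨d, hd⟩ := IsAlgClosed.exists_pow_nat_eq c⁻¹ (show 0 < n by omega)
      exact ⟨d, by rw [zpow_neg, zpow_natCast, hd, inv_inv]⟩
  have hd0 : d ≠ 0 := by
    rintro rfl
    exact hc (by rw [← hd, zero_zpow r hr])
  have hs : Lead (HahnSeries.single e d : LaurentSeries ℂ) e d := lead_single e d
  have hs0 := hs.ne_zero hd0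
  have hq := hf.mul ((hs.zpow hd0 r).inv (zpow_ne_zero r hd0))
  rw [hd, mul_inv_cancel₀ hc, add_neg_cancel] at hq
  obtain ⟨w, hw, hw'⟩ := exists_root_one_add (g := f * (HahnSeries.single e d ^ r)⁻¹ - 1)
    (h := 1) (by
      have := hq.sub lead_one
      rw [sub_self] at this
      simpa using this.ordGE_succ) one_pos r hr
  have hw1 : Lead w 0 1 := by
    have := lead_one.add_ordGE hw' one_pos
    rwa [add_sub_cancel] at this
  refine ⟨HahnSeries.single e d * w, d, hd0, by simpa using hs.mul hw1, ?_⟩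
  rw [mul_zpow, hw]
  have := zpow_ne_zero r hs0
  field_simp
  ring

/-- Comparison of powers of nearby series. -/
theorem lead_zpow_sub {μ lam : LaurentSeries ℂ} {e k : ℤ} {c d : ℂ} (hμ : Lead μ e c)
    (hlam : Lead lam e c) (hc : c ≠ 0) (hk : Lead (μ - lam) k d) (n : ℤ) :
    Lead (μ ^ n - lam ^ n) (e * (n - 1) + k) (n * c ^ (n - 1) * d) := by
  have nat : ∀ n : ℕ, Lead (μ ^ n - lam ^ n) (e * (n - 1) + k) (n * c ^ ((n : ℤ) - 1) * d) := by
    intro n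
    induction n with
    | zero =>
      simp only [pow_zero, sub_self, Nat.cast_zero, zero_mul]
      exact (ordGE_zero _).lead (lt_add_one _)
    | succ n ih =>
      have h1 : μ ^ (n + 1) - lam ^ (n + 1) = (μ ^ n - lam ^ n) * μ + lam ^ n * (μ - lam) := by ring
      rw [h1]
      convert (ih.mul hμ).add (g := lam ^ n * (μ - lam)) (d := c ^ n * d) ?_ using 1
      · push_cast
        ring
      · push_cast
        have e1 : c ^ ((n : ℤ) - 1) = c ^ n * c⁻¹ := by rw [zpow_sub_one₀ hc, zpow_natCast]
        have e2 : c ^ ((n : ℤ) + 1 - 1) = c ^ n := by rw [add_sub_cancel_right, zpow_natCast]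
        rw [e1, e2]
        field_simp
      · convert (hlam.pow n).mul hk using 1
        ring
  obtain ⟨n, rfl | rfl⟩ := n.eq_nat_or_neg
  · simpa using nat n
  · have hμ0 := hμ.ne_zero hc
    have hl0 := hlam.ne_zero hc
    have h1 : μ ^ (-(n : ℤ)) - lam ^ (-(n : ℤ))
        = -((μ ^ n - lam ^ n) * (μ ^ (-(n : ℤ)) * lam ^ (-(n : ℤ)))) := by
      rw [zpow_neg, zpow_neg, zpow_natCast, zpow_natCast]
      have := pow_ne_zero n hμ0
      have := pow_ne_zero n hl0
      field_simp
      ring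
    rw [h1]
    convert ((nat n).mul ((hμ.zpow hc (-n)).mul (hlam.zpow hc (-n)))).neg using 1
    · ring
    · push_cast
      have e1 : c ^ (-(n : ℤ) - 1) = c ^ ((n : ℤ) - 1) * (c ^ (-(n : ℤ)) * c ^ (-(n : ℤ))) := by
        rw [← zpow_add₀ hc, ← zpow_add₀ hc]
        congr 1
        ring
      rw [e1]
      ring

/-! ### Coordinates along ramified arcs -/

/-- The constant term of the coordinate at `b`, taken to be `0` at infinity. -/
def kap (b : OnePoint ℂ) : LaurentSeries ℂ := b.elim 0 HahnSeries.C

/-- The sign of the order of the coordinate at `b`. -/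
def eps (b : OnePoint ℂ) : ℤ := b.elim (-1) fun _ => 1

@[simp] theorem kap_infty : kap ∞ = 0 := rfl
@[simp] theorem kap_coe (a : ℂ) : kap a = HahnSeries.C a := rfl
@[simp] theorem eps_infty : eps ∞ = -1 := rfl
@[simp] theorem eps_coe (a : ℂ) : eps a = 1 := rfl

theorem eps_eq (b : OnePoint ℂ) : eps b = 1 ∨ eps b = -1 := by
  induction b using OnePoint.rec <;> simp

theorem eps_ne_zero (b : OnePoint ℂ) : eps b ≠ 0 := by
  rcases eps_eq b with h | h <;> simp [h]

/-- With `kap` and `eps`, finite points and infinity are covered by a single computation. -/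
theorem coordAlong_eq (b : OnePoint ℂ) (r : ℕ) (τ : LaurentSeries ℂ) :
    coordAlong b r τ = kap b + τ ^ (eps b * r) := by
  induction b using OnePoint.rec with
  | infty => simp [coordAlong]
  | coe a => simp [coordAlong]

theorem dt_kap (b : OnePoint ℂ) : dt (kap b) = 0 := by
  induction b using OnePoint.rec with
  | infty => simp
  | coe a => exact dt_C a

theorem ordGE_kap (b : OnePoint ℂ) : OrdGE 0 (kap b) := by
  induction b using OnePoint.rec with
  | infty => exact ordGE_zero 0
  | coe a => exact ordGE_C a

theorem IsSub.map_kap {φ : LaurentSeries ℂ →+* LaurentSeries ℂ} {σ : LaurentSeries ℂ}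
    (h : IsSub φ σ) (b : OnePoint ℂ) : φ (kap b) = kap b := by
  induction b using OnePoint.rec with
  | infty => simp
  | coe a => exact h.map_C a

theorem IsSub.map_coordAlong {φ : LaurentSeries ℂ →+* LaurentSeries ℂ} {σ : LaurentSeries ℂ}
    (h : IsSub φ σ) (b : OnePoint ℂ) (r : ℕ) (τ : LaurentSeries ℂ) :
    φ (coordAlong b r τ) = coordAlong b r (φ τ) := by
  rw [coordAlong_eq, coordAlong_eq, map_add, h.map_kap, map_zpow₀]

theorem lead_zpow_coord {τ : LaurentSeries ℂ} {c : ℂ} (hτ : Lead τ 1 c) (hc : c ≠ 0) (n : ℤ) :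
    Lead (τ ^ n) n (c ^ n) := by simpa using hτ.zpow hc n

theorem lead_dt_coordAlong {τ : LaurentSeries ℂ} {c : ℂ} (hτ : Lead τ 1 c) (hc : c ≠ 0)
    (b : OnePoint ℂ) {r : ℕ} (hr : 0 < r) :
    ∃ d ≠ 0, Lead (dt (coordAlong b r τ)) (eps b * r - 1) d := by
  have h := (lead_zpow_coord hτ hc (eps b * r)).dt
  have h0 : ((eps b * r : ℤ) : ℂ) ≠ 0 := by
    exact_mod_cast mul_ne_zero (eps_ne_zero b) (by omega)
  refine ⟨_, mul_ne_zero h0 (zpow_ne_zero (eps b * r) hc), ?_⟩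
  rwa [coordAlong_eq, map_add, dt_kap, zero_add]

/-- Every nonconstant Laurent series is a ramified coordinate at some point. -/
theorem exists_coordAlong {ξ : LaurentSeries ℂ} (hξ : dt ξ ≠ 0) :
    ∃ (b : OnePoint ℂ) (r : ℕ) (τ : LaurentSeries ℂ) (c : ℂ),
      0 < r ∧ c ≠ 0 ∧ Lead τ 1 c ∧ ξ = coordAlong b r τ := by
  have hξ0 : ξ ≠ 0 := by
    rintro rfl
    simp at hξ
  obtain ⟨n, a, ha, hn⟩ := exists_lead hξ0
  rcases lt_or_ge n 0 with hneg | hpos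
  · obtain ⟨r, rfl⟩ : ∃ r : ℕ, n = 1 * -(r : ℤ) := ⟨(-n).toNat, by omega⟩
    obtain ⟨τ, c, hc, hτ, h⟩ := exists_root hn ha (by omega)
    exact ⟨∞, r, τ, c, by omega, hc, hτ, by simp [coordAlong_eq, ← h]⟩
  -- Without a pole, the constant term is the finite limit point and the order of the remainder is
  -- the ramification.
  · set ξ' := ξ - HahnSeries.C (ξ.coeff 0) with hξ'
    have h0 : ξ' ≠ 0 := by
      intro h
      rw [sub_eq_zero.1 h, dt_C] at hξ
      exact hξ rfl
    have hge : OrdGE 1 ξ' := by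
      refine Lead.ordGE_succ (n := 0) ⟨(hn.1.mono hpos).sub (ordGE_C _), ?_⟩
      simp [hξ']
    obtain ⟨m, d, hd, hm⟩ := exists_lead h0
    have := hm.le_of_ordGE hd hge
    obtain ⟨r, rfl⟩ : ∃ r : ℕ, m = 1 * (r : ℤ) := ⟨m.toNat, by omega⟩
    obtain ⟨τ, c, hc, hτ, h⟩ := exists_root hm hd (by omega)
    refine ⟨(ξ.coeff 0 : ℂ), r, τ, c, by omega, hc, hτ, ?_⟩
    rw [coordAlong_eq, eps_coe, one_mul, h, kap_coe, hξ']
    ring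

/-! ### Evaluation of exponential factors -/

namespace ExpFactor

theorem ram_dvd_iff {q : ExpFactor} {r : ℕ} : q.ram ∣ r ↔ ∀ k ∈ q.support, k.1.den ∣ r :=
  Finset.lcm_dvd_iff

theorem ram_pos (q : ExpFactor) : 0 < q.ram := by
  rw [Nat.pos_iff_ne_zero, ram, Ne, Finset.lcm_eq_zero_iff]
  rintro ⟨k, -, hk⟩
  exact k.1.den_ne_zero hk

theorem ram_add_dvd {p q : ExpFactor} {r : ℕ} (hp : p.ram ∣ r) (hq : q.ram ∣ r) :
    (p + q).ram ∣ r := by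
  classical
  rw [ram_dvd_iff] at *
  intro k hk
  rcases Finset.mem_union.1 (Finsupp.support_add hk) with h | h
  exacts [hp k h, hq k h]

theorem ram_neg (q : ExpFactor) : (-q).ram = q.ram := by simp [ram, Finsupp.support_neg]

theorem ram_sub_dvd {p q : ExpFactor} {r : ℕ} (hp : p.ram ∣ r) (hq : q.ram ∣ r) :
    (p - q).ram ∣ r := by
  rw [sub_eq_add_neg]
  exact ram_add_dvd hp (by rwa [ram_neg])

@[simp] theorem ram_zero : ram 0 = 1 := by simp [ram]

theorem ram_rotate (m : ℤ) (q : ExpFactor) : (rotate m q).ram = q.ram := by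
  simp [ram, support_rotate]

theorem slope_rotate (m : ℤ) (q : ExpFactor) : (rotate m q).slope = q.slope := by
  simp [slope, support_rotate]

theorem slope_neg (q : ExpFactor) : (-q).slope = q.slope := by simp [slope, Finsupp.support_neg]

/-- The floor in `ExpFactor.along` loses nothing once the denominators divide `r`. -/
theorem floor_eq {k : Exponent} {r : ℕ} (h : k.1.den ∣ r) :
    ((⌊k.1 * (r : ℚ≥0)⌋₊ : ℕ) : ℚ≥0) = k.1 * r := by
  obtain ⟨m, rfl⟩ := h
  have : k.1 * ((k.1.den * m : ℕ) : ℚ≥0) = ((k.1.num * m : ℕ) : ℚ≥0) := by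
    push_cast
    rw [← mul_assoc, NNRat.mul_den_eq_num]
  rw [this, Nat.floor_natCast]

theorem along_zero (r : ℕ) (τ : LaurentSeries ℂ) : along 0 r τ = 0 := Finsupp.sum_zero_index

theorem along_add (p q : ExpFactor) (r : ℕ) (τ : LaurentSeries ℂ) :
    (p + q).along r τ = p.along r τ + q.along r τ :=
  Finsupp.sum_add_index' (fun _ => by simp) fun _ _ _ => by rw [map_add, add_mul]

theorem along_neg (q : ExpFactor) (r : ℕ) (τ : LaurentSeries ℂ) :
    (-q).along r τ = -q.along r τ := by
  rw [eq_neg_iff_add_eq_zero, ← along_add, neg_add_cancel, along_zero]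

theorem along_sub (p q : ExpFactor) (r : ℕ) (τ : LaurentSeries ℂ) :
    (p - q).along r τ = p.along r τ - q.along r τ := by
  rw [sub_eq_add_neg, along_add, along_neg, sub_eq_add_neg]

theorem along_single (k : Exponent) (c : ℂ) (r : ℕ) (τ : LaurentSeries ℂ) :
    along (Finsupp.single k c) r τ
      = HahnSeries.C c * τ ^ (-(⌊k.1 * (r : ℚ≥0)⌋₊ : ℤ)) :=
  Finsupp.sum_single_index (by simp)

theorem along_monomial (n : ℕ) (hn : 0 < n) (c : ℂ) (r : ℕ) (τ : LaurentSeries ℂ) :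
    (monomial n hn c).along r τ = HahnSeries.C c * τ ^ (-((n * r : ℕ) : ℤ)) := by
  rw [monomial, along_single]
  congr 3
  rw [natExp, ← Nat.cast_mul, Nat.floor_natCast]

theorem ram_monomial (n : ℕ) (hn : 0 < n) (c : ℂ) : (monomial n hn c).ram = 1 := by
  rw [← Nat.dvd_one, ram_dvd_iff]
  intro k hk
  obtain rfl := Finset.mem_singleton.1 (Finsupp.support_single_subset hk)
  simp [natExp]

theorem map_along {φ : LaurentSeries ℂ →+* LaurentSeries ℂ} {σ : LaurentSeries ℂ}
    (h : IsSub φ σ) (q : ExpFactor) (r : ℕ) (τ : LaurentSeries ℂ) :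
    φ (q.along r τ) = q.along r (φ τ) := by
  rw [along, along, Finsupp.sum, Finsupp.sum, map_sum]
  exact Finset.sum_congr rfl fun k _ => by rw [map_mul, h.map_C, map_zpow₀]

theorem along_mul {q : ExpFactor} {r : ℕ} (hr : q.ram ∣ r) (m : ℕ) (τ : LaurentSeries ℂ) :
    q.along (m * r) τ = q.along r (τ ^ m) := by
  refine Finset.sum_congr rfl fun k hk => ?_
  have hd := ram_dvd_iff.1 hr k hk
  have : ⌊k.1 * ((m * r : ℕ) : ℚ≥0)⌋₊ = m * ⌊k.1 * (r : ℚ≥0)⌋₊ := by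
    have h : ((⌊k.1 * ((m * r : ℕ) : ℚ≥0)⌋₊ : ℕ) : ℚ≥0)
        = ((m * ⌊k.1 * (r : ℚ≥0)⌋₊ : ℕ) : ℚ≥0) := by
      rw [floor_eq (hd.mul_left m), Nat.cast_mul m ⌊_⌋₊, floor_eq hd, Nat.cast_mul]
      ring
    exact_mod_cast h
  dsimp only
  rw [this, Nat.cast_mul]
  rw [← zpow_natCast τ m, ← zpow_mul, mul_neg]

/-- The pole order of `q` at `z_a = t ^ r`. -/
theorem exists_natCast_eq_slope_mul {q : ExpFactor} {r : ℕ} (hr : q.ram ∣ r) :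
    ∃ n : ℕ, (n : ℚ≥0) = q.slope * r := by
  rcases eq_or_ne q 0 with rfl | hq
  · exact ⟨0, by simp [slope]⟩
  obtain ⟨k, hk, hk'⟩ := Finset.exists_mem_eq_sup q.support
    (Finsupp.support_nonempty_iff.2 hq) fun k => k.1
  refine ⟨⌊k.1 * (r : ℚ≥0)⌋₊, ?_⟩
  rw [floor_eq (ram_dvd_iff.1 hr k hk), slope, hk']

/-- Distinct exponents give distinct pole orders, so the term of largest exponent dominates without
cancellation. -/
theorem lead_along {q : ExpFactor} {r : ℕ} (hq : q ≠ 0) (hr : q.ram ∣ r) (hr0 : 0 < r)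
    {τ : LaurentSeries ℂ} {c : ℂ} (hτ : Lead τ 1 c) (hc : c ≠ 0) :
    ∃ (n : ℕ) (d : ℂ), 0 < n ∧ (n : ℚ≥0) = q.slope * r ∧ d ≠ 0 ∧ Lead (q.along r τ) (-n) d := by
  obtain ⟨k, hk, hk'⟩ := Finset.exists_mem_eq_sup q.support
    (Finsupp.support_nonempty_iff.2 hq) fun k => k.1
  have hfl := floor_eq (ram_dvd_iff.1 hr k hk)
  have hr1 : (0 : ℚ≥0) < r := by exact_mod_cast hr0
  refine ⟨⌊k.1 * (r : ℚ≥0)⌋₊, q k * c ^ (-(⌊k.1 * (r : ℚ≥0)⌋₊ : ℤ)), ?_, ?_, ?_, ?_⟩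
  · have : (0 : ℚ≥0) < (⌊k.1 * (r : ℚ≥0)⌋₊ : ℕ) := by
      rw [hfl]
      exact mul_pos k.2 hr1
    exact_mod_cast this
  · rw [hfl, slope, hk']
  · exact mul_ne_zero (Finsupp.mem_support_iff.1 hk) (zpow_ne_zero _ hc)
  · classical
    rw [along, Finsupp.sum, ← Finset.add_sum_erase _ _ hk]
    have h1 := (lead_zpow_coord hτ hc (-(⌊k.1 * (r : ℚ≥0)⌋₊ : ℤ))).C_mul (q k)
    refine h1.add_ordGE (m := -(⌊k.1 * (r : ℚ≥0)⌋₊ : ℤ) + 1) (ordGE_sum _ fun j hj => ?_)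
      (lt_add_one _)
    obtain ⟨hjk, hj⟩ := Finset.mem_erase.1 hj
    have hfj := floor_eq (ram_dvd_iff.1 hr j hj)
    have hlt : j.1 < k.1 := by
      refine lt_of_le_of_ne ?_ fun h => hjk (Subtype.ext h)
      rw [← hk']
      exact Finset.le_sup (f := fun k : Exponent => k.1) hj
    have : ⌊j.1 * (r : ℚ≥0)⌋₊ < ⌊k.1 * (r : ℚ≥0)⌋₊ := by
      have h : ((⌊j.1 * (r : ℚ≥0)⌋₊ : ℕ) : ℚ≥0) < (⌊k.1 * (r : ℚ≥0)⌋₊ : ℕ) := by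
        rw [hfl, hfj]
        exact mul_lt_mul_of_pos_right hlt hr1
      exact_mod_cast h
    exact ((lead_zpow_coord hτ hc _).1.C_mul _).mono (by omega)

/-- An exponential factor has only polar terms. This is the uniqueness principle: its values modulo
power series determine it. -/
theorem eq_zero_of_ordGE_along {q : ExpFactor} {r : ℕ} (hr : q.ram ∣ r) (hr0 : 0 < r)
    {τ : LaurentSeries ℂ} {c : ℂ} (hτ : Lead τ 1 c) (hc : c ≠ 0) (h : OrdGE 0 (q.along r τ)) :
    q = 0 := by
  by_contra hq
  obtain ⟨n, d, hn, -, hd, hl⟩ := lead_along hq hr hr0 hτ hc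
  have := hl.le_of_ordGE hd h
  omega

/-- A change of determination amounts to multiplying the `r`-th root of the local coordinate by an
`r`-th root of unity. -/
theorem along_rotate {q : ExpFactor} {r : ℕ} (hr : q.ram ∣ r) (hr0 : 0 < r) (j : ℤ)
    (τ : LaurentSeries ℂ) :
    (rotate j q).along r τ
      = q.along r (HahnSeries.C (Complex.exp (2 * Real.pi * Complex.I * j / r)) * τ) := by
  rw [along, along, Finsupp.sum, Finsupp.sum, support_rotate]
  refine Finset.sum_congr rfl fun k hk => ?_
  have hfl := floor_eq (ram_dvd_iff.1 hr k hk)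
  have hfl' : ((⌊k.1 * (r : ℚ≥0)⌋₊ : ℕ) : ℂ) = (k.1 : ℂ) * r := by
    have := congrArg (fun x : ℚ≥0 => (x : ℂ)) hfl
    simpa using this
  have hr1 : (r : ℂ) ≠ 0 := by exact_mod_cast hr0.ne'
  rw [rotate_apply, mul_zpow, ← map_zpow₀, ← mul_assoc, ← map_mul, mul_comm (q k)]
  congr 3
  rw [← Complex.exp_int_mul]
  congr 1
  rw [Int.cast_neg, Int.cast_natCast, hfl']
  field_simp

theorem exists_principalPart {τ : LaurentSeries ℂ} {c : ℂ} (hτ : Lead τ 1 c) (hc : c ≠ 0) {r : ℕ}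
    (hr : 0 < r) (P : LaurentSeries ℂ) :
    ∃ p : ExpFactor, p.ram ∣ r ∧ OrdGE 0 (P - p.along r τ) := by
  have main : ∀ (n : ℕ) (P : LaurentSeries ℂ), OrdGE (-n) P →
      ∃ p : ExpFactor, p.ram ∣ r ∧ OrdGE 0 (P - p.along r τ) := by
    intro n
    induction n with
    | zero => exact fun P hP => ⟨0, by simp, by simpa [along_zero] using hP⟩
    | succ n ih =>
      intro P hP
      have hr1 : (r : ℚ≥0) ≠ 0 := by exact_mod_cast hr.ne'
      -- The exponent `(n + 1) / r` evaluates to `τ ^ (-(n + 1))`; the factor `c ^ (n + 1)` in `p₁`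
      -- compensates the leading coefficient of `τ`, so the deepest polar term of `P` is removed.
      set k : Exponent := ⟨((n + 1 : ℕ) : ℚ≥0) / r, by positivity⟩ with hk
      have hden : k.1.den ∣ r := by
        have h1 : k.1 * r = ((n + 1 : ℕ) : ℚ≥0) := div_mul_cancel₀ _ hr1
        have h2 : (k.1.num * r : ℕ) = (n + 1) * k.1.den := by
          have h3 : ((k.1.num * r : ℕ) : ℚ≥0) = (((n + 1) * k.1.den : ℕ) : ℚ≥0) := by
            rw [Nat.cast_mul, Nat.cast_mul, ← h1, ← NNRat.mul_den_eq_num]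
            ring
          exact_mod_cast h3
        exact k.1.coprime_num_den.symm.dvd_of_dvd_mul_left ⟨n + 1, by rw [h2, mul_comm]⟩
      have hfl : ⌊k.1 * (r : ℚ≥0)⌋₊ = n + 1 := by
        rw [hk, div_mul_cancel₀ _ hr1, Nat.floor_natCast]
      set a := P.coeff (-(n + 1 : ℕ)) with ha
      set p₁ : ExpFactor := Finsupp.single k (a * c ^ (n + 1)) with hp₁
      have hl : Lead (p₁.along r τ) (-(n + 1 : ℕ)) a := by
        rw [hp₁, along_single, hfl]
        convert (lead_zpow_coord hτ hc (-((n + 1 : ℕ) : ℤ))).C_mul (a * c ^ (n + 1)) using 1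
        rw [zpow_neg, zpow_natCast, mul_assoc, mul_inv_cancel₀ (pow_ne_zero _ hc), mul_one]
      obtain ⟨p₂, hp₂, h₂⟩ := ih (P - p₁.along r τ) (by
        have hPl : Lead P (-(n + 1 : ℕ)) a := ⟨hP, rfl⟩
        have := hPl.sub hl
        rw [sub_self] at this
        exact this.ordGE_succ.mono (by push_cast; omega))
      refine ⟨p₁ + p₂, ram_add_dvd ?_ hp₂, ?_⟩
      · rw [ram_dvd_iff]
        intro j hj
        obtain rfl := Finset.mem_singleton.1 (Finsupp.support_single_subset hj)
        exact hden
      · rwa [along_add, ← sub_sub]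
  obtain ⟨n, hn⟩ : ∃ n : ℕ, OrdGE (-n) P := by
    refine ⟨(-P.order).toNat, (lead_order P).1.mono ?_⟩
    omega
  exact main n P hn

end ExpFactor

/-! ### Parametrized curves representing circles -/

/-- The uniformizer of the field of Laurent series. -/
def unif : LaurentSeries ℂ := HahnSeries.single 1 1

theorem lead_unif : Lead unif 1 1 := lead_single 1 1

/-- The curve `v = (z, ξ)` represents the circle `⟨q⟩_a` with ramification `r`: the coordinate `z`
is ramified of order `r` at `a`, and `ξ dz = dq` up to the differential of a power series. -/
def Rep (v : LaurentSeries ℂ × LaurentSeries ℂ) (a : OnePoint ℂ) (q : ExpFactor) (r : ℕ) : Prop :=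
  0 < r ∧ q.ram ∣ r ∧ ∃ (σ : LaurentSeries ℂ) (c : ℂ), c ≠ 0 ∧ Lead σ 1 c ∧
    v.1 = coordAlong a r σ ∧ OrdGE 0 (v.2 * dt v.1 - dt (q.along r σ))

theorem OrdGE.of_mul {f g : LaurentSeries ℂ} {k n : ℤ} {d : ℂ} (h : OrdGE k (f * g))
    (hg : Lead g n d) (hd : d ≠ 0) : OrdGE (k - n) f := by
  have := h.mul (hg.inv hd).1
  rwa [mul_inv_cancel_right₀ (hg.ne_zero hd), ← sub_eq_add_neg] at this

theorem ordGE_one_add_pow {x : LaurentSeries ℂ} {h : ℤ} (hh : 0 ≤ h) (hx : OrdGE h (x - 1))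
    (m : ℕ) : OrdGE h (x ^ m - 1) := by
  have hx0 : OrdGE 0 x := by
    simpa using (hx.mono hh).add lead_one.1
  induction m with
  | zero => simpa using ordGE_zero h
  | succ m ih =>
    have : x ^ (m + 1) - 1 = (x ^ m - 1) * x + (x - 1) := by ring
    rw [this]
    exact ((ih.mul hx0).mono (by omega)).add hx

/-- The limit of the coordinate determines the point and its order determines the ramification. Then
`(τ / σ) ^ r = 1`, so `τ / σ` has zero derivative and is a constant root of unity. -/
theorem coordAlong_unique {a b : OnePoint ℂ} {r s : ℕ} {σ τ : LaurentSeries ℂ} {c d : ℂ}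
    (hr : 0 < r) (hs : 0 < s) (hσ : Lead σ 1 c) (hc : c ≠ 0) (hτ : Lead τ 1 d) (hd : d ≠ 0)
    (h : coordAlong a r σ = coordAlong b s τ) :
    a = b ∧ r = s ∧ ∃ j : ℤ,
      τ = HahnSeries.C (Complex.exp (2 * Real.pi * Complex.I * j / r)) * σ := by
  have lσ := lead_zpow_coord hσ hc (eps a * r)
  have lτ := lead_zpow_coord hτ hd (eps b * s)
  rw [coordAlong_eq, coordAlong_eq] at h
  have hab : a = b := by
    induction a using OnePoint.rec with
    | infty =>
      induction b using OnePoint.rec with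
      | infty => rfl
      | coe b =>
        simp only [kap_infty, zero_add, eps_infty, eps_coe, kap_coe, one_mul] at h lσ lτ
        have := lσ.le_of_ordGE (m := 0) (zpow_ne_zero _ hc)
          (by rw [h]; exact (ordGE_C b).add (lτ.1.mono (by omega)))
        omega
    | coe a =>
      induction b using OnePoint.rec with
      | infty =>
        simp only [kap_infty, zero_add, eps_infty, eps_coe, kap_coe, one_mul] at h lσ lτ
        have := lτ.le_of_ordGE (m := 0) (zpow_ne_zero _ hd)
          (by rw [← h]; exact (ordGE_C a).add (lσ.1.mono (by omega)))
        omega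
      | coe b =>
        simp only [eps_coe, kap_coe, one_mul] at h lσ lτ
        have h1 := (lead_C a).add_ordGE lσ.1 (by omega)
        have h2 := (lead_C b).add_ordGE lτ.1 (by omega)
        rw [h] at h1
        rw [h1.2.symm.trans h2.2]
  subst hab
  have h := add_left_cancel h
  rw [← h] at lτ
  obtain ⟨h1, -⟩ := lσ.unique lτ (zpow_ne_zero _ hc) (zpow_ne_zero _ hd)
  have hrs : r = s := by exact_mod_cast mul_left_cancel₀ (eps_ne_zero a) h1
  subst hrs
  refine ⟨rfl, rfl, ?_⟩
  have hσ0 := hσ.ne_zero hc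
  have hτ0 := hτ.ne_zero hd
  have hpow : σ ^ r = τ ^ r := by
    rcases eps_eq a with he | he
    · rw [he] at h
      simpa using h
    · rw [he] at h
      simpa using h
  have hu : (τ / σ) ^ r = 1 := by rw [div_pow, hpow, div_self (pow_ne_zero _ hτ0)]
  have hu0 : dt (τ / σ) = 0 := by
    have h1 := dt_pow (τ / σ) r
    rw [hu, dt_one, zero_mul, mul_one] at h1
    refine (mul_eq_zero.1 h1.symm).resolve_left ?_
    intro h0
    rw [map_eq_zero] at h0
    exact hr.ne' (by exact_mod_cast h0)
  have hC := eq_C_of_dt_eq_zero hu0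
  set ζ := (τ / σ).coeff 0
  have hζ : ζ ^ r = 1 := by
    rw [hC, ← map_pow] at hu
    exact HahnSeries.C_injective (by rw [hu, map_one])
  have := NeZero.mk hr.ne'
  obtain ⟨j, -, hj⟩ := (Complex.isPrimitiveRoot_exp r hr.ne').eq_pow_of_pow_eq_one hζ
  refine ⟨j, ?_⟩
  have : Complex.exp (2 * Real.pi * Complex.I * (j : ℤ) / r) = ζ := by
    rw [← hj, ← Complex.exp_nat_mul]
    congr 1
    push_cast
    ring
  rw [this, ← hC, div_mul_cancel₀ _ hσ0]

/-- Once the uniformizers agree up to a root of unity, absorbed in a rotation of `p`, both factors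
have the differential `ξ dz` modulo regular terms, so their difference has no pole. -/
theorem Rep.unique {v : LaurentSeries ℂ × LaurentSeries ℂ} {a b : OnePoint ℂ} {q p : ExpFactor}
    {r s : ℕ} (h : Rep v a q r) (h' : Rep v b p s) :
    a = b ∧ r = s ∧ (⟦q⟧ : LocalCircle) = ⟦p⟧ := by
  obtain ⟨hr, hqr, σ, c, hc, hσ, hz, hq⟩ := h
  obtain ⟨hs, hps, τ, d, hd, hτ, hz', hp⟩ := h'
  obtain ⟨rfl, rfl, j, rfl⟩ := coordAlong_unique hr hs hσ hc hτ hd (hz.symm.trans hz')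
  refine ⟨rfl, rfl, ?_⟩
  rw [← ExpFactor.along_rotate hps hr] at hp
  have h1 : OrdGE 0 ((q - ExpFactor.rotate j p).along r σ) := by
    refine ordGE_of_dt le_rfl ?_
    rw [ExpFactor.along_sub, map_sub]
    refine OrdGE.mono ?_ (show (0 : ℤ) - 1 ≤ 0 by omega)
    convert hp.sub hq using 1
    ring
  have h2 := ExpFactor.eq_zero_of_ordGE_along
    (ExpFactor.ram_sub_dvd hqr (by rwa [ExpFactor.ram_rotate])) hr hσ hc h1
  rw [sub_eq_zero.1 h2]
  exact (Quotient.sound ⟨j, rfl⟩ : (⟦p⟧ : LocalCircle) = _).symm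

/-! ### The stationary phase -/

/-- The Legendre transform `⟨q⟩_a ↦ ⟨p⟩_b` outside the tame and pure cases, `r'` being the
ramification of the dual coordinate. -/
def Stationary (a : OnePoint ℂ) (q : ExpFactor) (b : OnePoint ℂ) (p : ExpFactor) (r' : ℕ) : Prop :=
  0 < r' ∧ p.ram ∣ r' ∧ ∃ (τ : LaurentSeries ℂ) (c : ℂ), c ≠ 0 ∧ Lead τ 1 c ∧
    coordAlong b r' τ * dt (coordAlong a q.ram unif) = dt (q.along q.ram unif) ∧
    OrdGE 0 (p.along r' τ - (q.along q.ram unif - coordAlong b r' τ * coordAlong a q.ram unif))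

theorem legendreTransform_iff {a : OnePoint ℂ} {q : ExpFactor} {b : OnePoint ℂ} {p : ExpFactor} :
    LegendreTransform a q b p ↔
      (∃ x : ℂ, a = x ∧ q = 0 ∧ b = ∞ ∧ p = monomial 1 one_pos (-x)) ∨
      (∃ x : ℂ, a = ∞ ∧ q = monomial 1 one_pos x ∧ b = x ∧ p = 0) ∨
      ∃ r', Stationary a q b p r' := by
  constructor
  · rintro (x | x | ⟨_, _, _, _, r', hr', hp, t, τ, z, ξ, Q, P, rfl, hτ, rfl, rfl, rfl, rfl, hd, hv⟩)
    · exact .inl ⟨x, rfl, rfl, rfl, rfl⟩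
    · exact .inr (.inl ⟨x, rfl, rfl, rfl, rfl⟩)
    · obtain ⟨c, hc, hl⟩ := lead_of_order one_ne_zero hτ
      exact .inr (.inr ⟨r', hr', hp, τ, c, hc, hl, hd, ordGE_zero_iff.2 hv⟩)
  · rintro (⟨x, rfl, rfl, rfl, rfl⟩ | ⟨x, rfl, rfl, rfl, rfl⟩ | ⟨r', hr', hp, τ, c, hc, hl, hd, hv⟩)
    · exact .tame x
    · exact .pure x
    · exact .stationary a q b p r' hr' hp _ τ _ _ _ _ rfl (hl.order_eq hc) rfl rfl rfl rfl hd
        (ordGE_zero_iff.1 hv)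

namespace ExpFactor

/-- The exponent of the linear term at infinity. -/
abbrev linExp : Exponent := natExp 1 one_pos

theorem ram_erase_linExp (q : ExpFactor) : ram (q.erase linExp) = q.ram := by
  refine Nat.dvd_antisymm ?_ ?_
  · rw [ram_dvd_iff]
    intro k hk
    rw [Finsupp.support_erase] at hk
    exact ram_dvd_iff.1 dvd_rfl k (Finset.mem_of_mem_erase hk)
  · rw [ram_dvd_iff]
    intro k hk
    by_cases h : k = linExp
    · subst h
      simp [natExp]
    · refine ram_dvd_iff.1 dvd_rfl k ?_
      rw [Finsupp.support_erase]
      exact Finset.mem_erase.2 ⟨h, hk⟩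

theorem slope_erase_linExp {q : ExpFactor} (h : q.slope ≠ 1) : slope (q.erase linExp) = q.slope := by
  have hle : slope (q.erase linExp) ≤ q.slope := by
    rw [slope, slope, Finsupp.support_erase]
    exact Finset.sup_mono (Finset.erase_subset _ _)
  refine le_antisymm hle ?_
  rcases eq_or_ne q 0 with rfl | hq
  · simp [slope]
  obtain ⟨k, hk, hk'⟩ := Finset.exists_mem_eq_sup q.support
    (Finsupp.support_nonempty_iff.2 hq) fun k => k.1
  rw [slope, hk', slope, Finsupp.support_erase]
  refine Finset.le_sup (f := fun k : Exponent => k.1) (Finset.mem_erase.2 ⟨?_, hk⟩)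
  rintro rfl
  exact h (by rw [slope, hk']; simp [natExp])

theorem erase_sub_monomial (q : ExpFactor) (c : ℂ) :
    (q - monomial 1 one_pos c).erase linExp = q.erase linExp := by
  ext k
  by_cases h : k = linExp
  · subst h
    simp
  · rw [Finsupp.erase_ne h, Finsupp.erase_ne h, Finsupp.sub_apply, monomial,
      Finsupp.single_eq_of_ne (Ne.symm (Ne.symm h)), sub_zero]

end ExpFactor

/-- The orders of the two coordinates of the exact curve add up to minus the irregularity. -/
theorem Stationary.order_add {a : OnePoint ℂ} {q : ExpFactor} {b : OnePoint ℂ} {p : ExpFactor}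
    {r' : ℕ} (h : Stationary a q b p r') :
    eps a * q.ram + eps b * r' = -(hessianIrr a q : ℤ) ∧ 0 < hessianIrr a q := by
  obtain ⟨hr', -, τ, c, hc, hτ, hd, -⟩ := h
  have hr := q.ram_pos
  have lτ := lead_zpow_coord hτ hc (eps b * r')
  have hne : coordAlong b r' τ ≠ 0 := by
    obtain ⟨d, hd, hl⟩ := lead_dt_coordAlong hτ hc b hr'
    intro h0
    rw [h0, map_zero] at hl
    exact hl.ne_zero hd rfl
  obtain ⟨e, he, hz⟩ := lead_dt_coordAlong lead_unif one_ne_zero a hr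
  -- The orders of the two sides of `ξ dz = dq` are compared. Removing the constant term of `ξ` at a
  -- finite limit point subtracts a linear term from `q`, hence the auxiliary factor `q'`.
  have key : ∀ q' : ExpFactor, q'.ram ∣ q.ram →
      dt (q'.along q.ram unif) = τ ^ (eps b * r') * dt (coordAlong a q.ram unif) →
      ∃ n : ℕ, 0 < n ∧ (n : ℚ≥0) = q'.slope * q.ram ∧ eps a * q.ram + eps b * r' = -(n : ℤ) := by
    intro q' hq' heq
    have hl := lτ.mul hz
    rw [← heq] at hl
    have hl0 := mul_ne_zero (zpow_ne_zero (eps b * r') hc) he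
    have hq0 : q' ≠ 0 := by
      rintro rfl
      rw [ExpFactor.along_zero, map_zero] at hl
      exact hl.ne_zero hl0 rfl
    obtain ⟨n, d, hn, hn', hd', hl'⟩ := ExpFactor.lead_along hq0 hq' hr lead_unif one_ne_zero
    refine ⟨n, hn, hn', ?_⟩
    have := (hl.unique hl'.dt hl0 (mul_ne_zero (by push_cast; simpa using hn.ne') hd')).1
    omega
  induction a using OnePoint.rec with
  | coe a =>
    have hh : hessianIrr a q = q.irr := by simp [hessianIrr]
    rw [hh]
    induction b using OnePoint.rec with
    | infty =>
      obtain ⟨n, hn, hn', h⟩ := key q dvd_rfl (by rw [← hd, coordAlong_eq]; simp)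
      have : q.irr = n := by rw [ExpFactor.irr, mul_comm, ← hn', Nat.floor_natCast]
      rw [this]
      exact ⟨h, hn⟩
    | coe b =>
      -- From a finite point to a finite point, `dq` would have no pole, so `q = 0`, although `ξ dz`
      -- is nonzero.
      exfalso
      simp only [eps_coe, one_mul] at hz
      have h1 : OrdGE 0 (coordAlong (b : OnePoint ℂ) r' τ) := by
        rw [coordAlong_eq]
        exact (ordGE_kap _).add (lτ.1.mono (by simp))
      have h2 : OrdGE 0 (dt (q.along q.ram unif)) := by
        rw [← hd]
        exact (h1.mul hz.1).mono (by omega)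
      have h3 := ExpFactor.eq_zero_of_ordGE_along dvd_rfl hr lead_unif one_ne_zero
        (ordGE_of_dt le_rfl (h2.mono (by omega)))
      rw [h3, ExpFactor.along_zero, map_zero, ← h3] at hd
      exact (mul_ne_zero hne (hz.ne_zero he)) hd
  | infty =>
    obtain ⟨x, hx⟩ : ∃ x : ℂ, kap b = HahnSeries.C x := by
      induction b using OnePoint.rec with
      | infty => exact ⟨0, by simp⟩
      | coe b => exact ⟨b, rfl⟩
    obtain ⟨n, hn, hn', h⟩ := key (q - monomial 1 one_pos x)
      (ExpFactor.ram_sub_dvd dvd_rfl (by simp [ExpFactor.ram_monomial])) (by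
        have h1 : HahnSeries.C x * (unif ^ (-((1 * q.ram : ℕ) : ℤ)))
            = kap b * coordAlong ∞ q.ram unif := by
          rw [coordAlong_eq, hx]
          simp
        rw [ExpFactor.along_sub, ExpFactor.along_monomial, h1, map_sub, ← hd, hx, dt_C_mul,
          coordAlong_eq b, hx]
        ring)
    -- The order relation gives `n = q.ram - eps b * r'`, which differs from `q.ram`. So erasing the
    -- linear term does not change the slope here.
    have hs : (q - monomial 1 one_pos x).slope ≠ 1 := by
      intro h1
      rw [h1, one_mul] at hn'
      have : n = q.ram := by exact_mod_cast hn'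
      subst this
      rcases eps_eq b with hb | hb <;> rw [hb] at h <;> simp at h <;> omega
    have hh : hessianIrr ∞ q = n := by
      rw [hessianIrr, if_pos rfl, ExpFactor.irr, ExpFactor.ram_erase_linExp,
        ← ExpFactor.erase_sub_monomial q x, ExpFactor.slope_erase_linExp hs, mul_comm, ← hn',
        Nat.floor_natCast]
    rw [hh]
    exact ⟨h, hn⟩

/-- The Legendre transform of a circle is represented by the rotation of any curve representing
the circle. -/
theorem Stationary.rep {a : OnePoint ℂ} {q : ExpFactor} {b : OnePoint ℂ} {p : ExpFactor}
    {r' m : ℕ} (h : Stationary a q b p r') {v : LaurentSeries ℂ × LaurentSeries ℂ}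
    (hv : Rep v a q (m * q.ram)) : Rep (v.2, -v.1) b p (m * r') := by
  obtain ⟨hord, hs⟩ := h.order_add
  obtain ⟨hr', hp, τ, cτ, hcτ, hτ, hd, hval⟩ := h
  obtain ⟨hr, -, σ, c, hc, hσ, hz, hreg⟩ := hv
  have hm : 0 < m := Nat.pos_of_mul_pos_right hr
  set z₀ := coordAlong a q.ram unif with hz₀
  set Q₀ := q.along q.ram unif with hQ₀
  set ξ₀ := coordAlong b r' τ with hξ₀
  set s : ℤ := (hessianIrr a q : ℤ) with hs_def
  have hs1 : 1 ≤ s := by omega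
  have hm1 : (1 : ℤ) ≤ m := by omega
  have hms : (1 : ℤ) ≤ m * s := by nlinarith
  have hlam : Lead (σ ^ m) m (c ^ m) := by simpa using hσ.pow m
  have hcm : c ^ m ≠ 0 := pow_ne_zero m hc
  -- The exact curve `(z₀, ξ₀)` is pulled back by `t ↦ σ ^ m`, so that its first coordinate becomes
  -- that of `v`; only the second coordinates differ.
  obtain ⟨φ, hφ⟩ := exists_isSub hlam hcm (by omega)
  have hφz : φ z₀ = v.1 := by
    rw [hz₀, hφ.map_coordAlong, unif, hφ.map_single, hz, coordAlong_eq, coordAlong_eq,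
      ← zpow_natCast σ m, ← zpow_mul]
    congr 2
    push_cast
    ring
  have hφQ : φ Q₀ = q.along (m * q.ram) σ := by
    rw [hQ₀, ExpFactor.map_along hφ, unif, hφ.map_single, ExpFactor.along_mul dvd_rfl]
  have hφd : φ ξ₀ * dt v.1 = dt (q.along (m * q.ram) σ) := by
    rw [← hφz, ← hφQ, hφ.dt, hφ.dt, ← hd, map_mul, mul_assoc]
  set T := φ τ with hT
  have hTl : Lead T m (cτ * (c ^ m)) := by simpa using hφ.lead hlam hcm (by omega) hτ
  have hcT : cτ * c ^ m ≠ 0 := mul_ne_zero hcτ hcm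
  have hφξ : φ ξ₀ = kap b + T ^ (eps b * r') := by rw [hξ₀, hφ.map_coordAlong, coordAlong_eq]
  -- the perturbation of the dual coordinate
  obtain ⟨e, he, hdz⟩ := lead_dt_coordAlong hσ hc a hr
  rw [← hz] at hdz
  set u := v.2 - φ ξ₀ with hu
  have hu1 : OrdGE (1 - m * (eps a * q.ram)) u := by
    have h1 : OrdGE 0 (u * dt v.1) := by
      rw [hu, sub_mul, hφd]
      exact hreg
    refine (h1.of_mul hdz he).mono ?_
    push_cast
    linarith
  have hT0 : T ^ (eps b * r') ≠ 0 := zpow_ne_zero _ (hTl.ne_zero hcT)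
  -- `g` is the relative error in `ξ`. As `u dz` has no pole and the orders of `z` and `ξ` add up to
  -- `-(m s)`, it has order at least `1 + m s`, and a root of `1 + g` corrects the uniformizer `θ₀`.
  set g := u * (T ^ (eps b * r'))⁻¹ with hg
  have hgo : OrdGE (1 + m * s) g := by
    refine (hu1.mul ((hTl.zpow hcT (eps b * r')).inv (zpow_ne_zero _ hcT)).1).mono ?_
    have : (m : ℤ) * (eps a * q.ram) + m * (eps b * r') = -(m * s) := by
      rw [← mul_add, hord]
      ring
    linarith
  obtain ⟨w, hw, hw1⟩ := exists_root_one_add hgo (by omega) (eps b * (m * r' : ℕ))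
    (mul_ne_zero (eps_ne_zero b) (by exact_mod_cast (Nat.mul_pos hm hr').ne'))
  obtain ⟨θ₀, d, hd0, hθ₀, hθT⟩ := exists_root (e := 1) (r := (m : ℤ)) (by simpa using hTl) hcT
    (by omega)
  rw [zpow_natCast] at hθT
  have hwl : Lead w 0 1 := by
    have := lead_one.add_ordGE hw1 (by omega)
    rwa [add_sub_cancel] at this
  set θ := θ₀ * w with hθ
  have hθl : Lead θ 1 d := by simpa using hθ₀.mul hwl
  have hv2 : v.2 = coordAlong b (m * r') θ := by
    have h1 : θ₀ ^ (eps b * (m * r' : ℕ)) = T ^ (eps b * r') := by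
      rw [← hθT, ← zpow_natCast θ₀ m, ← zpow_mul]
      congr 1
      push_cast
      ring
    rw [coordAlong_eq, hθ, mul_zpow, hw, h1, mul_add, mul_one, hg, mul_comm u,
      mul_inv_cancel_left₀ hT0, hu, hφξ]
    ring
  -- the corresponding reparametrization
  have hθm : Lead (θ ^ m) m (d ^ m) := by simpa using hθl.pow m
  -- Where `φ` matches the exact curve with `v` along `z`, `ψ` matches it along `ξ`; the discrepancy
  -- is thereby moved to `z`.
  obtain ⟨ψ, μ, hψ, hψτ, hμ⟩ := exists_isSub_eq hτ hcτ hθm (pow_ne_zero m hd0) (by omega)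
  have hdiff : OrdGE (m + (1 + m * s)) (ψ τ - φ τ) := by
    have : ψ τ - φ τ = T * (w ^ m - 1) := by
      rw [hψτ, ← hT, hθ, mul_pow, hθT]
      ring
    rw [this]
    exact hTl.1.mul (ordGE_one_add_pow (by omega) hw1 m)
  have hμlam : OrdGE (m + (1 + m * s)) (μ - σ ^ m) := by
    rcases eq_or_ne (μ - σ ^ m) 0 with h0 | h0
    · rw [h0]
      exact ordGE_zero _
    obtain ⟨k, x, hx, hk⟩ := exists_lead h0
    have h1 := hψ.lead_sub hφ (hμ.1.mono hm1) (hlam.1.mono hm1) hk hτ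
    exact hk.1.mono (h1.le_of_ordGE (mul_ne_zero hcτ hx) hdiff)
  have hμ' : Lead μ m (c ^ m) := by
    have := hlam.add_ordGE hμlam (by omega)
    rwa [add_sub_cancel] at this
  have hzz : OrdGE (m * (eps a * q.ram) + (1 + m * s)) (ψ z₀ - v.1) := by
    have h1 : ψ z₀ - v.1 = μ ^ (eps a * q.ram) - (σ ^ m) ^ (eps a * q.ram) := by
      rw [← hφz, hz₀, hψ.map_coordAlong, hφ.map_coordAlong, unif, hψ.map_single, hφ.map_single,
        coordAlong_eq, coordAlong_eq]
      ring
    rw [h1]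
    refine (lead_zpow_sub hμ' hlam hcm ⟨hμlam, rfl⟩ (eps a * q.ram)).1.mono (le_of_eq ?_)
    ring
  have hψξ : ψ ξ₀ = v.2 := by
    rw [hξ₀, hψ.map_coordAlong, hψτ, hv2, coordAlong_eq, coordAlong_eq, ← zpow_natCast θ m,
      ← zpow_mul]
    congr 2
    push_cast
    ring
  refine ⟨Nat.mul_pos hm hr', hp.mul_left m, θ, d, hd0, hθl, hv2, ?_⟩
  obtain ⟨e', -, hdv⟩ := lead_dt_coordAlong hθl hd0 b (Nat.mul_pos hm hr')
  rw [← hv2] at hdv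
  have hP : p.along (m * r') θ = ψ (p.along r' τ) := by
    rw [ExpFactor.map_along hψ, hψτ, ExpFactor.along_mul hp]
  have hder : dt (ψ (Q₀ - ξ₀ * z₀)) = -(ψ z₀ * dt v.2) := by
    rw [← hψξ, hψ.dt, hψ.dt, map_sub dt, dt_mul, ← hd]
    simp only [map_sub, map_add, map_mul]
    ring
  -- The defect consists of the error in `z` times `dξ`, and the regular error of the exact curve.
  -- The order of the first product is bounded below by exactly `0`: the terms `m s` cancel, and the
  -- `1` gained in the error offsets the `-1` of the derivative.
  have hfin : -v.1 * dt v.2 - dt (p.along (m * r') θ)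
      = (ψ z₀ - v.1) * dt v.2 - dt (ψ (p.along r' τ - (Q₀ - ξ₀ * z₀))) := by
    rw [map_sub ψ (p.along r' τ), map_sub dt, hder, hP]
    ring
  simp only
  rw [hfin]
  refine ((hzz.mul hdv.1).mono ?_).sub (hψ.ordGE hval).dt_zero
  have : (m : ℤ) * (eps a * q.ram) + m * (eps b * r') = -(m * s) := by
    rw [← mul_add, hord]
    ring
  push_cast
  linarith

/-! ### Curves representing circles, and the elementary operations -/

/-- The curve `v = (z, ξ)` represents the tame circle `⟨0⟩_x`. -/
def Tame (v : LaurentSeries ℂ × LaurentSeries ℂ) (x : ℂ) : Prop :=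
  (∃ n c, n < 0 ∧ c ≠ 0 ∧ Lead v.2 n c) ∧ OrdGE 0 ((v.1 - HahnSeries.C x) * dt v.2)

/-- The curve `v = (z, ξ)` represents the circle `⟨q⟩_a`. -/
def RepFactor (v : LaurentSeries ℂ × LaurentSeries ℂ) (a : OnePoint ℂ) (q : ExpFactor) : Prop :=
  (∃ x : ℂ, a = x ∧ q = 0 ∧ Tame v x) ∨ ((a = ∞ ∨ q ≠ 0) ∧ ∃ r, Rep v a q r)

/-- The curve `v = (z, ξ)` represents the circle `I`. -/
def Represents (v : LaurentSeries ℂ × LaurentSeries ℂ) (I : ExpCircle) : Prop :=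
  ∃ a q, I = (a, ⟦q⟧) ∧ RepFactor v a q

namespace ExpFactor

theorem support_rescale {u : Exponent → ℂ} (hu : ∀ k, u k ≠ 0) (q : ExpFactor) :
    (q.rescale u).support = q.support := by
  ext k
  simp [rescale, hu]

theorem rescale_apply (u : Exponent → ℂ) (q : ExpFactor) (k : Exponent) :
    q.rescale u k = u k * q k := rfl

theorem ram_rescale {u : Exponent → ℂ} (hu : ∀ k, u k ≠ 0) (q : ExpFactor) :
    (q.rescale u).ram = q.ram := by simp [ram, support_rescale hu]

theorem slope_rescale {u : Exponent → ℂ} (hu : ∀ k, u k ≠ 0) (q : ExpFactor) :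
    (q.rescale u).slope = q.slope := by simp [slope, support_rescale hu]

theorem rescale_eq_zero {u : Exponent → ℂ} (hu : ∀ k, u k ≠ 0) {q : ExpFactor} :
    q.rescale u = 0 ↔ q = 0 := by
  rw [← Finsupp.support_eq_empty, support_rescale hu, Finsupp.support_eq_empty]

theorem rotate_eq_zero {m : ℤ} {q : ExpFactor} : rotate m q = 0 ↔ q = 0 :=
  rescale_eq_zero fun _ => Complex.exp_ne_zero _

theorem along_rescale {q : ExpFactor} {r : ℕ} (hr : q.ram ∣ r) (hr0 : 0 < r) (w : ℂ)
    (τ : LaurentSeries ℂ) :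
    (q.rescale fun k => Complex.exp (w * (k.1 : ℂ))).along r
      (HahnSeries.C (Complex.exp (w / r)) * τ) = q.along r τ := by
  rw [along, along, Finsupp.sum, Finsupp.sum, support_rescale fun _ => Complex.exp_ne_zero _]
  refine Finset.sum_congr rfl fun k hk => ?_
  have hfl := floor_eq (ram_dvd_iff.1 hr k hk)
  have hfl' : ((⌊k.1 * (r : ℚ≥0)⌋₊ : ℕ) : ℂ) = (k.1 : ℂ) * r := by
    have := congrArg (fun x : ℚ≥0 => (x : ℂ)) hfl
    simpa using this
  have hr1 : (r : ℂ) ≠ 0 := by exact_mod_cast hr0.ne'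
  have h1 : Complex.exp (w / r) ^ (-(⌊k.1 * (r : ℚ≥0)⌋₊ : ℤ))
      = (Complex.exp (w * (k.1 : ℂ)))⁻¹ := by
    rw [← Complex.exp_int_mul, ← Complex.exp_neg]
    congr 1
    rw [Int.cast_neg, Int.cast_natCast, hfl']
    field_simp
  rw [rescale_apply, mul_zpow, ← map_zpow₀, h1, ← mul_assoc, ← map_mul]
  congr 2
  rw [mul_comm, inv_mul_cancel_left₀ (Complex.exp_ne_zero _)]

theorem rotate_eq_rescale (m : ℤ) (q : ExpFactor) :
    rotate m q
      = q.rescale fun k => Complex.exp (-(2 * Real.pi * Complex.I * (m : ℂ)) * (k.1 : ℂ)) := by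
  ext k
  rw [rotate_apply, rescale_apply]
  congr 2
  ring

end ExpFactor

/-- Change of the determination of the ramified coordinate. -/
theorem coordAlong_exp_mul (a : OnePoint ℂ) {r : ℕ} (hr : 0 < r) (w : ℂ) (σ : LaurentSeries ℂ) :
    coordAlong a r (HahnSeries.C (Complex.exp (w / r)) * σ)
      = kap a + HahnSeries.C (Complex.exp (eps a * w)) * σ ^ (eps a * r) := by
  rw [coordAlong_eq, mul_zpow, ← map_zpow₀, ← Complex.exp_int_mul]
  have hr1 : (r : ℂ) ≠ 0 := by exact_mod_cast hr.ne'
  congr 4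
  push_cast
  field_simp

theorem lead_C_exp_mul {σ : LaurentSeries ℂ} {c : ℂ} (hσ : Lead σ 1 c) (w : ℂ) :
    Lead (HahnSeries.C (Complex.exp w) * σ) 1 (Complex.exp w * c) := hσ.C_mul _

theorem Rep.rotate {v : LaurentSeries ℂ × LaurentSeries ℂ} {a : OnePoint ℂ} {q : ExpFactor}
    {r : ℕ} (h : Rep v a q r) (j : ℤ) : Rep v a (ExpFactor.rotate j q) r := by
  obtain ⟨hr, hqr, σ, c, hc, hσ, hz, hq⟩ := h
  refine ⟨hr, by rwa [ExpFactor.ram_rotate], _, _, mul_ne_zero (Complex.exp_ne_zero _) hc,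
    lead_C_exp_mul hσ (-(2 * Real.pi * Complex.I * (j : ℂ)) / r), ?_, ?_⟩
  · rw [coordAlong_exp_mul a hr, hz, coordAlong_eq]
    have : Complex.exp (eps a * -(2 * Real.pi * Complex.I * (j : ℂ))) = 1 := by
      rw [Complex.exp_eq_one_iff]
      exact ⟨-(eps a * j), by push_cast; ring⟩
    rw [this, map_one, one_mul]
  · rwa [ExpFactor.rotate_eq_rescale, ExpFactor.along_rescale hqr hr]

theorem RepFactor.of_equiv {v : LaurentSeries ℂ × LaurentSeries ℂ} {a : OnePoint ℂ}
    {q p : ExpFactor} (h : RepFactor v a q) (hqp : (⟦q⟧ : LocalCircle) = ⟦p⟧) : RepFactor v a p := by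
  obtain ⟨j, rfl⟩ := Quotient.exact hqp
  rcases h with ⟨x, rfl, rfl, h⟩ | ⟨hc, r, h⟩
  · exact .inl ⟨x, rfl, by rw [ExpFactor.rotate_eq_zero], h⟩
  · exact .inr ⟨by rwa [Ne, ExpFactor.rotate_eq_zero], r, h.rotate j⟩

theorem represents_iff {v : LaurentSeries ℂ × LaurentSeries ℂ} {a : OnePoint ℂ} {q : ExpFactor} :
    Represents v (a, ⟦q⟧) ↔ RepFactor v a q := by
  refine ⟨?_, fun h => ⟨a, q, rfl, h⟩⟩
  rintro ⟨a', q', h, h'⟩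
  obtain ⟨rfl, h2⟩ := Prod.mk.inj h
  exact h'.of_equiv h2.symm

theorem Tame.ordGE {v : LaurentSeries ℂ × LaurentSeries ℂ} {x : ℂ} (h : Tame v x) :
    ∃ n c, n < 0 ∧ c ≠ 0 ∧ Lead v.2 n c ∧ OrdGE (1 - n) (v.1 - HahnSeries.C x) := by
  obtain ⟨⟨n, c, hn, hc, hl⟩, h⟩ := h
  refine ⟨n, c, hn, hc, hl, ?_⟩
  refine (h.of_mul hl.dt (mul_ne_zero ?_ hc)).mono (by omega)
  exact_mod_cast hn.ne

theorem Tame.lead_fst {v : LaurentSeries ℂ × LaurentSeries ℂ} {x : ℂ} (h : Tame v x) :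
    Lead v.1 0 x := by
  obtain ⟨n, c, hn, hc, hl, ho⟩ := h.ordGE
  have := (lead_C x).add_ordGE ho (by omega)
  rwa [add_sub_cancel] at this

theorem Represents.tame_or {v : LaurentSeries ℂ × LaurentSeries ℂ} {I : ExpCircle}
    (h : Represents v I) : (∃ x : ℂ, I = ((x : OnePoint ℂ), ⟦0⟧) ∧ Tame v x) ∨
      ∃ a q r, I = (a, ⟦q⟧) ∧ (a = ∞ ∨ q ≠ 0) ∧ Rep v a q r := by
  obtain ⟨a, q, rfl, ⟨x, rfl, rfl, h⟩ | ⟨hc, r, h⟩⟩ := h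
  · exact .inl ⟨x, rfl, h⟩
  · exact .inr ⟨a, q, r, rfl, hc, h⟩

/-- On a tame curve both `z` and `ξ dz` are regular; the former excludes `a = ∞`, the latter `q ≠
0`. -/
theorem Tame.not_rep {v : LaurentSeries ℂ × LaurentSeries ℂ} {x : ℂ} {a : OnePoint ℂ}
    {q : ExpFactor} {r : ℕ} (h : Tame v x) (h' : Rep v a q r) : ¬(a = ∞ ∨ q ≠ 0) := by
  obtain ⟨hr, hqr, σ, c, hc, hσ, hz, hq⟩ := h'
  obtain ⟨n, d, hn, hd, hl, ho⟩ := h.ordGE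
  rintro (rfl | hq0)
  · have l := lead_zpow_coord hσ hc (eps ∞ * r)
    have h1 : OrdGE 0 (σ ^ (eps ∞ * r)) := by
      have := h.lead_fst.1
      rwa [hz, coordAlong_eq, kap_infty, zero_add] at this
    have := l.le_of_ordGE (zpow_ne_zero _ hc) h1
    simp only [eps_infty] at this
    omega
  · have h1 : dt v.1 = dt (v.1 - HahnSeries.C x) := by rw [map_sub, dt_C, sub_zero]
    have h2 : OrdGE 0 (dt (q.along r σ)) := by
      have h3 : OrdGE 0 (v.2 * dt v.1) := by
        rw [h1]
        exact (hl.1.mul ho.dt).mono (by omega)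
      have := h3.sub hq
      rwa [sub_sub_cancel] at this
    exact hq0 (ExpFactor.eq_zero_of_ordGE_along hqr hr hσ hc
      (ordGE_of_dt le_rfl (h2.mono (by omega))))

/-- A curve represents at most one circle. -/
theorem Represents.unique {v : LaurentSeries ℂ × LaurentSeries ℂ} {I J : ExpCircle}
    (hI : Represents v I) (hJ : Represents v J) : I = J := by
  rcases hI.tame_or with ⟨x, rfl, h⟩ | ⟨a, q, r, rfl, hc, h⟩ <;>
    rcases hJ.tame_or with ⟨y, rfl, h'⟩ | ⟨b, p, s, rfl, hc', h'⟩
  · rw [h.lead_fst.2.symm.trans h'.lead_fst.2]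
  · exact absurd hc' (h.not_rep h')
  · exact absurd hc (h'.not_rep h)
  · obtain ⟨rfl, -, h2⟩ := h.unique h'
    rw [h2]

/-- Every circle is represented by a curve. -/
theorem exists_represents (I : ExpCircle) : ∃ v, Represents v I := by
  obtain ⟨a, Q⟩ := I
  induction Q using Quotient.inductionOn with
  | h q =>
    by_cases h : a = ∞ ∨ q ≠ 0
    · obtain ⟨e, he, hz⟩ := lead_dt_coordAlong lead_unif one_ne_zero a q.ram_pos
      refine ⟨(coordAlong a q.ram unif,
        dt (q.along q.ram unif) * (dt (coordAlong a q.ram unif))⁻¹), a, q, rfl,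
        .inr ⟨h, q.ram, q.ram_pos, dvd_rfl, unif, 1, one_ne_zero, lead_unif, rfl, ?_⟩⟩
      simp only
      rw [inv_mul_cancel_right₀ (hz.ne_zero he), sub_self]
      exact ordGE_zero 0
    · push Not at h
      obtain ⟨h, rfl⟩ := h
      obtain ⟨x, rfl⟩ := OnePoint.ne_infty_iff_exists.1 h
      refine ⟨(HahnSeries.C x, HahnSeries.single (-1) 1), _, _, rfl, .inl ⟨x, rfl, rfl,
        ⟨-1, 1, by omega, one_ne_zero, lead_single _ _⟩, ?_⟩⟩
      simp only
      rw [sub_self, zero_mul]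
      exact ordGE_zero 0

/-- The image of a circle under a stationary Legendre transform is not tame at finite distance. -/
theorem Stationary.target {a b : OnePoint ℂ} {q p : ExpFactor} {r' m : ℕ}
    (hS : Stationary a q b p r') {v : LaurentSeries ℂ × LaurentSeries ℂ}
    (h : Rep v a q (m * q.ram)) : b = ∞ ∨ p ≠ 0 := by
  obtain ⟨hord, hs⟩ := hS.order_add
  have hR := hS.rep h
  by_contra! hcon
  obtain ⟨hb, rfl⟩ := hcon
  obtain ⟨y, rfl⟩ := OnePoint.ne_infty_iff_exists.1 hb
  obtain ⟨hr', -, θ, d, hd, hθ, hξ, hreg⟩ := hR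
  obtain ⟨hr, -, σ, c, hc, hσ, hz, -⟩ := h
  have hm : 0 < m := Nat.pos_of_mul_pos_right hr
  obtain rfl : a = ∞ := by
    by_contra ha
    obtain ⟨y, rfl⟩ := OnePoint.ne_infty_iff_exists.1 ha
    simp only [eps_coe] at hord
    omega
  obtain ⟨e, he, hl⟩ := lead_dt_coordAlong hθ hd (y : OnePoint ℂ) hr'
  have hl' := lead_zpow_coord hσ hc (eps ∞ * (m * q.ram : ℕ))
  rw [← zero_add (σ ^ _), ← kap_infty, ← coordAlong_eq, ← hz] at hl'
  rw [← hξ] at hl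
  -- With zero dual factor, `-z dξ` would have no pole, forcing `m * r' > m * q.ram`, against the
  -- negative sum of orders in `hord`.
  have := (hl'.neg.mul hl).le_of_ordGE (m := 0)
    (mul_ne_zero (neg_ne_zero.2 (zpow_ne_zero _ hc)) he)
    (by simpa [ExpFactor.along_zero] using hreg)
  simp only [eps_infty, eps_coe] at this hord
  push_cast at this
  have h1 : (m : ℤ) * (-1 * q.ram + 1 * r') = m * -(hessianIrr ∞ q : ℤ) := by rw [hord]
  have h2 : (0 : ℤ) < m * (hessianIrr ∞ q : ℤ) := by positivity
  linarith

/-- The tame and pure cases exchange the two kinds of representing curves, a root of `ξ` serving as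
uniformizer at infinity in the tame case. All other cases are stationary phase. -/
theorem RepFactor.legendre {v : LaurentSeries ℂ × LaurentSeries ℂ} {a b : OnePoint ℂ}
    {q p : ExpFactor} (h : RepFactor v a q) (hL : LegendreTransform a q b p) :
    RepFactor (v.2, -v.1) b p := by
  rcases legendreTransform_iff.1 hL with ⟨x, rfl, rfl, rfl, rfl⟩ | ⟨x, rfl, rfl, rfl, rfl⟩ |
    ⟨r', hS⟩
  · rcases h with ⟨y, hy, -, h⟩ | ⟨hc, -⟩
    · obtain rfl := OnePoint.coe_injective hy
      obtain ⟨⟨n, c, hn, hc, hl⟩, h⟩ := h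
      obtain ⟨r, rfl⟩ : ∃ r : ℕ, n = 1 * -(r : ℤ) := ⟨(-n).toNat, by omega⟩
      obtain ⟨τ, d, hd, hτ, hroot⟩ := exists_root hl hc (by omega)
      refine .inr ⟨.inl rfl, r, by omega, by simp [ExpFactor.ram_monomial], τ, d, hd, hτ, ?_, ?_⟩
      · simp [coordAlong_eq, hroot]
      · simp only
        rw [ExpFactor.along_monomial, one_mul, hroot, dt_C_mul, map_neg]
        convert h.neg using 1
        ring
    · simp at hc
  · rcases h with ⟨y, hy, -⟩ | ⟨-, r, hr, -, σ, c, hc, hσ, hz, hq⟩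
    · exact absurd hy (OnePoint.infty_ne_coe y)
    · refine .inl ⟨x, rfl, rfl, ⟨-r, -(c ^ (-(r : ℤ))), by omega,
        neg_ne_zero.2 (zpow_ne_zero _ hc), ?_⟩, ?_⟩
      · simp only
        rw [hz, coordAlong_eq]
        simpa using (lead_zpow_coord hσ hc (-(r : ℤ))).neg
      · rw [ExpFactor.along_monomial, one_mul, dt_C_mul] at hq
        have hz' : v.1 = σ ^ (-(r : ℤ)) := by simp [hz, coordAlong_eq]
        rw [← hz'] at hq
        simp only
        rw [map_neg]
        convert hq.neg using 1
        ring
  · obtain ⟨hord, hs⟩ := hS.order_add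
    rcases h with ⟨y, rfl, rfl, -⟩ | ⟨-, r, h⟩
    · simp [hessianIrr, ExpFactor.irr, ExpFactor.slope] at hs
    · obtain ⟨m, rfl⟩ := h.2.1
      rw [mul_comm] at h
      exact .inr ⟨hS.target h, _, hS.rep h⟩

theorem exists_legendreTransform (a : OnePoint ℂ) (q : ExpFactor) :
    ∃ b p, LegendreTransform a q b p := by
  by_cases h0 : a ≠ ∞ ∧ q = 0
  · obtain ⟨h, rfl⟩ := h0
    obtain ⟨x, rfl⟩ := OnePoint.ne_infty_iff_exists.1 h
    exact ⟨_, _, .tame x⟩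
  by_cases h1 : ∃ x, a = ∞ ∧ q = monomial 1 one_pos x
  · obtain ⟨x, rfl, rfl⟩ := h1
    exact ⟨_, _, .pure x⟩
  obtain ⟨e, he, hz⟩ := lead_dt_coordAlong lead_unif one_ne_zero a q.ram_pos
  set z := coordAlong a q.ram unif with hz_def
  set Q := q.along q.ram unif with hQ
  set ξ := dt Q * (dt z)⁻¹ with hξ
  have hξz : ξ * dt z = dt Q := inv_mul_cancel_right₀ (hz.ne_zero he) _
  -- A constant `dq/dz` occurs only for `q = x z` at infinity or `q = 0` at a finite point, that is
  -- in the pure and tame cases already removed.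
  have hne : dt ξ ≠ 0 := by
    intro h
    rw [eq_C_of_dt_eq_zero h] at hξz
    set x := ξ.coeff 0
    induction a using OnePoint.rec with
    | infty =>
      refine h1 ⟨x, rfl, ?_⟩
      rw [← sub_eq_zero]
      refine ExpFactor.eq_zero_of_ordGE_along (ExpFactor.ram_sub_dvd dvd_rfl
        (by simp [ExpFactor.ram_monomial])) q.ram_pos lead_unif one_ne_zero
        (ordGE_of_dt le_rfl ?_)
      have : HahnSeries.C x * unif ^ (-((1 * q.ram : ℕ) : ℤ)) = HahnSeries.C x * z := by
        rw [hz_def, coordAlong_eq]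
        simp
      rw [ExpFactor.along_sub, ExpFactor.along_monomial, this, map_sub, dt_C_mul, hξz, sub_self]
      exact ordGE_zero _
    | coe a =>
      refine h0 ⟨OnePoint.coe_ne_infty a, ?_⟩
      refine ExpFactor.eq_zero_of_ordGE_along dvd_rfl q.ram_pos lead_unif one_ne_zero
        (ordGE_of_dt le_rfl ?_)
      rw [← hQ, ← hξz]
      refine (hz.1.C_mul x).mono ?_
      have := q.ram_pos
      simp only [eps_coe]
      omega
  obtain ⟨b, r', τ, c, hr', hc, hτ, hb⟩ := exists_coordAlong hne
  obtain ⟨p, hp, hpo⟩ := ExpFactor.exists_principalPart hτ hc hr' (Q - ξ * z)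
  refine ⟨b, p, legendreTransform_iff.2 (.inr (.inr ⟨r', hr', hp, τ, c, hc, hτ, ?_, ?_⟩))⟩
  · rw [← hb, hξz]
  · rw [← hb]
    convert hpo.neg using 1
    ring

/-! ### Twists and scalings of circles -/

/-- The form `ξ dz` changes by `-lam z dz`, the differential of `-(lam / 2) z²`. -/
theorem RepFactor.twist_infty {v : LaurentSeries ℂ × LaurentSeries ℂ} {q : ExpFactor} (lam : ℂ)
    (h : RepFactor v ∞ q) :
    RepFactor (v.1, v.2 - HahnSeries.C lam * v.1) ∞ (q - monomial 2 two_pos (lam / 2)) := by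
  rcases h with ⟨y, hy, -⟩ | ⟨-, r, hr, hqr, σ, c, hc, hσ, hz, hq⟩
  · exact absurd hy (OnePoint.infty_ne_coe y)
  refine .inr ⟨.inl rfl, r, hr, ExpFactor.ram_sub_dvd hqr (by simp [ExpFactor.ram_monomial]),
    σ, c, hc, hσ, hz, ?_⟩
  have hz2 : σ ^ (-((2 * r : ℕ) : ℤ)) = v.1 * v.1 := by
    rw [hz, coordAlong_eq, kap_infty, zero_add, ← zpow_add₀ (hσ.ne_zero hc)]
    congr 1
    simp only [eps_infty]
    push_cast
    ring
  simp only
  have h2 : (HahnSeries.C lam : LaurentSeries ℂ)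
      = HahnSeries.C (lam / 2) + HahnSeries.C (lam / 2) := by
    rw [← map_add, add_halves]
  rw [ExpFactor.along_sub, ExpFactor.along_monomial, hz2, map_sub, dt_C_mul, dt_mul, h2]
  convert hq using 1
  ring

theorem RepFactor.twist_coe {v : LaurentSeries ℂ × LaurentSeries ℂ} {q : ExpFactor} {a : ℂ}
    (lam : ℂ) (h : RepFactor v a q) : RepFactor (v.1, v.2 - HahnSeries.C lam * v.1) a q := by
  rcases h with ⟨x, hx, rfl, h⟩ | ⟨hc, r, hr, hqr, σ, c, hc', hσ, hz, hq⟩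
  · refine .inl ⟨x, hx, rfl, ?_, ?_⟩
    · obtain ⟨n, c, hn, hc, hl⟩ := h.1
      refine ⟨n, c, hn, hc, ?_⟩
      simpa [sub_eq_add_neg] using hl.add_ordGE (h.lead_fst.1.C_mul lam).neg hn
    · have h1 : dt (v.1 - HahnSeries.C x) = dt v.1 := by rw [map_sub, dt_C, sub_zero]
      simp only
      rw [map_sub, dt_C_mul, mul_sub]
      refine h.2.sub ?_
      have h0 : OrdGE 0 (v.1 - HahnSeries.C x) := h.lead_fst.1.sub (ordGE_C x)
      exact h0.mul (h.lead_fst.1.dt_zero.C_mul lam)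
  · refine .inr ⟨hc, r, hr, hqr, σ, c, hc', hσ, hz, ?_⟩
    have h0 : OrdGE 0 v.1 := by
      rw [hz, coordAlong_eq]
      exact (ordGE_kap _).add ((lead_zpow_coord hσ hc' _).1.mono (by simp))
    simp only
    have := hq.sub ((h0.C_mul lam).mul h0.dt_zero)
    convert this using 1
    ring

/-- The form `ξ dz` is unchanged; the uniformizer is multiplied by the `r`-th root of `lam` given by
the logarithm used in `cpow`. -/
theorem Rep.scaling_infty {v : LaurentSeries ℂ × LaurentSeries ℂ} {q : ExpFactor} {r : ℕ}
    (lam : ℂˣ) (h : Rep v ∞ q r) :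
    Rep (HahnSeries.C (lam : ℂ)⁻¹ * v.1, HahnSeries.C (lam : ℂ) * v.2) ∞
      (q.rescale fun k => (lam : ℂ) ^ (k.1 : ℂ)) r := by
  obtain ⟨hr, hqr, σ, c, hc, hσ, hz, hq⟩ := h
  have hl : (lam : ℂ) ≠ 0 := lam.ne_zero
  have hre : (fun k : Exponent => (lam : ℂ) ^ (k.1 : ℂ))
      = fun k => Complex.exp (Complex.log lam * (k.1 : ℂ)) := by
    funext k
    rw [Complex.cpow_def_of_ne_zero hl]
  rw [hre]
  refine ⟨hr, ?_, _, _, mul_ne_zero (Complex.exp_ne_zero _) hc,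
    lead_C_exp_mul hσ (Complex.log lam / r), ?_, ?_⟩
  · rwa [ExpFactor.ram_rescale fun _ => Complex.exp_ne_zero _]
  · simp only
    rw [coordAlong_exp_mul _ hr, hz, coordAlong_eq]
    simp [Complex.exp_neg, Complex.exp_log hl]
  · rw [ExpFactor.along_rescale hqr hr]
    simp only
    rw [dt_C_mul, mul_mul_mul_comm, ← map_mul, mul_inv_cancel₀ hl, map_one, one_mul]
    exact hq

theorem scaling_coe_eq_exp (lam : ℂˣ) : (fun k : Exponent => (lam : ℂ) ^ (-(k.1 : ℂ)))
    = fun k => Complex.exp (-Complex.log lam * (k.1 : ℂ)) := by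
  funext k
  rw [Complex.cpow_def_of_ne_zero lam.ne_zero]
  congr 1
  ring

theorem Rep.scaling_coe {v : LaurentSeries ℂ × LaurentSeries ℂ} {q : ExpFactor} {a : ℂ} {r : ℕ}
    (lam : ℂˣ) (h : Rep v a q r) :
    Rep (HahnSeries.C (lam : ℂ)⁻¹ * v.1, HahnSeries.C (lam : ℂ) * v.2)
      ((a / (lam : ℂ) : ℂ) : OnePoint ℂ) (q.rescale fun k => (lam : ℂ) ^ (-(k.1 : ℂ))) r := by
  obtain ⟨hr, hqr, σ, c, hc', hσ, hz, hq⟩ := h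
  have hl : (lam : ℂ) ≠ 0 := lam.ne_zero
  rw [scaling_coe_eq_exp]
  refine ⟨hr, ?_, _, _, mul_ne_zero (Complex.exp_ne_zero _) hc',
    lead_C_exp_mul hσ (-Complex.log lam / r), ?_, ?_⟩
  · rwa [ExpFactor.ram_rescale fun _ => Complex.exp_ne_zero _]
  · simp only
    rw [coordAlong_exp_mul _ hr, hz, coordAlong_eq, mul_add, kap_coe, kap_coe, ← map_mul,
      div_eq_inv_mul]
    simp only [eps_coe, Int.cast_one, one_mul, Complex.exp_neg, Complex.exp_log hl]
  · rw [ExpFactor.along_rescale hqr hr]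
    simp only
    rw [dt_C_mul, mul_mul_mul_comm, ← map_mul, mul_inv_cancel₀ hl, map_one, one_mul]
    exact hq

theorem RepFactor.scaling_infty {v : LaurentSeries ℂ × LaurentSeries ℂ} {q : ExpFactor}
    (lam : ℂˣ) (h : RepFactor v ∞ q) :
    RepFactor (HahnSeries.C (lam : ℂ)⁻¹ * v.1, HahnSeries.C (lam : ℂ) * v.2) ∞
      (q.rescale fun k => (lam : ℂ) ^ (k.1 : ℂ)) := by
  rcases h with ⟨y, hy, -⟩ | ⟨-, r, h⟩
  · exact absurd hy (OnePoint.infty_ne_coe y)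
  · exact .inr ⟨.inl rfl, r, h.scaling_infty lam⟩

theorem RepFactor.scaling_coe {v : LaurentSeries ℂ × LaurentSeries ℂ} {q : ExpFactor} {a : ℂ}
    (lam : ℂˣ) (h : RepFactor v a q) :
    RepFactor (HahnSeries.C (lam : ℂ)⁻¹ * v.1, HahnSeries.C (lam : ℂ) * v.2)
      ((a / (lam : ℂ) : ℂ) : OnePoint ℂ) (q.rescale fun k => (lam : ℂ) ^ (-(k.1 : ℂ))) := by
  have hl : (lam : ℂ) ≠ 0 := lam.ne_zero
  rw [scaling_coe_eq_exp]
  rcases h with ⟨x, hx, rfl, ⟨n, c, hn, hc, hlead⟩, h⟩ | ⟨hc, r, h⟩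
  · obtain rfl := OnePoint.coe_injective hx
    refine .inl ⟨_, rfl, (ExpFactor.rescale_eq_zero fun _ => Complex.exp_ne_zero _).2 rfl,
      ⟨n, _, hn, mul_ne_zero hl hc, hlead.C_mul _⟩, ?_⟩
    simp only
    rw [dt_C_mul]
    have : (HahnSeries.C (lam : ℂ)⁻¹ * v.1 - HahnSeries.C (a / (lam : ℂ)))
        * (HahnSeries.C (lam : ℂ) * dt v.2)
        = (HahnSeries.C (lam : ℂ)⁻¹ * HahnSeries.C (lam : ℂ))
          * ((v.1 - HahnSeries.C a) * dt v.2) := by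
      rw [div_eq_inv_mul, map_mul]
      ring
    rw [this, ← map_mul, inv_mul_cancel₀ hl, map_one, one_mul]
    exact h
  · refine .inr ⟨?_, r, ?_⟩
    · simpa [ExpFactor.rescale_eq_zero fun _ => Complex.exp_ne_zero _] using hc
    · rw [← scaling_coe_eq_exp]
      exact h.scaling_coe lam

/-! ### The action of `SL₂(ℂ)` on circles -/

/-- The contragredient action of `SL₂(ℂ)` on curves. -/
def rho (A : SL(2, ℂ)) (v : LaurentSeries ℂ × LaurentSeries ℂ) :
    LaurentSeries ℂ × LaurentSeries ℂ :=
  (HahnSeries.C (A 1 1) * v.1 - HahnSeries.C (A 1 0) * v.2,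
    HahnSeries.C (A 0 0) * v.2 - HahnSeries.C (A 0 1) * v.1)

theorem rho_one (v : LaurentSeries ℂ × LaurentSeries ℂ) : rho 1 v = v := by
  simp [rho, HahnSeries.single_zero_one]

theorem rho_mul (A B : SL(2, ℂ)) (v : LaurentSeries ℂ × LaurentSeries ℂ) :
    rho (A * B) v = rho A (rho B v) := by
  simp only [rho, Matrix.SpecialLinearGroup.coe_mul, Matrix.mul_apply, Fin.sum_univ_two, map_add,
    map_mul]
  ext1 <;> simp only <;> ring

/-- The circle `I` is moved to `J` by `A`, for every representing curve. -/
def Moves (A : SL(2, ℂ)) (I J : ExpCircle) : Prop :=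
  ∀ v, Represents v I → Represents (rho A v) J

theorem Moves.unique {A : SL(2, ℂ)} {I J J' : ExpCircle} (h : Moves A I J) (h' : Moves A I J') :
    J = J' := by
  obtain ⟨v, hv⟩ := exists_represents I
  exact (h v hv).unique (h' v hv)

theorem Moves.mul {A B : SL(2, ℂ)} {I J K : ExpCircle} (h : Moves A J K) (h' : Moves B I J) :
    Moves (A * B) I K := fun v hv => by
  rw [rho_mul]
  exact h _ (h' v hv)

theorem moves_fourier {a b : OnePoint ℂ} {q p : ExpFactor} (h : LegendreTransform a q b p) :
    Moves fourierMatrix (a, ⟦q⟧) (b, ⟦p⟧) := fun v hv => by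
  have : rho fourierMatrix v = (v.2, -v.1) := by
    simp only [rho, fourierMatrix]
    simp [HahnSeries.single_zero_one]
  rw [this]
  exact represents_iff.2 ((represents_iff.1 hv).legendre h)

theorem rho_twistMatrix (lam : ℂ) (v : LaurentSeries ℂ × LaurentSeries ℂ) :
    rho (twistMatrix lam) v = (v.1, v.2 - HahnSeries.C lam * v.1) := by
  simp only [rho, twistMatrix]
  simp [HahnSeries.single_zero_one]

theorem moves_twist_infty (lam : ℂ) (q : ExpFactor) :
    Moves (twistMatrix lam) (∞, ⟦q⟧) (∞, ⟦q - monomial 2 two_pos (lam / 2)⟧) := fun v hv => by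
  rw [rho_twistMatrix]
  exact represents_iff.2 ((represents_iff.1 hv).twist_infty lam)

theorem moves_twist_coe (lam : ℂ) (a : ℂ) (q : ExpFactor) :
    Moves (twistMatrix lam) ((a : OnePoint ℂ), ⟦q⟧) ((a : OnePoint ℂ), ⟦q⟧) := fun v hv => by
  rw [rho_twistMatrix]
  exact represents_iff.2 ((represents_iff.1 hv).twist_coe lam)

theorem rho_scalingMatrix (lam : ℂˣ) (v : LaurentSeries ℂ × LaurentSeries ℂ) :
    rho (scalingMatrix lam) v
      = (HahnSeries.C (lam : ℂ)⁻¹ * v.1, HahnSeries.C (lam : ℂ) * v.2) := by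
  simp only [rho, scalingMatrix]
  simp

theorem moves_scaling_infty (lam : ℂˣ) (q : ExpFactor) :
    Moves (scalingMatrix lam) (∞, ⟦q⟧) (∞, ⟦q.rescale fun k => (lam : ℂ) ^ (k.1 : ℂ)⟧) :=
  fun v hv => by
    rw [rho_scalingMatrix]
    exact represents_iff.2 ((represents_iff.1 hv).scaling_infty lam)

theorem moves_scaling_coe (lam : ℂˣ) (a : ℂ) (q : ExpFactor) :
    Moves (scalingMatrix lam) ((a : OnePoint ℂ), ⟦q⟧)
      (((a / (lam : ℂ) : ℂ) : OnePoint ℂ), ⟦q.rescale fun k => (lam : ℂ) ^ (-(k.1 : ℂ))⟧) :=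
  fun v hv => by
    rw [rho_scalingMatrix]
    exact represents_iff.2 ((represents_iff.1 hv).scaling_coe lam)

/-! ### Generation of `SL₂(ℂ)` by elementary matrices, and existence of the action. -/

theorem coe_twistMatrix (lam : ℂ) :
    (twistMatrix lam : Matrix (Fin 2) (Fin 2) ℂ) = !![1, lam; 0, 1] := rfl

theorem coe_scalingMatrix (lam : ℂˣ) : (scalingMatrix lam : Matrix (Fin 2) (Fin 2) ℂ)
    = !![(lam : ℂ), 0; 0, ((lam⁻¹ : ℂˣ) : ℂ)] := rfl

theorem coe_fourierMatrix :
    (fourierMatrix : Matrix (Fin 2) (Fin 2) ℂ) = !![0, 1; -1, 0] := rfl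

theorem eq_twist_mul_scaling {A : SL(2, ℂ)} (h : A 1 0 = 0) :
    ∃ lam μ, A = twistMatrix lam * scalingMatrix μ := by
  have hdet := A.det_coe
  rw [Matrix.det_fin_two, h, mul_zero, sub_zero] at hdet
  have ha : A 0 0 ≠ 0 := left_ne_zero_of_mul_eq_one hdet
  have hd : A 1 1 = (A 0 0)⁻¹ := eq_inv_of_mul_eq_one_right hdet
  refine ⟨A 0 1 * A 0 0, Units.mk0 _ ha, Subtype.ext ?_⟩
  rw [Matrix.SpecialLinearGroup.coe_mul, coe_twistMatrix, coe_scalingMatrix, Matrix.mul_fin_two]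
  ext i j
  fin_cases i <;> fin_cases j <;> simp [h, hd, ha]

/-- This is the big Bruhat cell. That a single Fourier factor suffices is essential for
`edgeForm_act`. -/
theorem eq_twist_mul_scaling_mul_fourier_mul_twist {A : SL(2, ℂ)} (h : A 1 0 ≠ 0) :
    ∃ x μ y, A = twistMatrix x * (scalingMatrix μ * (fourierMatrix * twistMatrix y)) := by
  have hdet := A.det_coe
  rw [Matrix.det_fin_two] at hdet
  refine ⟨A 0 0 / A 1 0, Units.mk0 (-(A 1 0)⁻¹) (neg_ne_zero.2 (inv_ne_zero h)), A 1 1 / A 1 0,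
    Subtype.ext ?_⟩
  rw [Matrix.SpecialLinearGroup.coe_mul, Matrix.SpecialLinearGroup.coe_mul,
    Matrix.SpecialLinearGroup.coe_mul, coe_twistMatrix, coe_scalingMatrix, coe_twistMatrix,
    coe_fourierMatrix, Matrix.mul_fin_two, Matrix.mul_fin_two, Matrix.mul_fin_two]
  ext i j
  fin_cases i <;> fin_cases j
  · simp [h]
  · simp
    field_simp
    linear_combination -hdet
  · simp
  · simp
    field_simp

/-- Induction on matrices as products of elementary ones. -/
theorem SL_induction {P : SL(2, ℂ) → Prop} (one : P 1)
    (fourier : ∀ A, P A → P (fourierMatrix * A)) (twist : ∀ lam A, P A → P (twistMatrix lam * A))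
    (scaling : ∀ lam A, P A → P (scalingMatrix lam * A)) (A : SL(2, ℂ)) : P A := by
  by_cases h : A 1 0 = 0
  · obtain ⟨x, μ, rfl⟩ := eq_twist_mul_scaling h
    rw [← mul_one (scalingMatrix μ)]
    exact twist _ _ (scaling _ _ one)
  · obtain ⟨x, μ, y, rfl⟩ := eq_twist_mul_scaling_mul_fourier_mul_twist h
    rw [← mul_one (twistMatrix y)]
    exact twist _ _ (scaling _ _ (fourier _ (twist _ _ one)))

theorem exists_moves (A : SL(2, ℂ)) (I : ExpCircle) : ∃ J, Moves A I J := by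
  have gen : ∀ (B A : SL(2, ℂ)), (∀ I, ∃ J, Moves B I J) → (∃ J, Moves A I J) →
      ∃ J, Moves (B * A) I J := by
    rintro B A hB ⟨J, hJ⟩
    obtain ⟨K, hK⟩ := hB J
    exact ⟨K, hK.mul hJ⟩
  induction A using SL_induction with
  | one => exact ⟨I, fun v hv => by rwa [rho_one]⟩
  | fourier A ih =>
    refine gen _ _ (fun I => ?_) ih
    obtain ⟨a, Q⟩ := I
    induction Q using Quotient.inductionOn with
    | h q =>
      obtain ⟨b, p, h⟩ := exists_legendreTransform a q
      exact ⟨_, moves_fourier h⟩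
  | twist lam A ih =>
    refine gen _ _ (fun I => ?_) ih
    obtain ⟨a, Q⟩ := I
    induction Q using Quotient.inductionOn with
    | h q =>
      induction a using OnePoint.rec with
      | infty => exact ⟨_, moves_twist_infty lam q⟩
      | coe a => exact ⟨_, moves_twist_coe lam a q⟩
  | scaling lam A ih =>
    refine gen _ _ (fun I => ?_) ih
    obtain ⟨a, Q⟩ := I
    induction Q using Quotient.inductionOn with
    | h q =>
      induction a using OnePoint.rec with
      | infty => exact ⟨_, moves_scaling_infty lam q⟩
      | coe a => exact ⟨_, moves_scaling_coe lam a q⟩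

/-- The action of `SL₂(ℂ)` on circles. -/
def act (A : SL(2, ℂ)) (I : ExpCircle) : ExpCircle := (exists_moves A I).choose

theorem moves_act (A : SL(2, ℂ)) (I : ExpCircle) : Moves A I (act A I) :=
  (exists_moves A I).choose_spec

theorem Moves.act_eq {A : SL(2, ℂ)} {I J : ExpCircle} (h : Moves A I J) : act A I = J :=
  (moves_act A I).unique h

theorem act_one (I : ExpCircle) : act 1 I = I :=
  Moves.act_eq fun v hv => by rwa [rho_one]

theorem act_mul (A B : SL(2, ℂ)) (I : ExpCircle) : act (A * B) I = act A (act B I) :=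
  ((moves_act A _).mul (moves_act B I)).act_eq

/-- The permutation of the circles defined by a matrix. -/
def actEquiv (A : SL(2, ℂ)) : ExpCircle ≃ ExpCircle where
  toFun := act A
  invFun := act A⁻¹
  left_inv I := by rw [← act_mul, inv_mul_cancel, act_one]
  right_inv I := by rw [← act_mul, mul_inv_cancel, act_one]

/-! ### Parity of ramification indices -/

/-- The map `v ↦ -v` is both the scaling by `-1` and the square of the Fourier rotation, so two
Legendre transforms preserve ramification. -/
theorem Rep.neg {v : LaurentSeries ℂ × LaurentSeries ℂ} {a : OnePoint ℂ} {q : ExpFactor} {r : ℕ}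
    (h : Rep v a q r) : ∃ a' q', q'.ram = q.ram ∧ ((a = ∞ ∨ q ≠ 0) → (a' = ∞ ∨ q' ≠ 0)) ∧
      Rep (-v.1, -v.2) a' q' r := by
  have hv : (HahnSeries.C ((-1 : ℂˣ) : ℂ)⁻¹ * v.1, HahnSeries.C ((-1 : ℂˣ) : ℂ) * v.2)
      = (-v.1, -v.2) := by
    simp only [Units.val_neg, Units.val_one, inv_neg, inv_one, map_neg, map_one, neg_mul, one_mul]
  have hne (x : ℂ) : ((-1 : ℂˣ) : ℂ) ^ x ≠ 0 := by simp [Complex.cpow_eq_zero_iff]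
  induction a using OnePoint.rec with
  | infty =>
    have := h.scaling_infty (-1)
    rw [hv] at this
    exact ⟨_, _, ExpFactor.ram_rescale (fun _ => hne _) q, fun _ => .inl rfl, this⟩
  | coe a =>
    have := h.scaling_coe (-1)
    rw [hv] at this
    refine ⟨_, _, ExpFactor.ram_rescale (fun _ => hne _) q, ?_, this⟩
    rintro (h | h)
    · exact absurd h (OnePoint.coe_ne_infty a)
    · exact .inr fun h' => h ((ExpFactor.rescale_eq_zero fun _ => hne _).1 h')

theorem exists_rep_ram {a : OnePoint ℂ} {q : ExpFactor} : ∃ v, Rep v a q q.ram := by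
  obtain ⟨e, he, hz⟩ := lead_dt_coordAlong lead_unif one_ne_zero a q.ram_pos
  refine ⟨(coordAlong a q.ram unif,
    dt (q.along q.ram unif) * (dt (coordAlong a q.ram unif))⁻¹),
    q.ram_pos, dvd_rfl, unif, 1, one_ne_zero, lead_unif, rfl, ?_⟩
  simp only
  rw [inv_mul_cancel_right₀ (hz.ne_zero he), sub_self]
  exact ordGE_zero 0

theorem Stationary.source {a b : OnePoint ℂ} {q p : ExpFactor} {r' : ℕ}
    (hS : Stationary a q b p r') : a = ∞ ∨ q ≠ 0 := by
  by_contra! h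
  obtain ⟨h, rfl⟩ := h
  have := hS.order_add.2
  simp [hessianIrr, ExpFactor.irr, ExpFactor.slope] at this

/-- The dual circle has ramification index `r'`. -/
theorem Stationary.ram_eq {a b : OnePoint ℂ} {q p : ExpFactor} {r' : ℕ}
    (hS : Stationary a q b p r') : p.ram = r' := by
  obtain ⟨v, hv⟩ := exists_rep_ram (a := a) (q := q)
  have h1 := hS.rep (m := 1) (by rwa [one_mul])
  rw [one_mul] at h1
  have ht := hS.target (m := 1) (by rwa [one_mul])
  obtain ⟨a', q', hram, hc, hneg⟩ := hv.neg
  have hc := hc hS.source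
  obtain ⟨m, hm⟩ := h1.2.1
  -- A second transform leads to `-v`, of ramification `q.ram`. If `r' = m * p.ram`, this
  -- ramification is also `m * r''` with `q.ram ∣ r''`, so `m = 1`.
  obtain ⟨c, p', hL⟩ := exists_legendreTransform b p
  have hF := RepFactor.legendre (.inr ⟨ht, _, h1⟩) hL
  rcases legendreTransform_iff.1 hL with ⟨x, rfl, rfl, -⟩ | ⟨x, rfl, rfl, rfl, rfl⟩ | ⟨r'', hS'⟩
  · simp at ht
  · rcases hF with ⟨y, -, -, h⟩ | ⟨h, -⟩
    · exact absurd hc (h.not_rep hneg)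
    · simp at h
  · rw [mul_comm] at hm
    rw [hm] at h1
    have h2 := hS'.rep h1
    obtain ⟨-, h3, h4⟩ := h2.unique hneg
    have h5 : p'.ram = q'.ram := congrArg LocalCircle.ram h4
    have h6 : q.ram ∣ r'' := by
      rw [← hram, ← h5]
      exact hS'.2.1
    have h7 : 0 < r'' := hS'.1
    have h8 := Nat.le_of_dvd h7 h6
    have h9 : 0 < m := Nat.pos_of_mul_pos_right (hm ▸ hS.1)
    have : m = 1 := by nlinarith
    rw [hm, this, one_mul]

/-- Modulo 2 the signs in the order relation of the two coordinates disappear. -/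
theorem legendreTransform_parity {a b : OnePoint ℂ} {q p : ExpFactor}
    (h : LegendreTransform a q b p) : Even (hessianIrr a q + (q.ram + p.ram)) := by
  rcases legendreTransform_iff.1 h with ⟨x, rfl, rfl, rfl, rfl⟩ | ⟨x, rfl, rfl, rfl, rfl⟩ |
    ⟨r', hS⟩
  · simp [hessianIrr, ExpFactor.irr, ExpFactor.slope, ExpFactor.ram_monomial]
  · have : (monomial 1 one_pos x).erase ExpFactor.linExp = 0 := by
      rw [monomial, Finsupp.erase_single]
    rw [hessianIrr, if_pos rfl, this]
    simp [ExpFactor.irr, ExpFactor.slope, ExpFactor.ram_monomial]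
  · have h1 := hS.order_add.1
    rw [hS.ram_eq]
    have : Even ((hessianIrr a q + (q.ram + r') : ℕ) : ℤ) := by
      rw [Int.even_iff]
      push_cast
      rcases eps_eq a with ha | ha <;> rcases eps_eq b with hb | hb <;> rw [ha, hb] at h1 <;> omega
    exact_mod_cast this

/-- Thus the inversion in `legendreLocSys` takes place only when exactly one of the two points is
finite. -/
theorem legendreTransform_infty {a b : OnePoint ℂ} {q p : ExpFactor}
    (h : LegendreTransform a q b p) : a = ∞ ∨ b = ∞ := by
  rcases legendreTransform_iff.1 h with ⟨x, rfl, rfl, rfl, rfl⟩ | ⟨x, rfl, rfl, rfl, rfl⟩ |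
    ⟨r', hS⟩
  · exact .inr rfl
  · exact .inl rfl
  · by_contra! hcon
    obtain ⟨x, rfl⟩ := OnePoint.ne_infty_iff_exists.1 hcon.1
    obtain ⟨y, rfl⟩ := OnePoint.ne_infty_iff_exists.1 hcon.2
    have h1 := hS.order_add
    simp only [eps_coe] at h1
    omega

/-! ### The action on formal data -/

namespace LocSys

theorem ind {P : LocSys → Prop} (h : ∀ n (g : GL (Fin n) ℂ), P ⟨n, ConjClasses.mk g⟩)
    (c : LocSys) : P c := by
  obtain ⟨n, c⟩ := c
  induction c using Quotient.inductionOn with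
  | h g => exact h n g

theorem sign_mk (s n : ℕ) (g : GL (Fin n) ℂ) :
    sign s ⟨n, ConjClasses.mk g⟩ = ⟨n, ConjClasses.mk ((-1) ^ s * g)⟩ := rfl

theorem inv_mk (n : ℕ) (g : GL (Fin n) ℂ) :
    inv ⟨n, ConjClasses.mk g⟩ = ⟨n, ConjClasses.mk g⁻¹⟩ := rfl

theorem sign_sign (s t : ℕ) (c : LocSys) : (c.sign s).sign t = c.sign (s + t) := by
  induction c using ind with
  | h n g => rw [sign_mk, sign_mk, sign_mk, ← mul_assoc, ← pow_add, add_comm]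

theorem sign_of_even {s : ℕ} (hs : Even s) (c : LocSys) : c.sign s = c := by
  induction c using ind with
  | h n g => rw [sign_mk, hs.neg_one_pow, one_mul]

theorem inv_inv (c : LocSys) : c.inv.inv = c := by
  induction c using ind with
  | h n g => rw [inv_mk, inv_mk, _root_.inv_inv]

theorem inv_sign (s : ℕ) (c : LocSys) : (c.sign s).inv = c.inv.sign s := by
  induction c using ind with
  | h n g =>
    rw [sign_mk, inv_mk, inv_mk, sign_mk, mul_inv_rev]
    rcases neg_one_pow_eq_or (GL (Fin n) ℂ) s with hs | hs <;> simp [hs]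

theorem sign_congr {s t : ℕ} (h : Even (s + t)) (c : LocSys) : c.sign s = c.sign t := by
  induction c using ind with
  | h n g => rw [sign_mk, sign_mk, neg_one_pow_congr (Nat.even_add.1 h)]

theorem sign_eq_iff {s t u : ℕ} (h : Even (u + (s + t))) {c c' : LocSys} :
    c'.sign t = c.sign s ↔ c' = c.sign u := by
  constructor
  · intro h'
    have h1 := congrArg (sign t) h'
    rw [sign_sign, sign_of_even (Even.add_self t), sign_sign] at h1
    rw [h1]
    exact sign_congr (by rwa [add_comm]) c
  · rintro rfl
    rw [sign_sign]
    exact sign_congr (by rwa [add_assoc, add_comm t s]) c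

end LocSys

open Classical in
/-- The local system on the circle `I`, twisted by the sign `(-1) ^ ram I` and oriented in such a
way that the action of `SL₂(ℂ)` only permutes the circles. -/
def normalize (I : ExpCircle) (c : LocSys) : LocSys :=
  if I.1 = ∞ then c.sign I.2.ram else (c.sign I.2.ram).inv

theorem normalize_involutive (I : ExpCircle) : Function.Involutive (normalize I) := by
  intro c
  unfold normalize
  split_ifs
  · rw [LocSys.sign_sign, LocSys.sign_of_even (Even.add_self _)]
  · rw [LocSys.inv_sign, LocSys.inv_sign, LocSys.inv_sign, LocSys.sign_sign,
      LocSys.sign_of_even (Even.add_self _), LocSys.inv_inv]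

theorem normalize_fst (I : ExpCircle) (c : LocSys) : (normalize I c).1 = c.1 := by
  unfold normalize
  split_ifs <;> rfl

/-- By parity, the sign of the Gaussian factor is the quotient of the signs `(-1) ^ ram` of target
and source, so normalization absorbs it together with the change of orientation. -/
theorem normalize_eq_iff {a b : OnePoint ℂ} {q p : ExpFactor} (h : LegendreTransform a q b p)
    {c c' : LocSys} :
    normalize (b, ⟦p⟧) c' = normalize (a, ⟦q⟧) c ↔ c' = legendreLocSys a q b c := by
  have hpar := legendreTransform_parity h
  have hiff := @LocSys.sign_eq_iff q.ram p.ram (hessianIrr a q) hpar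
  unfold normalize legendreLocSys
  classical
  change (if b = ∞ then c'.sign p.ram else (c'.sign p.ram).inv)
    = (if a = ∞ then c.sign q.ram else (c.sign q.ram).inv) ↔ _
  rcases legendreTransform_infty h with rfl | rfl
  · by_cases hb : b = ∞
    · rw [if_pos hb, if_pos rfl, if_pos ⟨rfl, hb⟩]
      exact hiff
    · rw [if_neg hb, if_pos rfl, if_neg fun h => hb h.2, LocSys.inv_sign, hiff]
      constructor
      · intro h1
        rw [← h1, LocSys.inv_inv]
      · rintro rfl
        rw [LocSys.inv_inv]
  · by_cases ha : a = ∞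
    · rw [if_pos ha, if_pos rfl, if_pos ⟨ha, rfl⟩]
      exact hiff
    · rw [if_neg ha, if_pos rfl, if_neg fun h => ha h.1, LocSys.inv_sign, LocSys.inv_sign]
      exact hiff

/-- `D'` is obtained from `D` by moving the circles with `A`. -/
def Transports (A : SL(2, ℂ)) (D D' : FormalData) : Prop :=
  ∀ I, normalize (act A I) (D'.loc (act A I)) = normalize I (D.loc I)

theorem Transports.unique {A : SL(2, ℂ)} {D D' D'' : FormalData} (h' : Transports A D D')
    (h'' : Transports A D D'') : D' = D'' := by
  ext1
  funext I
  obtain ⟨J, rfl⟩ := (actEquiv A).surjective I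
  exact (normalize_involutive _).injective ((h' J).trans (h'' J).symm)

theorem Transports.mul {A B : SL(2, ℂ)} {D D' D'' : FormalData} (h' : Transports B D D')
    (h'' : Transports A D' D'') : Transports (A * B) D D'' := fun I => by
  rw [act_mul, h'' _, h' I]

theorem exists_transports (A : SL(2, ℂ)) (D : FormalData) : ∃ D', Transports A D D' := by
  refine ⟨⟨fun J => normalize J (normalize ((actEquiv A).symm J) (D.loc ((actEquiv A).symm J))),
    ?_⟩, fun I => ?_⟩
  · simp only [normalize_fst]
    exact D.finite_support.preimage (actEquiv A).symm.injective.injOn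
  · have : (actEquiv A).symm (act A I) = I := (actEquiv A).symm_apply_apply I
    simp only [this]
    rw [normalize_involutive]

theorem isFourier_iff {D D' : FormalData} : IsFourier D D' ↔ Transports fourierMatrix D D' := by
  constructor
  · rintro h ⟨a, Q⟩
    induction Q using Quotient.inductionOn with
    | h q =>
      obtain ⟨b, p, hL⟩ := exists_legendreTransform a q
      rw [(moves_fourier hL).act_eq, normalize_eq_iff hL]
      exact h a q b p hL
  · intro h a q b p hL
    have := h (a, ⟦q⟧)
    rwa [(moves_fourier hL).act_eq, normalize_eq_iff hL] at this

theorem normalize_congr {I J : ExpCircle} (h1 : I.1 = ∞ ↔ J.1 = ∞) (h2 : I.2.ram = J.2.ram) :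
    normalize I = normalize J := by
  funext c
  unfold normalize
  by_cases h : I.1 = ∞
  · rw [if_pos h, if_pos (h1.1 h), h2]
  · rw [if_neg h, if_neg (mt h1.2 h), h2]

theorem ram_sub_monomial (q : ExpFactor) (n : ℕ) (hn : 0 < n) (c : ℂ) :
    (q - monomial n hn c).ram = q.ram := by
  refine Nat.dvd_antisymm
    (ExpFactor.ram_sub_dvd dvd_rfl (by simp [ExpFactor.ram_monomial])) ?_
  conv_lhs => rw [← sub_add_cancel q (monomial n hn c)]
  exact ExpFactor.ram_add_dvd dvd_rfl (by simp [ExpFactor.ram_monomial])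

theorem normalize_twist (lam : ℂ) (q : ExpFactor) :
    normalize (∞, ⟦q - monomial 2 two_pos (lam / 2)⟧) = normalize (∞, ⟦q⟧) :=
  normalize_congr Iff.rfl (ram_sub_monomial q _ _ _)

theorem isTwist_iff {lam : ℂ} {D D' : FormalData} :
    IsTwist lam D D' ↔ Transports (twistMatrix lam) D D' := by
  constructor
  · rintro ⟨h1, h2⟩ ⟨a, Q⟩
    induction Q using Quotient.inductionOn with
    | h q =>
      induction a using OnePoint.rec with
      | infty => rw [(moves_twist_infty lam q).act_eq, normalize_twist, h1]
      | coe a => rw [(moves_twist_coe lam a q).act_eq, h2]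
  · intro h
    refine ⟨fun q => ?_, fun a q => ?_⟩
    · have := h (∞, ⟦q⟧)
      rw [(moves_twist_infty lam q).act_eq, normalize_twist] at this
      exact (normalize_involutive _).injective this
    · have := h ((a : OnePoint ℂ), ⟦q⟧)
      rw [(moves_twist_coe lam a q).act_eq] at this
      exact (normalize_involutive _).injective this

theorem normalize_scaling {lam : ℂˣ} (a b : OnePoint ℂ) (h : a = ∞ ↔ b = ∞) (s : Exponent → ℂ)
    (q : ExpFactor) :
    normalize (a, ⟦q.rescale fun k => (lam : ℂ) ^ s k⟧) = normalize (b, ⟦q⟧) := by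
  refine normalize_congr h ?_
  exact ExpFactor.ram_rescale (fun k => by simp [Complex.cpow_eq_zero_iff]) q

theorem isScaling_iff {lam : ℂˣ} {D D' : FormalData} :
    IsScaling lam D D' ↔ Transports (scalingMatrix lam) D D' := by
  have hfin (x y : ℂ) : (x : OnePoint ℂ) = ∞ ↔ (y : OnePoint ℂ) = ∞ := by simp
  constructor
  · rintro ⟨h1, h2⟩ ⟨a, Q⟩
    induction Q using Quotient.inductionOn with
    | h q =>
      induction a using OnePoint.rec with
      | infty =>
        rw [(moves_scaling_infty lam q).act_eq, normalize_scaling ∞ ∞ Iff.rfl, h1]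
      | coe a =>
        rw [(moves_scaling_coe lam a q).act_eq, normalize_scaling _ _ (hfin _ a), h2]
  · intro h
    refine ⟨fun q => ?_, fun a q => ?_⟩
    · have := h (∞, ⟦q⟧)
      rw [(moves_scaling_infty lam q).act_eq, normalize_scaling ∞ ∞ Iff.rfl] at this
      exact (normalize_involutive _).injective this
    · have := h ((a : OnePoint ℂ), ⟦q⟧)
      rw [(moves_scaling_coe lam a q).act_eq, normalize_scaling _ _ (hfin _ a)] at this
      exact (normalize_involutive _).injective this

theorem transports_one (D : FormalData) : Transports 1 D D := fun I => by rw [act_one]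

/-- `Transports` mentions only the matrix, so this contains the independence of the factorization.
For the converse, one factorization of `A` yields some image, which uniqueness of transport
identifies with `D'`. -/
theorem acts_iff {A : SL(2, ℂ)} {D D' : FormalData} : Acts A D D' ↔ Transports A D D' := by
  constructor
  · intro h
    induction h with
    | one D => exact transports_one D
    | fourier _ h ih => exact ih.mul (isFourier_iff.1 h)
    | twist lam _ h ih => exact ih.mul (isTwist_iff.1 h)
    | scaling lam _ h ih => exact ih.mul (isScaling_iff.1 h)
  · have main : ∃ D'', Acts A D D'' ∧ Transports A D D'' := by
      induction A using SL_induction with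
      | one => exact ⟨D, .one D, transports_one D⟩
      | fourier A ih =>
        obtain ⟨E, h1, h2⟩ := ih
        obtain ⟨E', h⟩ := exists_transports fourierMatrix E
        exact ⟨E', .fourier h1 (isFourier_iff.2 h), h2.mul h⟩
      | twist lam A ih =>
        obtain ⟨E, h1, h2⟩ := ih
        obtain ⟨E', h⟩ := exists_transports (twistMatrix lam) E
        exact ⟨E', .twist lam h1 (isTwist_iff.2 h), h2.mul h⟩
      | scaling lam A ih =>
        obtain ⟨E, h1, h2⟩ := ih
        obtain ⟨E', h⟩ := exists_transports (scalingMatrix lam) E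
        exact ⟨E', .scaling lam h1 (isScaling_iff.2 h), h2.mul h⟩
    obtain ⟨E, h1, h2⟩ := main
    intro h
    rwa [h.unique h2]

theorem existsUnique_acts (A : SL(2, ℂ)) (D : FormalData) : ∃! D', Acts A D D' := by
  obtain ⟨E, h⟩ := exists_transports A D
  exact ⟨E, acts_iff.2 h, fun E' h' => (acts_iff.1 h').unique h⟩

theorem Transports.fst_eq {A : SL(2, ℂ)} {D D' : FormalData} (h : Transports A D D')
    (I : ExpCircle) : (D'.loc (act A I)).1 = (D.loc I).1 := by
  rw [← normalize_fst (act A I), h I, normalize_fst]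

/-! ### Genericity -/

theorem Represents.fst_eq_infty_iff {v : LaurentSeries ℂ × LaurentSeries ℂ} {I : ExpCircle}
    (h : Represents v I) : I.1 = ∞ ↔ ¬OrdGE 0 v.1 := by
  rcases id h.tame_or with ⟨x, rfl, ht⟩ | ⟨a, q, r, rfl, hc, hr, hqr, σ, c, hc', hσ, hz, hq⟩
  · simp [ht.lead_fst.1]
  · have l := lead_zpow_coord hσ hc' (eps a * r)
    rw [hz, coordAlong_eq]
    induction a using OnePoint.rec with
    | infty =>
      simp only [true_iff, kap_infty, zero_add]
      intro h
      have := l.le_of_ordGE (zpow_ne_zero _ hc') h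
      simp only [eps_infty] at this
      omega
    | coe a =>
      simp only [OnePoint.coe_ne_infty, false_iff, not_not]
      exact (ordGE_kap _).add (l.1.mono (by simp))

/-- A representing curve leaves every bounded region of the phase plane; this is what makes a
generic linear coordinate have a pole. -/
theorem Represents.not_ordGE {v : LaurentSeries ℂ × LaurentSeries ℂ} {I : ExpCircle}
    (h : Represents v I) : ¬(OrdGE 0 v.1 ∧ OrdGE 0 v.2) := by
  rintro ⟨h1, h2⟩
  rcases id h.tame_or with ⟨x, rfl, ht⟩ | ⟨a, q, r, rfl, hc, hr, hqr, σ, c, hc', hσ, hz, hq⟩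
  · obtain ⟨⟨n, c, hn, hc, hl⟩, -⟩ := ht
    have := hl.le_of_ordGE hc h2
    omega
  · have ha : a ≠ ∞ := fun ha => h.fst_eq_infty_iff.1 ha h1
    refine hc.elim ha fun hq0 => hq0 ?_
    refine ExpFactor.eq_zero_of_ordGE_along hqr hr hσ hc' (ordGE_of_dt le_rfl ?_)
    have := (h2.mul h1.dt_zero).sub hq
    rw [zero_add, sub_sub_cancel] at this
    exact this.mono (by omega)

theorem coeff_rho_fst (A : SL(2, ℂ)) (v : LaurentSeries ℂ × LaurentSeries ℂ) (n : ℤ) :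
    (rho A v).1.coeff n = A 1 1 * v.1.coeff n - A 1 0 * v.2.coeff n := by
  simp [rho]

theorem mem_genericSet_iff {D : FormalData} {A : SL(2, ℂ)} :
    A ∈ genericSet D ↔ ∀ I, (D.loc I).1 ≠ 0 → (act A I).1 = ∞ := by
  constructor
  · rintro ⟨D', h, h'⟩ I hI
    exact h' _ (by rwa [(acts_iff.1 h).fst_eq])
  · intro h
    obtain ⟨D', h'⟩ := exists_transports A D
    refine ⟨D', acts_iff.2 h', fun J hJ => ?_⟩
    obtain ⟨I, rfl⟩ := (actEquiv A).surjective J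
    exact h I fun h0 => hJ ((h'.fst_eq I).trans h0)

theorem isOpen_setOf_act_infty (I : ExpCircle) : IsOpen {A : SL(2, ℂ) | (act A I).1 = ∞} := by
  obtain ⟨v, hv⟩ := exists_represents I
  have : {A : SL(2, ℂ) | (act A I).1 = ∞} = ⋃ (n : ℤ) (_ : n < 0),
      {A : SL(2, ℂ) | A 1 1 * v.1.coeff n - A 1 0 * v.2.coeff n ≠ 0} := by
    ext A
    rw [Set.mem_ofPred_eq, (moves_act A I v hv).fst_eq_infty_iff]
    simp [OrdGE, coeff_rho_fst]
  rw [this]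
  refine isOpen_iUnion fun n => isOpen_iUnion fun _ => ?_
  refine isOpen_ne_fun ?_ continuous_const
  have h1 : Continuous fun A : SL(2, ℂ) => A 1 1 :=
    continuous_subtype_val.matrix_elem 1 1
  have h2 : Continuous fun A : SL(2, ℂ) => A 1 0 :=
    continuous_subtype_val.matrix_elem 1 0
  fun_prop

theorem genericSet_eq (D : FormalData) :
    genericSet D = ⋂ I ∈ {I | (D.loc I).1 ≠ 0}, {A : SL(2, ℂ) | (act A I).1 = ∞} := by
  ext A
  rw [mem_genericSet_iff]
  simp

theorem isOpen_genericSet (D : FormalData) : IsOpen (genericSet D) := by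
  rw [genericSet_eq]
  exact D.finite_support.isOpen_biInter fun I _ => isOpen_setOf_act_infty I

/-- The opposite transvection, used to perturb a matrix. -/
def lowerMatrix (x : ℂ) : SL(2, ℂ) := ⟨!![1, 0; x, 1], by simp [Matrix.det_fin_two]⟩

theorem rho_lowerMatrix (x : ℂ) (v : LaurentSeries ℂ × LaurentSeries ℂ) :
    rho (lowerMatrix x) v = (v.1 - HahnSeries.C x * v.2, v.2) := by
  simp only [rho, lowerMatrix]
  simp [HahnSeries.single_zero_one]

/-- Two bad parameters would make two independent combinations of `z` and `ξ` regular, hence both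
coordinates. -/
theorem finite_setOf_act_lower_ne_infty (I : ExpCircle) :
    {x : ℂ | (act (lowerMatrix x) I).1 ≠ ∞}.Finite := by
  obtain ⟨v, hv⟩ := exists_represents I
  have hmem (x : ℂ) : (act (lowerMatrix x) I).1 ≠ ∞ ↔ OrdGE 0 (v.1 - HahnSeries.C x * v.2) := by
    rw [Ne, (moves_act (lowerMatrix x) I v hv).fst_eq_infty_iff, not_not, rho_lowerMatrix]
  refine Set.Subsingleton.finite fun x hx y hy => ?_
  rw [Set.mem_ofPred_eq, hmem] at hx hy
  by_contra hxy
  have h1 : OrdGE 0 v.2 := by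
    have := (hy.sub hx).C_mul (x - y)⁻¹
    have h2 : HahnSeries.C (x - y)⁻¹
        * (v.1 - HahnSeries.C y * v.2 - (v.1 - HahnSeries.C x * v.2)) = v.2 := by
      have : v.1 - HahnSeries.C y * v.2 - (v.1 - HahnSeries.C x * v.2)
          = HahnSeries.C (x - y) * v.2 := by
        rw [map_sub]
        ring
      rw [this, ← mul_assoc, ← map_mul, inv_mul_cancel₀ (sub_ne_zero.2 hxy), map_one, one_mul]
    rwa [h2] at this
  refine hv.not_ordGE ⟨?_, h1⟩
  have := hx.add (h1.C_mul x)
  rwa [sub_add_cancel] at this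

/-- Through any `A` runs the line `lowerMatrix x * A`, on which finitely many active circles exclude
only finitely many `x`. -/
theorem dense_genericSet (D : FormalData) : Dense (genericSet D) := by
  intro A
  have hfin : {x : ℂ | lowerMatrix x * A ∉ genericSet D}.Finite := by
    refine (D.finite_support.biUnion fun I _ =>
      finite_setOf_act_lower_ne_infty (act A I)).subset fun x hx => ?_
    rw [Set.mem_ofPred_eq, mem_genericSet_iff] at hx
    push Not at hx
    obtain ⟨I, hI, h⟩ := hx
    rw [act_mul] at h
    exact Set.mem_biUnion hI h
  have hd : Dense {x : ℂ | lowerMatrix x * A ∈ genericSet D} := by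
    have := (hfin.countable.dense_compl ℝ)
    simpa [Set.compl_ofPred] using this
  have hcont : Continuous fun x : ℂ => lowerMatrix x * A := by
    refine Continuous.mul ?_ continuous_const
    refine Continuous.subtype_mk ?_ _
    refine continuous_matrix fun i j => ?_
    fin_cases i <;> fin_cases j <;> simp <;> fun_prop
  have h0 : lowerMatrix 0 * A = A := by
    have : lowerMatrix 0 = 1 := by
      refine Subtype.ext ?_
      ext i j
      fin_cases i <;> fin_cases j <;> simp [lowerMatrix]
    rw [this, one_mul]
  have h1 : (fun x : ℂ => lowerMatrix x * A) 0 ∈ closure (genericSet D) :=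
    map_mem_closure (f := fun x : ℂ => lowerMatrix x * A) hcont (hd 0) fun x hx => hx
  simpa [h0] using h1

/-! ### Leaves of circles and the irregularity of `Hom` -/

namespace ExpFactor

theorem rotate_sub (m : ℤ) (p q : ExpFactor) : rotate m (p - q) = rotate m p - rotate m q := by
  ext k
  simp only [rotate_apply, Finsupp.sub_apply, mul_sub]

theorem rotate_injective (m : ℤ) : Function.Injective (rotate m) := by
  intro p q h
  have := congrArg (rotate (-m)) h
  rwa [rotate_rotate, rotate_rotate, neg_add_cancel, rotate_zero, rotate_zero] at this

theorem rotate_eq_self_iff {j : ℤ} {q : ExpFactor} : rotate j q = q ↔ (q.ram : ℤ) ∣ j := by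
  have key : ∀ k : Exponent, Complex.exp (-(2 * Real.pi * Complex.I * (k.1 : ℂ) * (j : ℂ))) = 1 ↔
      (k.1.den : ℤ) ∣ j := by
    intro k
    have hpi : (2 * Real.pi * Complex.I : ℂ) ≠ 0 := Complex.two_pi_I_ne_zero
    have hden : (k.1.den : ℂ) ≠ 0 := by exact_mod_cast k.1.den_ne_zero
    have hk : (k.1 : ℂ) = k.1.num / k.1.den := by
      rw [eq_div_iff hden]
      have : ((k.1 * k.1.den : ℚ≥0) : ℂ) = ((k.1.num : ℚ≥0) : ℂ) := by
        rw [NNRat.mul_den_eq_num]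
      exact_mod_cast this
    rw [Complex.exp_eq_one_iff]
    constructor
    · rintro ⟨n, hn⟩
      have h1 : -((k.1 : ℂ) * j) = n := by
        refine mul_left_cancel₀ hpi ?_
        linear_combination hn
      rw [hk] at h1
      field_simp at h1
      have h2 : -((k.1.num : ℤ) * j) = k.1.den * n := by exact_mod_cast h1
      have h3 : (k.1.den : ℤ) ∣ k.1.num * j := ⟨-n, by linear_combination -h2⟩
      exact (Nat.isCoprime_iff_coprime.2 k.1.coprime_num_den.symm).dvd_of_dvd_mul_left h3
    · rintro ⟨n, rfl⟩
      refine ⟨-(k.1.num * n), ?_⟩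
      rw [hk]
      push_cast
      field_simp
  constructor
  · intro h
    have h1 : q.ram ∣ j.natAbs := by
      rw [ram_dvd_iff]
      intro k hk
      rw [← Int.natCast_dvd, ← key]
      have h2 := DFunLike.congr_fun h k
      rw [rotate_apply] at h2
      exact mul_right_cancel₀ (Finsupp.mem_support_iff.1 hk) (by rw [h2, one_mul])
    rwa [Int.natCast_dvd]
  · intro h
    ext k
    rw [rotate_apply]
    by_cases hk : q k = 0
    · rw [hk, mul_zero]
    · rw [(key k).2, one_mul]
      refine dvd_trans ?_ h
      exact_mod_cast ram_dvd_iff.1 dvd_rfl k (Finsupp.mem_support_iff.2 hk)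

open Classical in
/-- The determinations of `q`. -/
def leaves (q : ExpFactor) : Finset ExpFactor :=
  (Finset.range q.ram).image fun j : ℕ => rotate (j : ℤ) q

theorem mem_leaves {q x : ExpFactor} : x ∈ leaves q ↔ (⟦x⟧ : LocalCircle) = ⟦q⟧ := by
  rw [leaves, Finset.mem_image]
  constructor
  · rintro ⟨j, -, rfl⟩
    exact (Quotient.sound ⟨(j : ℤ), rfl⟩ : (⟦q⟧ : LocalCircle) = _).symm
  · intro h
    obtain ⟨j, rfl⟩ := Quotient.exact h.symm
    have hr : (0 : ℤ) < q.ram := by exact_mod_cast q.ram_pos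
    refine ⟨(j % q.ram).toNat, ?_, ?_⟩
    · have := Int.emod_lt_of_pos j hr
      rw [Finset.mem_range]
      omega
    · rw [Int.toNat_of_nonneg (Int.emod_nonneg j hr.ne')]
      conv_rhs => rw [← Int.emod_add_mul_ediv j q.ram, ← rotate_rotate,
        rotate_eq_self_iff.2 (dvd_mul_right _ _)]

theorem leaves_injOn (q : ExpFactor) :
    Set.InjOn (fun j : ℕ => rotate (j : ℤ) q) (Finset.range q.ram) := by
  intro i hi j hj h
  simp only [Finset.coe_range, Set.mem_Iio] at hi hj
  have h1 : rotate ((i : ℤ) - j) q = q := by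
    have := congrArg (rotate (-(j : ℤ))) h
    simp only [rotate_rotate] at this
    rwa [neg_add_cancel, rotate_zero, add_comm, ← sub_eq_add_neg] at this
  have h2 := Int.eq_zero_of_abs_lt_dvd (rotate_eq_self_iff.1 h1) (by rw [abs_lt]; omega)
  omega

theorem card_leaves (q : ExpFactor) : (leaves q).card = q.ram := by
  rw [leaves, Finset.card_image_of_injOn (leaves_injOn q), Finset.card_range]

/-- Rotation of `q` has period `q.ram`, so each leaf is visited `M / q.ram` times. -/
theorem sum_range_rotate {q : ExpFactor} {M : ℕ} (hM : q.ram ∣ M) (f : ExpFactor → ℚ≥0) :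
    (q.ram : ℚ≥0) * ∑ j ∈ Finset.range M, f (rotate (j : ℤ) q) = M * ∑ x ∈ leaves q, f x := by
  obtain ⟨m, rfl⟩ := hM
  have h : ∑ j ∈ Finset.range (q.ram * m), f (rotate (j : ℤ) q) = m * ∑ x ∈ leaves q, f x := by
    induction m with
    | zero => simp
    | succ m ih =>
      rw [mul_add_one, Finset.sum_range_add, ih, leaves, Finset.sum_image (leaves_injOn q)]
      push_cast
      rw [add_one_mul]
      congr 1
      refine Finset.sum_congr rfl fun x _ => ?_
      rw [add_comm ((q.ram : ℤ) * m), ← rotate_rotate, rotate_eq_self_iff.2 (dvd_mul_right _ _)]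
  rw [h]
  push_cast
  ring

theorem irr_eq (q : ExpFactor) : (q.irr : ℚ≥0) = q.ram * q.slope := by
  obtain ⟨n, hn⟩ := exists_natCast_eq_slope_mul (dvd_refl q.ram)
  rw [irr, mul_comm, ← hn, Nat.floor_natCast]

theorem rotate_mem_leaves {m : ℤ} {q x : ExpFactor} : rotate m x ∈ leaves q ↔ x ∈ leaves q := by
  rw [mem_leaves, mem_leaves]
  have : (⟦rotate m x⟧ : LocalCircle) = ⟦x⟧ := (Quotient.sound ⟨m, rfl⟩ : (⟦x⟧ : LocalCircle) = _).symm
  rw [this]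

end ExpFactor

open ExpFactor Classical in
-- Rotating both leaves simultaneously shows that the count does not depend on the chosen leaf of
-- `K`.
theorem homClass_eq_card (q p : ExpFactor) (K : LocalCircle) {d : ExpFactor} (hd : ⟦d⟧ = K) :
    homClass ⟦q⟧ ⟦p⟧ K = ((leaves q ×ˢ leaves p).filter fun x => x.2 - x.1 = d).card := by
  have h1 : homClass ⟦q⟧ ⟦p⟧ K
      = ((leaves q ×ˢ leaves p).filter fun x => x.2 - x.1 = K.out).card := by
    rw [homClass, ← Set.ncard_coe_finset]
    congr 1
    ext x
    simp [mem_leaves, and_assoc]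
  rw [h1]
  obtain ⟨j, hj⟩ : ∃ j, rotate j K.out = d := Quotient.exact ((Quotient.out_eq K).trans hd.symm)
  refine Finset.card_bij (fun x _ => (rotate j x.1, rotate j x.2)) ?_ ?_ ?_
  · intro x hx
    simp only [Finset.mem_filter, Finset.mem_product, rotate_mem_leaves] at hx ⊢
    rw [← rotate_sub, hx.2, hj]
    exact ⟨hx.1, rfl⟩
  · intro x _ y _ h
    simp only [Prod.mk.injEq] at h
    exact Prod.ext (rotate_injective j h.1) (rotate_injective j h.2)
  · intro y hy
    simp only [Finset.mem_filter, Finset.mem_product] at hy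
    have hback (z : ExpFactor) : rotate j (rotate (-j) z) = z := by
      rw [rotate_rotate, add_neg_cancel, rotate_zero]
    refine ⟨(rotate (-j) y.1, rotate (-j) y.2), ?_, by simp [hback]⟩
    simp only [Finset.mem_filter, Finset.mem_product, rotate_mem_leaves]
    refine ⟨hy.1, rotate_injective j ?_⟩
    rw [rotate_sub, hback, hback, hy.2, hj]

open ExpFactor Classical in
-- Exactly `n_K * ram K` pairs of leaves have their difference on `K`, each of slope `slope K`;
-- together they give `n_K * Irr K`.
theorem irrClass_homClass (q p : ExpFactor) :
    (irrClass (homClass ⟦q⟧ ⟦p⟧) : ℚ≥0)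
      = ∑ x ∈ leaves q, ∑ y ∈ leaves p, (y - x).slope := by
  set S := leaves q ×ˢ leaves p with hS
  have hzero : ∀ K : LocalCircle, K ∉ S.image (fun x => (⟦x.2 - x.1⟧ : LocalCircle)) →
      homClass ⟦q⟧ ⟦p⟧ K = 0 := by
    intro K hK
    rw [homClass_eq_card q p K (Quotient.out_eq K), Finset.card_eq_zero, Finset.filter_eq_empty_iff]
    intro x hx h
    refine hK (Finset.mem_image.2 ⟨x, hx, ?_⟩)
    rw [h]
    exact Quotient.out_eq K
  have h1 : irrClass (homClass ⟦q⟧ ⟦p⟧)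
      = ∑ K ∈ S.image (fun x => (⟦x.2 - x.1⟧ : LocalCircle)), homClass ⟦q⟧ ⟦p⟧ K * LocalCircle.irr K := by
    refine finsum_eq_sum_of_support_subset _ fun K hK => ?_
    by_contra h
    rw [Function.mem_support, hzero K h, zero_mul] at hK
    exact hK rfl
  have h2 : ∀ K : LocalCircle, ((homClass ⟦q⟧ ⟦p⟧ K * LocalCircle.irr K : ℕ) : ℚ≥0)
      = ∑ x ∈ S with (⟦x.2 - x.1⟧ : LocalCircle) = K, (x.2 - x.1).slope := by
    intro K
    induction K using Quotient.inductionOn with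
    | h d =>
      have h3 : (S.filter fun x => (⟦x.2 - x.1⟧ : LocalCircle) = ⟦d⟧).card
          = d.ram * homClass ⟦q⟧ ⟦p⟧ ⟦d⟧ := by
        rw [Finset.card_eq_sum_card_fiberwise (f := fun x : ExpFactor × ExpFactor => x.2 - x.1)
          (t := leaves d)
          fun x hx => mem_leaves.2 (Finset.mem_filter.1 hx).2]
        rw [← card_leaves d, ← smul_eq_mul, ← Finset.sum_const]
        refine Finset.sum_congr rfl fun e he => ?_
        rw [homClass_eq_card q p ⟦d⟧ (mem_leaves.1 he), Finset.filter_filter]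
        congr 1
        refine Finset.filter_congr fun x _ => ?_
        constructor
        · exact fun h => h.2
        · intro h
          exact ⟨mem_leaves.1 (show x.2 - x.1 ∈ leaves d from h ▸ he), h⟩
      have h4 : ∀ x ∈ S.filter (fun x => (⟦x.2 - x.1⟧ : LocalCircle) = ⟦d⟧),
          (x.2 - x.1).slope = d.slope := by
        intro x hx
        obtain ⟨j, hj⟩ := Quotient.exact (Finset.mem_filter.1 hx).2
        rw [← hj, slope_rotate]
      rw [Finset.sum_congr rfl h4, Finset.sum_const, h3, nsmul_eq_mul]
      have : ((LocalCircle.irr (Quotient.mk _ d) : ℕ) : ℚ≥0) = d.ram * d.slope := irr_eq d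
      push_cast
      rw [this]
      ring
  rw [h1, Nat.cast_sum, Finset.sum_congr rfl fun K _ => h2 K,
    ← Finset.sum_product (s := leaves q) (t := leaves p) (f := fun x => (x.2 - x.1).slope)]
  exact Finset.sum_fiberwise_of_maps_to (fun x hx => Finset.mem_image_of_mem _ hx) _

open ExpFactor in
/-- The irregularity of `Hom` as a sum over the rotations of one of the two factors. -/
theorem ram_mul_ram_mul_sum_slope (q p : ExpFactor) {M : ℕ} (hM : p.ram ∣ M) :
    (q.ram * p.ram : ℚ≥0) * ∑ j ∈ Finset.range M, (rotate (j : ℤ) p - q).slope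
      = M * irrClass (homClass ⟦q⟧ ⟦p⟧) := by
  have h1 : ∀ x ∈ leaves q, ∑ y ∈ leaves p, (y - x).slope = ∑ y ∈ leaves p, (y - q).slope := by
    intro x hx
    obtain ⟨j, rfl⟩ := Quotient.exact (mem_leaves.1 hx).symm
    refine (Finset.sum_bij (fun y _ => rotate j y) (fun y hy => rotate_mem_leaves.2 hy)
      (fun y _ y' _ h => rotate_injective j h) (fun y hy => ⟨rotate (-j) y, rotate_mem_leaves.2 hy,
        by rw [rotate_rotate, add_neg_cancel, rotate_zero]⟩) fun y _ => ?_).symm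
    rw [← rotate_sub, slope_rotate]
  rw [irrClass_homClass, Finset.sum_congr rfl h1, Finset.sum_const, card_leaves, mul_assoc,
    sum_range_rotate hM fun y => (y - q).slope, nsmul_eq_mul]
  ring

/-! ### Pole orders of differences of dual circles at infinity -/

/-- The order of the pole of a Laurent series, `0` for a power series. -/
def pol (f : LaurentSeries ℂ) : ℕ := (-f.order).toNat

theorem Lead.pol_eq {f : LaurentSeries ℂ} {n : ℤ} {c : ℂ} (h : Lead f n c) (hc : c ≠ 0) :
    pol f = (-n).toNat := by rw [pol, h.order_eq hc]

theorem pol_of_ordGE {f : LaurentSeries ℂ} (h : OrdGE 0 f) : pol f = 0 := by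
  rcases eq_or_ne f 0 with rfl | hf
  · simp [pol]
  · obtain ⟨n, c, hc, hl⟩ := exists_lead hf
    rw [hl.pol_eq hc]
    have := hl.le_of_ordGE hc h
    omega

theorem pol_of_dt {f g : LaurentSeries ℂ} (h : OrdGE 0 (dt f - g)) {n : ℤ} {c : ℂ}
    (hg : Lead g n c) (hc : c ≠ 0) : pol f = (-(n + 1)).toNat := by
  rcases lt_or_ge n 0 with hn | hn
  · have h1 : Lead (dt f) n c := by
      have := hg.add_ordGE h hn
      rwa [add_sub_cancel] at this
    have hf : f ≠ 0 := by
      rintro rfl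
      rw [map_zero] at h1
      exact h1.ne_zero hc rfl
    obtain ⟨k, d, hd, hk⟩ := exists_lead hf
    rcases eq_or_ne k 0 with rfl | hk0
    · have := h1.le_of_ordGE hc hk.1.dt_zero
      omega
    · have := (h1.unique hk.dt hc (mul_ne_zero (by exact_mod_cast hk0) hd)).1
      rw [hk.pol_eq hd]
      omega
  · rw [pol_of_ordGE]
    · omega
    · refine ordGE_of_dt le_rfl ?_
      have := h.add (hg.1.mono hn)
      rw [sub_add_cancel] at this
      exact this.mono (by omega)

theorem pol_of_dt_zero {f : LaurentSeries ℂ} (h : OrdGE 0 (dt f)) : pol f = 0 :=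
  pol_of_ordGE (ordGE_of_dt le_rfl (h.mono (by omega)))

theorem pol_along {q : ExpFactor} {r : ℕ} (hr : q.ram ∣ r) (hr0 : 0 < r) {τ : LaurentSeries ℂ}
    {c : ℂ} (hτ : Lead τ 1 c) (hc : c ≠ 0) : (pol (q.along r τ) : ℚ≥0) = q.slope * r := by
  rcases eq_or_ne q 0 with rfl | hq
  · rw [ExpFactor.along_zero, pol_of_ordGE (ordGE_zero 0)]
    simp [ExpFactor.slope]
  · obtain ⟨n, d, -, hn, hd, hl⟩ := ExpFactor.lead_along hq hr hr0 hτ hc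
    rw [hl.pol_eq hd, ← hn, neg_neg, Int.toNat_natCast]

theorem IsSub.congr {φ ψ : LaurentSeries ℂ →+* LaurentSeries ℂ} {σ : LaurentSeries ℂ}
    (h : IsSub φ σ) (h' : IsSub ψ σ) {f : LaurentSeries ℂ} (hf : OrdGE 0 f) : φ f = ψ f := by
  obtain ⟨g, rfl⟩ := ordGE_zero_iff.1 hf
  obtain ⟨s, rfl, -, -, hφ⟩ := h
  obtain ⟨s', hs, -, -, hψ⟩ := h'
  obtain rfl : s = s' := HahnSeries.ofPowerSeries_injective hs
  rw [hφ, hψ]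

/-- The circles `⟨q⟩_∞` and `⟨p⟩_∞` are dual, with coordinates `z = t ^ (-N)`, `ξ = θ ^ (-N')`. -/
structure Dual (N N' : ℕ) (q p : ExpFactor) (θ : LaurentSeries ℂ) (β : ℂ) : Prop where
  ne_zero : β ≠ 0
  lead : Lead θ 1 β
  ram_left : q.ram ∣ N
  ram_right : p.ram ∣ N'
  deriv : θ ^ (-(N' : ℤ)) * dt (unif ^ (-(N : ℤ))) = dt (q.along N unif)
  value : OrdGE 0 (p.along N' θ - (q.along N unif - θ ^ (-(N' : ℤ)) * unif ^ (-(N : ℤ))))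

/-- Substituting `t ^ m` for `t` and taking an `m`-th root of the dual uniformizer lets two circles
be brought to common ramifications. -/
theorem Stationary.exists_dual {q p : ExpFactor} {r' : ℕ} (h : Stationary ∞ q ∞ p r') {m : ℕ}
    (hm : 0 < m) : ∃ θ β, Dual (m * q.ram) (m * r') q p θ β := by
  obtain ⟨hr', hp, τ, c, hc, hτ, hd, hval⟩ := h
  have hlam : Lead (unif ^ m) m 1 := by simpa using lead_unif.pow m
  obtain ⟨φ, hφ⟩ := exists_isSub hlam one_ne_zero (by omega)
  have hT : Lead (φ τ) (1 * m) c := by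
    have := hφ.lead hlam one_ne_zero (by omega) hτ
    simpa using this
  obtain ⟨θ, β, hβ, hθ, hθT⟩ := exists_root hT hc (by omega)
  rw [zpow_natCast] at hθT
  have hz : φ (coordAlong ∞ q.ram unif) = unif ^ (-((m * q.ram : ℕ) : ℤ)) := by
    rw [hφ.map_coordAlong, unif, hφ.map_single, coordAlong_eq, kap_infty, zero_add, eps_infty,
      ← zpow_natCast unif m, ← zpow_mul]
    congr 1
    push_cast
    ring
  have hξ : φ (coordAlong ∞ r' τ) = θ ^ (-((m * r' : ℕ) : ℤ)) := by
    rw [hφ.map_coordAlong, coordAlong_eq, kap_infty, zero_add, eps_infty, ← hθT,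
      ← zpow_natCast θ m, ← zpow_mul]
    congr 1
    push_cast
    ring
  have hQ : φ (q.along q.ram unif) = q.along (m * q.ram) unif := by
    rw [ExpFactor.map_along hφ, unif, hφ.map_single, ExpFactor.along_mul dvd_rfl]
    rfl
  have hP : φ (p.along r' τ) = p.along (m * r') θ := by
    rw [ExpFactor.map_along hφ, ← hθT, ExpFactor.along_mul hp]
  refine ⟨θ, β, hβ, hθ, dvd_mul_left _ _, hp.mul_left m, ?_, ?_⟩
  · rw [← hz, ← hξ, ← hQ, hφ.dt, hφ.dt, ← hd, map_mul, mul_assoc]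
  · have := hφ.ordGE hval
    rwa [map_sub, map_sub, map_mul, hz, hξ, hQ, hP] at this

theorem Dual.dt_value {N N' : ℕ} {q p : ExpFactor} {θ : LaurentSeries ℂ} {β : ℂ}
    (h : Dual N N' q p θ β) :
    OrdGE 0 (dt (p.along N' θ) + unif ^ (-(N : ℤ)) * dt (θ ^ (-(N' : ℤ)))) := by
  have := h.value.dt_zero
  rw [map_sub, map_sub, dt_mul, h.deriv] at this
  convert this using 1
  ring

section Contact

variable {N N' : ℕ} {q₁ q₂ p₁ p₂ : ExpFactor} {θ₁ θ₂ : LaurentSeries ℂ} {β₁ β₂ : ℂ}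

theorem isSub_C_mul_unif {ω : ℂ} (hω : ω ≠ 0) :
    Lead (HahnSeries.C ω * unif) 1 ω ∧ ∃ φ, IsSub φ (HahnSeries.C ω * unif) := by
  have h : Lead (HahnSeries.C ω * unif) 1 ω := by simpa using lead_unif.C_mul ω
  exact ⟨h, exists_isSub h hω one_pos⟩

/-- The derivative of the difference of two determinations. -/
theorem Dual.dt_sub (h₁ : Dual N N' q₁ p₁ θ₁ β₁) (h₂ : Dual N N' q₂ p₂ θ₂ β₂) {ω : ℂ}
    (hω : ω ^ N = 1) {φ : LaurentSeries ℂ →+* LaurentSeries ℂ}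
    (hφ : IsSub φ (HahnSeries.C ω * unif)) :
    dt (q₂.along N (HahnSeries.C ω * unif) - q₁.along N unif)
      = ((φ θ₂) ^ (-(N' : ℤ)) - θ₁ ^ (-(N' : ℤ))) * dt (unif ^ (-(N : ℤ))) := by
  have hu : φ unif = HahnSeries.C ω * unif := hφ.map_single
  have hz : φ (unif ^ (-(N : ℤ))) = unif ^ (-(N : ℤ)) := by
    rw [map_zpow₀, hu, mul_zpow, ← map_zpow₀, zpow_neg, zpow_natCast, hω, inv_one, map_one,
      one_mul]
  have h1 : dt (q₂.along N (HahnSeries.C ω * unif))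
      = (φ θ₂) ^ (-(N' : ℤ)) * dt (unif ^ (-(N : ℤ))) := by
    conv_rhs => rw [← hz, hφ.dt, ← map_zpow₀, ← mul_assoc, ← map_mul, h₂.deriv, ← hφ.dt]
    rw [ExpFactor.map_along hφ, hu]
  rw [map_sub, h1, ← h₁.deriv]
  ring

/-- The derivative of the difference of two determinations of the dual factors. -/
theorem Dual.dt_sub_dual (h₁ : Dual N N' q₁ p₁ θ₁ β₁) (h₂ : Dual N N' q₂ p₂ θ₂ β₂) {ζ : ℂ}
    (hζ : ζ ^ N' = 1) {ψ : LaurentSeries ℂ →+* LaurentSeries ℂ} {μ : LaurentSeries ℂ}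
    (hψ : IsSub ψ μ) (hμ : ψ θ₂ = HahnSeries.C ζ * θ₁) :
    OrdGE 0 (dt (p₂.along N' (HahnSeries.C ζ * θ₁) - p₁.along N' θ₁)
      - (unif ^ (-(N : ℤ)) - μ ^ (-(N : ℤ))) * dt (θ₁ ^ (-(N' : ℤ)))) := by
  have hξ : ψ (θ₂ ^ (-(N' : ℤ))) = θ₁ ^ (-(N' : ℤ)) := by
    rw [map_zpow₀, hμ, mul_zpow, ← map_zpow₀, zpow_neg, zpow_natCast, hζ, inv_one, map_one,
      one_mul]
  have hz : ψ (unif ^ (-(N : ℤ))) = μ ^ (-(N : ℤ)) := by rw [map_zpow₀, unif, hψ.map_single]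
  have hμ0 : OrdGE 0 (dt μ) := by
    obtain ⟨s, rfl, -⟩ := hψ
    exact (ordGE_ofPS s).dt_zero
  have h2 : OrdGE 0 (dt (p₂.along N' (HahnSeries.C ζ * θ₁))
      + μ ^ (-(N : ℤ)) * dt (θ₁ ^ (-(N' : ℤ)))) := by
    have := (hψ.ordGE h₂.dt_value).mul hμ0
    rw [map_add, add_mul, map_mul, hz, mul_assoc, ← hψ.dt, ← hψ.dt, hξ,
      ExpFactor.map_along hψ, hμ] at this
    simpa using this
  have := h2.sub h₁.dt_value
  rw [map_sub]
  convert this using 1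
  ring

theorem lead_dt_zpow_neg {τ : LaurentSeries ℂ} {c : ℂ} (hτ : Lead τ 1 c) (hc : c ≠ 0) {n : ℕ}
    (hn : 0 < n) : ∃ d ≠ 0, Lead (dt (τ ^ (-(n : ℤ)))) (-(n : ℤ) - 1) d := by
  have h0 : ((-(n : ℤ) : ℤ) : ℂ) ≠ 0 := by exact Int.cast_ne_zero.2 (by omega)
  exact ⟨_, mul_ne_zero h0 (zpow_ne_zero _ hc), (lead_zpow_coord hτ hc (-(n : ℤ))).dt⟩

theorem zpow_neg_sub_ne_zero {x y : ℂ} {n : ℕ} (h : x ^ n ≠ y ^ n) :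
    x ^ (-(n : ℤ)) - y ^ (-(n : ℤ)) ≠ 0 := by
  rw [sub_ne_zero, zpow_neg, zpow_neg, zpow_natCast, zpow_natCast]
  exact fun h' => h (inv_injective h')

/-- At equal `z` the leading terms of the two `ξ` do not cancel, so their difference keeps a pole of
order `N'`; `dz` has one of order `N + 1`, and integration removes one. -/
theorem Dual.pol_of_ne (h₁ : Dual N N' q₁ p₁ θ₁ β₁) (h₂ : Dual N N' q₂ p₂ θ₂ β₂) (hN : 0 < N)
    {ω : ℂ} (hω : ω ^ N = 1) (hne : ω ^ N' ≠ (β₁ / β₂) ^ N') :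
    pol (q₂.along N (HahnSeries.C ω * unif) - q₁.along N unif) = N + N' := by
  have hω0 : ω ≠ 0 := by
    rintro rfl
    rw [zero_pow hN.ne'] at hω
    exact zero_ne_one hω
  obtain ⟨hl, φ, hφ⟩ := isSub_C_mul_unif hω0
  obtain ⟨d, hd, hz⟩ := lead_dt_zpow_neg lead_unif one_ne_zero hN
  have h2 : Lead (φ θ₂) 1 (β₂ * ω) := by simpa using hφ.lead hl hω0 one_pos h₂.lead
  have h3 := (lead_zpow_coord h2 (mul_ne_zero h₂.ne_zero hω0) (-(N' : ℤ))).sub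
    (lead_zpow_coord h₁.lead h₁.ne_zero (-(N' : ℤ)))
  have hc : (β₂ * ω) ^ (-(N' : ℤ)) - β₁ ^ (-(N' : ℤ)) ≠ 0 := by
    refine zpow_neg_sub_ne_zero fun h => hne ?_
    rw [div_pow, eq_div_iff (pow_ne_zero _ h₂.ne_zero), ← h, mul_pow, mul_comm]
  have h0 : OrdGE 0 (dt (q₂.along N (HahnSeries.C ω * unif) - q₁.along N unif)
      - ((φ θ₂) ^ (-(N' : ℤ)) - θ₁ ^ (-(N' : ℤ))) * dt (unif ^ (-(N : ℤ)))) := by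
    rw [h₁.dt_sub h₂ hω hφ, sub_self]
    exact ordGE_zero 0
  rw [pol_of_dt h0 (h3.mul hz) (mul_ne_zero hc hd)]
  omega

theorem Dual.pol_dual_of_ne (h₁ : Dual N N' q₁ p₁ θ₁ β₁) (h₂ : Dual N N' q₂ p₂ θ₂ β₂)
    (hN' : 0 < N') {ζ : ℂ} (hζ : ζ ^ N' = 1) (hne : (ζ * (β₁ / β₂)) ^ N ≠ 1) :
    pol (p₂.along N' (HahnSeries.C ζ * θ₁) - p₁.along N' θ₁) = N + N' := by
  have hζ0 : ζ ≠ 0 := by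
    rintro rfl
    rw [zero_pow hN'.ne'] at hζ
    exact zero_ne_one hζ
  obtain ⟨ψ, μ, hψ, hψθ, hμ⟩ := exists_isSub_eq h₂.lead h₂.ne_zero (h₁.lead.C_mul ζ)
    (mul_ne_zero hζ0 h₁.ne_zero) one_pos
  have hω : ζ * β₁ / β₂ ≠ 0 := div_ne_zero (mul_ne_zero hζ0 h₁.ne_zero) h₂.ne_zero
  obtain ⟨d, hd, hz⟩ := lead_dt_zpow_neg h₁.lead h₁.ne_zero hN'
  have h3 := (lead_zpow_coord lead_unif one_ne_zero (-(N : ℤ))).sub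
    (lead_zpow_coord hμ hω (-(N : ℤ)))
  have hc : (1 : ℂ) ^ (-(N : ℤ)) - (ζ * β₁ / β₂) ^ (-(N : ℤ)) ≠ 0 := by
    refine zpow_neg_sub_ne_zero fun h => hne ?_
    rw [← mul_div_assoc, ← h, one_pow]
  rw [pol_of_dt (h₁.dt_sub_dual h₂ hζ hψ hψθ) (h3.mul hz) (mul_ne_zero hc hd)]
  omega

/-- Substituting `ω t` in the second curve matches it with the first along `z`, substituting `μ`
matches it along `ξ`. If `μ - ω t` has order `k`, both differentials have order `k - N - N' - 2`; if
it vanishes, neither has a pole. -/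
theorem Dual.pol_eq (h₁ : Dual N N' q₁ p₁ θ₁ β₁) (h₂ : Dual N N' q₂ p₂ θ₂ β₂) (hN : 0 < N)
    (hN' : 0 < N') {ζ : ℂ} (hζ : ζ ^ N' = 1) (hω : (ζ * (β₁ / β₂)) ^ N = 1) :
    pol (p₂.along N' (HahnSeries.C ζ * θ₁) - p₁.along N' θ₁)
      = pol (q₂.along N (HahnSeries.C (ζ * (β₁ / β₂)) * unif) - q₁.along N unif) := by
  have hζ0 : ζ ≠ 0 := by
    rintro rfl
    rw [zero_pow hN'.ne'] at hζ
    exact zero_ne_one hζ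
  set ω := ζ * (β₁ / β₂) with hω_def
  have hω0 : ω ≠ 0 := mul_ne_zero hζ0 (div_ne_zero h₁.ne_zero h₂.ne_zero)
  obtain ⟨ψ, μ, hψ, hψθ, hμ⟩ := exists_isSub_eq h₂.lead h₂.ne_zero (h₁.lead.C_mul ζ)
    (mul_ne_zero hζ0 h₁.ne_zero) one_pos
  rw [mul_div_assoc, ← hω_def] at hμ
  obtain ⟨hl, φ, hφ⟩ := isSub_C_mul_unif hω0
  have hD := h₁.dt_sub h₂ hω hφ
  have hE := h₁.dt_sub_dual h₂ hζ hψ hψθ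
  have hξ : (ψ θ₂) ^ (-(N' : ℤ)) = θ₁ ^ (-(N' : ℤ)) := by
    rw [hψθ, mul_zpow, ← map_zpow₀, zpow_neg, zpow_natCast, hζ, inv_one, map_one, one_mul]
  have hz : (HahnSeries.C ω * unif) ^ (-(N : ℤ)) = unif ^ (-(N : ℤ)) := by
    rw [mul_zpow, ← map_zpow₀, zpow_neg, zpow_natCast, hω, inv_one, map_one, one_mul]
  rw [← hξ] at hD
  rw [← hz] at hE
  rcases eq_or_ne (μ - HahnSeries.C ω * unif) 0 with h0 | h0
  · obtain rfl := sub_eq_zero.1 h0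
    rw [sub_self, zero_mul, sub_zero] at hE
    rw [hφ.congr hψ (h₂.lead.1.mono zero_le_one), sub_self, zero_mul] at hD
    rw [pol_of_dt_zero hE, pol_of_dt_zero (by rw [hD]; exact ordGE_zero 0)]
  · obtain ⟨k, d, hd, hk⟩ := exists_lead h0
    have hk' := hk.neg
    rw [neg_sub] at hk'
    obtain ⟨e, he, hdz⟩ := lead_dt_zpow_neg lead_unif one_ne_zero hN
    obtain ⟨e', he', hdξ⟩ := lead_dt_zpow_neg h₁.lead h₁.ne_zero hN'
    have hβω : β₂ * ω ≠ 0 := mul_ne_zero h₂.ne_zero hω0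
    have hφl : Lead (φ θ₂) 1 (β₂ * ω) := by simpa using hφ.lead hl hω0 one_pos h₂.lead
    have hψl : Lead (ψ θ₂) 1 (β₂ * ω) := by simpa using hψ.lead hμ hω0 one_pos h₂.lead
    have hθ := hφ.lead_sub hψ hl.1 hμ.1 hk' h₂.lead
    have hn0 (n : ℕ) (hn : 0 < n) : ((-(n : ℤ) : ℤ) : ℂ) ≠ 0 := by
      exact Int.cast_ne_zero.2 (by omega)
    have hD0 : OrdGE 0 (dt (q₂.along N (HahnSeries.C ω * unif) - q₁.along N unif)
        - ((φ θ₂) ^ (-(N' : ℤ)) - (ψ θ₂) ^ (-(N' : ℤ))) * dt (unif ^ (-(N : ℤ)))) := by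
      rw [hD, sub_self]
      exact ordGE_zero 0
    rw [pol_of_dt hE ((lead_zpow_sub hl hμ hω0 hk' (-(N : ℤ))).mul hdξ)
        (mul_ne_zero (mul_ne_zero (mul_ne_zero (hn0 N hN) (zpow_ne_zero _ hω0))
          (neg_ne_zero.2 hd)) he'),
      pol_of_dt hD0 ((lead_zpow_sub hφl hψl hβω hθ (-(N' : ℤ))).mul hdz)
        (mul_ne_zero (mul_ne_zero (mul_ne_zero (hn0 N' hN') (zpow_ne_zero _ hβω))
          (mul_ne_zero h₂.ne_zero (neg_ne_zero.2 hd))) he)]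
    congr 1
    ring

end Contact

open Classical in
/-- The solutions of `ω ^ M = γ ^ M`. -/
def rootSet (M : ℕ) (γ : ℂ) : Finset ℂ :=
  (Finset.range M).image fun j : ℕ => Complex.exp (2 * Real.pi * Complex.I * (j : ℤ) / M) * γ

theorem exp_two_pi_div_eq_pow (M j : ℕ) : Complex.exp (2 * Real.pi * Complex.I * (j : ℤ) / M)
    = Complex.exp (2 * Real.pi * Complex.I / M) ^ j := by
  rw [← Complex.exp_nat_mul]
  congr 1
  push_cast
  ring

theorem mem_rootSet {M : ℕ} (hM : 0 < M) {γ ω : ℂ} (hγ : γ ≠ 0) :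
    ω ∈ rootSet M γ ↔ ω ^ M = γ ^ M := by
  have hprim := Complex.isPrimitiveRoot_exp M hM.ne'
  rw [rootSet, Finset.mem_image]
  simp only [exp_two_pi_div_eq_pow]
  constructor
  · rintro ⟨j, -, rfl⟩
    rw [mul_pow, pow_right_comm, hprim.pow_eq_one, one_pow, one_mul]
  · intro h
    have := NeZero.mk hM.ne'
    obtain ⟨j, hj, hj'⟩ := hprim.eq_pow_of_pow_eq_one (ξ := ω / γ)
      (by rw [div_pow, h, div_self (pow_ne_zero _ hγ)])
    exact ⟨j, Finset.mem_range.2 hj, by rw [hj', div_mul_cancel₀ _ hγ]⟩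

theorem sum_rootSet {M : ℕ} (hM : 0 < M) {γ : ℂ} (hγ : γ ≠ 0) (f : ℂ → ℕ) :
    ∑ ω ∈ rootSet M γ, f ω
      = ∑ j ∈ Finset.range M, f (Complex.exp (2 * Real.pi * Complex.I * (j : ℤ) / M) * γ) := by
  rw [rootSet, Finset.sum_image]
  intro i hi j hj h
  have h' := mul_right_cancel₀ hγ h
  rw [exp_two_pi_div_eq_pow, exp_two_pi_div_eq_pow] at h'
  exact (Complex.isPrimitiveRoot_exp M hM.ne').pow_inj (by simpa using hi) (by simpa using hj) h'

theorem card_rootSet {M : ℕ} (hM : 0 < M) {γ : ℂ} (hγ : γ ≠ 0) : (rootSet M γ).card = M := by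
  rw [Finset.card_eq_sum_ones, sum_rootSet hM hγ]
  simp

/-- Two functions that agree on the intersection of two finite sets and are constant elsewhere. -/
theorem sum_add_card_mul_eq {α : Type*} (A B : Finset α) (f g : α → ℕ) (c : ℕ)
    (hf : ∀ x ∈ A, x ∉ B → f x = c) (hg : ∀ x ∈ B, x ∉ A → g x = c)
    (hfg : ∀ x ∈ A, x ∈ B → g x = f x) :
    ∑ x ∈ A, f x + B.card * c = ∑ x ∈ B, g x + A.card * c := by
  classical
  have hA := Finset.sum_filter_add_sum_filter_not A (· ∈ B) f
  have hB := Finset.sum_filter_add_sum_filter_not B (· ∈ A) g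
  have h1 : ∑ x ∈ A with x ∉ B, f x = (A.filter (· ∉ B)).card * c := by
    rw [Finset.sum_congr rfl fun x hx => hf x (Finset.mem_filter.1 hx).1 (Finset.mem_filter.1 hx).2,
      Finset.sum_const, smul_eq_mul]
  have h2 : ∑ x ∈ B with x ∉ A, g x = (B.filter (· ∉ A)).card * c := by
    rw [Finset.sum_congr rfl fun x hx => hg x (Finset.mem_filter.1 hx).1 (Finset.mem_filter.1 hx).2,
      Finset.sum_const, smul_eq_mul]
  have hAB : A.filter (· ∈ B) = B.filter (· ∈ A) := by
    ext x
    simp [and_comm]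
  have h3 : ∑ x ∈ B with x ∈ A, g x = ∑ x ∈ A with x ∈ B, f x := by
    rw [← hAB]
    exact Finset.sum_congr rfl fun x hx =>
      hfg x (Finset.mem_filter.1 hx).1 (Finset.mem_filter.1 hx).2
  have h4 := Finset.card_filter_add_card_filter_not (s := A) (· ∈ B)
  have h5 := Finset.card_filter_add_card_filter_not (s := B) (· ∈ A)
  rw [← hA, ← hB, h1, h2, h3, ← h4, ← h5, hAB]
  ring

open ExpFactor in
-- With `ζ = ω / γ`, branches correspond to `ω ^ N = 1` on one side and to `ω ^ N' = γ ^ N'` on the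
-- other. Pole orders agree on common solutions and equal `N + N'` elsewhere, so only the numbers of
-- solutions matter.
theorem Dual.sum_slope {N N' : ℕ} {q₁ q₂ p₁ p₂ : ExpFactor} {θ₁ θ₂ : LaurentSeries ℂ} {β₁ β₂ : ℂ}
    (h₁ : Dual N N' q₁ p₁ θ₁ β₁) (h₂ : Dual N N' q₂ p₂ θ₂ β₂) (hN : 0 < N) (hN' : 0 < N') :
    (N : ℚ≥0) * ∑ j ∈ Finset.range N, (rotate (j : ℤ) q₂ - q₁).slope + N' * (N + N')
      = N' * ∑ j ∈ Finset.range N', (rotate (j : ℤ) p₂ - p₁).slope + N * (N + N') := by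
  set γ := β₁ / β₂ with hγ_def
  have hγ : γ ≠ 0 := div_ne_zero h₁.ne_zero h₂.ne_zero
  have key := sum_add_card_mul_eq (rootSet N 1) (rootSet N' γ)
    (fun ω => pol (q₂.along N (HahnSeries.C ω * unif) - q₁.along N unif))
    (fun ω => pol (p₂.along N' (HahnSeries.C (ω / γ) * θ₁) - p₁.along N' θ₁)) (N + N')
    (fun ω hA hB => h₁.pol_of_ne h₂ hN (by simpa [mem_rootSet hN] using hA)
      (by rwa [mem_rootSet hN' hγ] at hB))
    (fun ω hB hA => h₁.pol_dual_of_ne h₂ hN'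
      (by rw [div_pow, (mem_rootSet hN' hγ).1 hB, div_self (pow_ne_zero _ hγ)])
      (by rw [div_mul_cancel₀ _ hγ]; simpa [mem_rootSet hN] using hA))
    (fun ω hA hB => by
      have hω : ω / γ * (β₁ / β₂) = ω := div_mul_cancel₀ _ hγ
      have := h₁.pol_eq h₂ hN hN' (ζ := ω / γ)
        (by rw [div_pow, (mem_rootSet hN' hγ).1 hB, div_self (pow_ne_zero _ hγ)])
        (by rw [hω]; simpa [mem_rootSet hN] using hA)
      rwa [hω] at this)
  rw [sum_rootSet hN one_ne_zero, sum_rootSet hN' hγ, card_rootSet hN one_ne_zero,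
    card_rootSet hN' hγ] at key
  have e1 : ∀ j : ℕ, (pol (q₂.along N (HahnSeries.C (Complex.exp
      (2 * Real.pi * Complex.I * (j : ℤ) / N) * 1) * unif) - q₁.along N unif) : ℚ≥0)
      = N * (rotate (j : ℤ) q₂ - q₁).slope := by
    intro j
    rw [mul_one, ← along_rotate h₂.ram_left hN, ← along_sub,
      pol_along (ram_sub_dvd (by rw [ram_rotate]; exact h₂.ram_left) h₁.ram_left) hN lead_unif
        one_ne_zero, mul_comm]
  have e2 : ∀ j : ℕ, (pol (p₂.along N' (HahnSeries.C (Complex.exp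
      (2 * Real.pi * Complex.I * (j : ℤ) / N') * γ / γ) * θ₁) - p₁.along N' θ₁) : ℚ≥0)
      = N' * (rotate (j : ℤ) p₂ - p₁).slope := by
    intro j
    rw [mul_div_cancel_right₀ _ hγ, ← along_rotate h₂.ram_right hN', ← along_sub,
      pol_along (ram_sub_dvd (by rw [ram_rotate]; exact h₂.ram_right) h₁.ram_right) hN' h₁.lead
        h₁.ne_zero, mul_comm]
  have key' := congrArg (fun n : ℕ => (n : ℚ≥0)) key
  simp only [Nat.cast_add, Nat.cast_mul, Nat.cast_sum, e1, e2] at key'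
  rw [Finset.mul_sum, Finset.mul_sum]
  exact key'

/-! ### Invariance of the edge numbers -/

open ExpFactor in
theorem slope_sub_of_lt {x y : ExpFactor} (h : x.slope < y.slope) : (y - x).slope = y.slope := by
  classical
  have hy : y ≠ 0 := by
    rintro rfl
    simp [ExpFactor.slope] at h
  refine le_antisymm ?_ ?_
  · refine Finset.sup_le fun k hk => ?_
    rcases Finset.mem_union.1 (Finsupp.support_sub hk) with hk | hk
    · exact Finset.le_sup (f := fun k : Exponent => k.1) hk
    · exact (Finset.le_sup (f := fun k : Exponent => k.1) hk).trans h.le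
  · obtain ⟨k, hk, hk'⟩ := Finset.exists_mem_eq_sup y.support
      (Finsupp.support_nonempty_iff.2 hy) fun k => k.1
    have hxk : x k = 0 := by
      by_contra hx
      have := Finset.le_sup (f := fun k : Exponent => k.1) (Finsupp.mem_support_iff.2 hx)
      rw [ExpFactor.slope, ExpFactor.slope, hk'] at h
      exact absurd this (not_le.2 h)
    rw [ExpFactor.slope, hk']
    refine Finset.le_sup (f := fun k : Exponent => k.1) ?_
    rw [Finsupp.mem_support_iff, Finsupp.sub_apply, hxk, sub_zero]
    exact Finsupp.mem_support_iff.1 hk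

open ExpFactor in
theorem slope_sub_of_ne {x y : ExpFactor} (h : x.slope ≠ y.slope) :
    (y - x).slope = max x.slope y.slope := by
  rcases lt_or_gt_of_ne h with h | h
  · rw [slope_sub_of_lt h, max_eq_right h.le]
  · rw [← slope_neg, neg_sub, slope_sub_of_lt h, max_eq_left h.le]

open ExpFactor in
theorem irrClass_homClass_of_slope_ne {q p : ExpFactor} (h : q.slope ≠ p.slope) :
    (irrClass (homClass ⟦q⟧ ⟦p⟧) : ℚ≥0) = q.ram * p.ram * max q.slope p.slope := by
  have h1 : ∀ x ∈ leaves q, ∑ y ∈ leaves p, (y - x).slope = p.ram * max q.slope p.slope := by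
    intro x hx
    obtain ⟨i, rfl⟩ := Quotient.exact (mem_leaves.1 hx).symm
    rw [← card_leaves p, ← nsmul_eq_mul, ← Finset.sum_const]
    refine Finset.sum_congr rfl fun y hy => ?_
    obtain ⟨j, rfl⟩ := Quotient.exact (mem_leaves.1 hy).symm
    rw [slope_sub_of_ne (by rwa [slope_rotate, slope_rotate]), slope_rotate, slope_rotate]
  rw [irrClass_homClass, Finset.sum_congr rfl h1, Finset.sum_const, card_leaves, nsmul_eq_mul,
    mul_assoc]

/-- The slopes of two dual circles at infinity. -/
theorem Stationary.slope_mul {q p : ExpFactor} {r' : ℕ} (h : Stationary ∞ q ∞ p r') :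
    q.slope * q.ram = q.ram + r' ∧ p.slope * r' = q.ram + r' := by
  obtain ⟨θ, β, hD⟩ := h.exists_dual one_pos
  simp only [one_mul] at hD
  have hr := q.ram_pos
  have hr' := h.1
  obtain ⟨d, hd, hz⟩ := lead_dt_zpow_neg lead_unif one_ne_zero hr
  obtain ⟨d', hd', hξ⟩ := lead_dt_zpow_neg hD.lead hD.ne_zero hr'
  have l1 := (lead_zpow_coord hD.lead hD.ne_zero (-(r' : ℤ))).mul hz
  have l2 := ((lead_zpow_coord lead_unif one_ne_zero (-(q.ram : ℤ))).mul hξ).neg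
  constructor
  · rw [← pol_along hD.ram_left hr lead_unif one_ne_zero,
      pol_of_dt (g := θ ^ (-(r' : ℤ)) * dt (unif ^ (-(q.ram : ℤ))))
        (by rw [hD.deriv, sub_self]; exact ordGE_zero 0) l1
        (mul_ne_zero (zpow_ne_zero _ hD.ne_zero) hd), ← Nat.cast_add]
    congr 1
    omega
  · rw [← pol_along hD.ram_right hr' hD.lead hD.ne_zero,
      pol_of_dt (by rw [sub_neg_eq_add]; exact hD.dt_value) l2
        (neg_ne_zero.2 (mul_ne_zero (zpow_ne_zero _ one_ne_zero) hd')), ← Nat.cast_add]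
    congr 1
    omega

theorem Stationary.irrClass_homClass_eq {q₁ q₂ p₁ p₂ : ExpFactor} {r₁ r₂ : ℕ}
    (h₁ : Stationary ∞ q₁ ∞ p₁ r₁) (h₂ : Stationary ∞ q₂ ∞ p₂ r₂) :
    (irrClass (homClass ⟦q₁⟧ ⟦q₂⟧) : ℚ≥0) + p₁.ram * p₂.ram
      = irrClass (homClass ⟦p₁⟧ ⟦p₂⟧) + q₁.ram * q₂.ram := by
  obtain ⟨s₁, s₁'⟩ := h₁.slope_mul
  obtain ⟨s₂, s₂'⟩ := h₂.slope_mul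
  have hr₁ := h₁.1
  have hr₂ := h₂.1
  rw [h₁.ram_eq, h₂.ram_eq]
  have hq₁ := q₁.ram_pos
  have hq₂ := q₂.ram_pos
  have c₁ : (0 : ℚ≥0) < r₁ := by exact_mod_cast hr₁
  have c₂ : (0 : ℚ≥0) < r₂ := by exact_mod_cast hr₂
  have d₁ : (0 : ℚ≥0) < q₁.ram := by exact_mod_cast hq₁
  have d₂ : (0 : ℚ≥0) < q₂.ram := by exact_mod_cast hq₂
  -- This is equality of the slopes `1 + rᵢ / qᵢ.ram`. In that case `N = q₂.ram * q₁.ram` and `N' =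
  -- q₂.ram * r₁ = q₁.ram * r₂` serve both circles.
  by_cases heq : q₂.ram * r₁ = q₁.ram * r₂
  · obtain ⟨θ₁, β₁, D₁⟩ := h₁.exists_dual hq₂
    obtain ⟨θ₂, β₂, D₂⟩ := h₂.exists_dual hq₁
    rw [mul_comm q₁.ram q₂.ram, ← heq] at D₂
    have key := D₁.sum_slope D₂ (Nat.mul_pos hq₂ hq₁) (Nat.mul_pos hq₂ hr₁)
    have e1 := ram_mul_ram_mul_sum_slope q₁ q₂ D₂.ram_left
    have e2 := ram_mul_ram_mul_sum_slope p₁ p₂ D₂.ram_right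
    rw [h₁.ram_eq, h₂.ram_eq] at e2
    set X := ∑ j ∈ Finset.range (q₂.ram * q₁.ram), (ExpFactor.rotate (j : ℤ) q₂ - q₁).slope
    set Y := ∑ j ∈ Finset.range (q₂.ram * r₁), (ExpFactor.rotate (j : ℤ) p₂ - p₁).slope
    have heq' : (q₂.ram : ℚ≥0) * r₁ = q₁.ram * r₂ := by exact_mod_cast heq
    push_cast at key e1 e2
    have e1' : X = irrClass (homClass ⟦q₁⟧ ⟦q₂⟧) := by
      refine mul_left_cancel₀ (mul_pos d₂ d₁).ne' ?_
      rw [← e1]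
      ring
    have e2' : r₂ * Y = q₂.ram * irrClass (homClass ⟦p₁⟧ ⟦p₂⟧) := by
      refine mul_left_cancel₀ c₁.ne' ?_
      rw [← mul_assoc, e2]
      ring
    rw [e1'] at key
    have k2 : (q₂.ram * r₁ : ℚ≥0) * Y = (q₂.ram * q₁.ram) * irrClass (homClass ⟦p₁⟧ ⟦p₂⟧) := by
      rw [heq', mul_assoc, e2']
      ring
    rw [k2] at key
    have k3 : (q₂.ram * r₁ : ℚ≥0) * (q₂.ram * r₁) = (q₂.ram * q₁.ram) * (r₁ * r₂) := by
      conv_lhs => rw [heq', ← heq']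
      rw [heq']
      calc (q₁.ram * r₂ : ℚ≥0) * (q₁.ram * r₂) = (q₂.ram * r₁) * (q₁.ram * r₂) := by rw [heq']
        _ = _ := by ring
    have k4 : (q₂.ram * q₁.ram : ℚ≥0) * (irrClass (homClass ⟦q₁⟧ ⟦q₂⟧) + r₁ * r₂)
        = (q₂.ram * q₁.ram) * (irrClass (homClass ⟦p₁⟧ ⟦p₂⟧) + q₁.ram * q₂.ram) := by
      refine add_right_cancel (b := (q₂.ram * r₁ : ℚ≥0) * (q₂.ram * q₁.ram)) ?_
      rw [mul_add _ _ (q₂.ram * r₁ : ℚ≥0), k3] at key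
      linear_combination key
    exact mul_left_cancel₀ (mul_pos d₂ d₁).ne' k4
  -- With unequal slopes the larger one decides, and both irregularities exceed the product of the
  -- ramifications by the same `max (q₂.ram * r₁) (q₁.ram * r₂)`.
  · have t₁ : q₁.slope = (q₁.ram + r₁) / q₁.ram := by rw [eq_div_iff d₁.ne', s₁]
    have t₂ : q₂.slope = (q₂.ram + r₂) / q₂.ram := by rw [eq_div_iff d₂.ne', s₂]
    have t₁' : p₁.slope = (q₁.ram + r₁) / r₁ := by rw [eq_div_iff c₁.ne', s₁']
    have t₂' : p₂.slope = (q₂.ram + r₂) / r₂ := by rw [eq_div_iff c₂.ne', s₂']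
    have n1 : q₁.slope ≠ q₂.slope := by
      rw [t₁, t₂, Ne, div_eq_div_iff d₁.ne' d₂.ne']
      intro h
      have h' : (q₁.ram + r₁) * q₂.ram = (q₂.ram + r₂) * q₁.ram := by exact_mod_cast h
      exact heq (by nlinarith)
    have n2 : p₁.slope ≠ p₂.slope := by
      rw [t₁', t₂', Ne, div_eq_div_iff c₁.ne' c₂.ne']
      intro h
      have h' : (q₁.ram + r₁) * r₂ = (q₂.ram + r₂) * r₁ := by exact_mod_cast h
      exact heq (by nlinarith)
    rw [irrClass_homClass_of_slope_ne n1, irrClass_homClass_of_slope_ne n2, h₁.ram_eq, h₂.ram_eq,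
      mul_max_of_nonneg _ _ zero_le, mul_max_of_nonneg _ _ zero_le]
    have u1 : (q₁.ram * q₂.ram : ℚ≥0) * q₁.slope = q₁.ram * q₂.ram + q₂.ram * r₁ := by
      linear_combination (q₂.ram : ℚ≥0) * s₁
    have u2 : (q₁.ram * q₂.ram : ℚ≥0) * q₂.slope = q₁.ram * q₂.ram + q₁.ram * r₂ := by
      linear_combination (q₁.ram : ℚ≥0) * s₂
    have u3 : (r₁ * r₂ : ℚ≥0) * p₁.slope = r₁ * r₂ + q₁.ram * r₂ := by
      linear_combination (r₂ : ℚ≥0) * s₁'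
    have u4 : (r₁ * r₂ : ℚ≥0) * p₂.slope = r₁ * r₂ + q₂.ram * r₁ := by
      linear_combination (r₁ : ℚ≥0) * s₂'
    rw [u1, u2, u3, u4, max_add_add_left, max_add_add_left, max_comm (q₁.ram * r₂ : ℚ≥0)]
    ring

open ExpFactor in
theorem irrClass_homClass_congr {q p q' p' : ExpFactor} (hq : q'.ram = q.ram)
    (hp : p'.ram = p.ram)
    (h : ∀ j : ℤ, (rotate j p' - q').slope = (rotate j p - q).slope) :
    irrClass (homClass ⟦q'⟧ ⟦p'⟧) = irrClass (homClass ⟦q⟧ ⟦p⟧) := by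
  have h1 := ram_mul_ram_mul_sum_slope q p (dvd_refl p.ram)
  have h2 := ram_mul_ram_mul_sum_slope q' p' hp.dvd
  rw [hq, hp, Finset.sum_congr rfl fun (j : ℕ) _ => h j, h1] at h2
  have hr : (p.ram : ℚ≥0) ≠ 0 := by exact_mod_cast p.ram_pos.ne'
  exact_mod_cast (mul_left_cancel₀ hr h2).symm

/-- The common part of the two cases in the definition of the edge numbers. -/
def edgeForm (I J : LocalCircle) : ℤ := irrClass (homClass I J) - I.ram * J.ram

open Classical in
-- The Kronecker delta split off here is invariant because the action is injective.
theorem edgeNumber_eq (I J : LocalCircle) :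
    edgeNumber I J = edgeForm I J + if I = J then 1 else 0 := by
  unfold edgeNumber edgeForm
  split_ifs with h
  · rw [← h, sq]
  · rw [add_zero]

theorem rotate_monomial (j : ℤ) (n : ℕ) (hn : 0 < n) (c : ℂ) :
    ExpFactor.rotate j (monomial n hn c) = monomial n hn c :=
  ExpFactor.rotate_eq_self_iff.2 (by simp [ExpFactor.ram_monomial])

theorem act_twist_fst (lam : ℂ) (I : ExpCircle) : (act (twistMatrix lam) I).1 = I.1 := by
  obtain ⟨a, Q⟩ := I
  induction Q using Quotient.inductionOn with
  | h q =>
    induction a using OnePoint.rec with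
    | infty => rw [(moves_twist_infty lam q).act_eq]
    | coe a => rw [(moves_twist_coe lam a q).act_eq]

theorem act_scaling_fst (lam : ℂˣ) (I : ExpCircle) :
    (act (scalingMatrix lam) I).1 = ∞ ↔ I.1 = ∞ := by
  obtain ⟨a, Q⟩ := I
  induction Q using Quotient.inductionOn with
  | h q =>
    induction a using OnePoint.rec with
    | infty => rw [(moves_scaling_infty lam q).act_eq]
    | coe a => simp [(moves_scaling_coe lam a q).act_eq]

theorem edgeForm_act_twist (lam : ℂ) {I J : ExpCircle} (hI : I.1 = ∞) (hJ : J.1 = ∞) :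
    edgeForm (act (twistMatrix lam) I).2 (act (twistMatrix lam) J).2 = edgeForm I.2 J.2 := by
  obtain ⟨_, Q⟩ := I
  obtain ⟨_, P⟩ := J
  subst hI hJ
  induction Q using Quotient.inductionOn with
  | h q =>
    induction P using Quotient.inductionOn with
    | h p =>
      rw [(moves_twist_infty lam q).act_eq, (moves_twist_infty lam p).act_eq]
      change ((irrClass (homClass ⟦_⟧ ⟦_⟧) : ℤ) - ((q - _).ram : ℕ) * ((p - _).ram : ℕ)) = _
      rw [irrClass_homClass_congr (ram_sub_monomial q _ _ _) (ram_sub_monomial p _ _ _) fun j => ?_,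
        ram_sub_monomial, ram_sub_monomial]
      · rfl
      · rw [ExpFactor.rotate_sub, rotate_monomial, sub_sub_sub_cancel_right]

theorem edgeForm_act_scaling (lam : ℂˣ) {I J : ExpCircle} (hI : I.1 = ∞) (hJ : J.1 = ∞) :
    edgeForm (act (scalingMatrix lam) I).2 (act (scalingMatrix lam) J).2 = edgeForm I.2 J.2 := by
  obtain ⟨_, Q⟩ := I
  obtain ⟨_, P⟩ := J
  subst hI hJ
  have hu : ∀ k : Exponent, (lam : ℂ) ^ (k.1 : ℂ) ≠ 0 := fun k => by
    simp [Complex.cpow_eq_zero_iff]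
  induction Q using Quotient.inductionOn with
  | h q =>
    induction P using Quotient.inductionOn with
    | h p =>
      rw [(moves_scaling_infty lam q).act_eq, (moves_scaling_infty lam p).act_eq]
      change ((irrClass (homClass ⟦_⟧ ⟦_⟧) : ℤ)
        - ((q.rescale _).ram : ℕ) * ((p.rescale _).ram : ℕ)) = _
      rw [irrClass_homClass_congr (ExpFactor.ram_rescale hu q) (ExpFactor.ram_rescale hu p)
        fun j => ?_, ExpFactor.ram_rescale hu, ExpFactor.ram_rescale hu]
      · rfl
      · rw [← ExpFactor.slope_rescale hu (ExpFactor.rotate j p - q)]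
        congr 1
        ext k
        simp only [ExpFactor.rescale_apply, Finsupp.sub_apply, ExpFactor.rotate_apply]
        ring

theorem exists_stationary_of_act_fourier {q : ExpFactor}
    (h : (act fourierMatrix (∞, ⟦q⟧)).1 = ∞) :
    ∃ p r, act fourierMatrix (∞, ⟦q⟧) = (∞, ⟦p⟧) ∧ Stationary ∞ q ∞ p r := by
  obtain ⟨b, p, hL⟩ := exists_legendreTransform ∞ q
  have hact := (moves_fourier hL).act_eq
  rw [hact] at h ⊢
  obtain rfl : b = ∞ := h
  rcases legendreTransform_iff.1 hL with ⟨x, hx, -⟩ | ⟨x, -, -, hx, -⟩ | ⟨r, hS⟩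
  · exact absurd hx.symm (OnePoint.coe_ne_infty x)
  · exact absurd hx.symm (OnePoint.coe_ne_infty x)
  · exact ⟨p, r, rfl, hS⟩

theorem edgeForm_act_fourier {I J : ExpCircle} (hI : I.1 = ∞) (hJ : J.1 = ∞)
    (hI' : (act fourierMatrix I).1 = ∞) (hJ' : (act fourierMatrix J).1 = ∞) :
    edgeForm (act fourierMatrix I).2 (act fourierMatrix J).2 = edgeForm I.2 J.2 := by
  obtain ⟨_, Q⟩ := I
  obtain ⟨_, P⟩ := J
  subst hI hJ
  induction Q using Quotient.inductionOn with
  | h q =>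
    induction P using Quotient.inductionOn with
    | h p =>
      obtain ⟨q', r, hq, hSq⟩ := exists_stationary_of_act_fourier hI'
      obtain ⟨p', s, hp, hSp⟩ := exists_stationary_of_act_fourier hJ'
      rw [hq, hp]
      have h := hSq.irrClass_homClass_eq hSp
      have h' : irrClass (homClass ⟦q⟧ ⟦p⟧) + q'.ram * p'.ram
        = irrClass (homClass ⟦q'⟧ ⟦p'⟧) + q.ram * p.ram := by exact_mod_cast h
      change ((irrClass (homClass ⟦q'⟧ ⟦p'⟧) : ℤ) - (q'.ram : ℕ) * (p'.ram : ℕ))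
        = (irrClass (homClass ⟦q⟧ ⟦p⟧) : ℤ) - (q.ram : ℕ) * (p.ram : ℕ)
      zify at h'
      linarith

/-- Twists and scalings keep circles at infinity there, in both directions, so in the Bruhat
factorization the circles are at infinity just before and just after the Fourier transform. -/
theorem edgeForm_act (A : SL(2, ℂ)) {I J : ExpCircle} (hI : I.1 = ∞) (hJ : J.1 = ∞)
    (hI' : (act A I).1 = ∞) (hJ' : (act A J).1 = ∞) :
    edgeForm (act A I).2 (act A J).2 = edgeForm I.2 J.2 := by
  by_cases h : A 1 0 = 0
  · obtain ⟨lam, μ, rfl⟩ := eq_twist_mul_scaling h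
    simp only [act_mul] at hI' hJ' ⊢
    rw [act_twist_fst] at hI' hJ'
    rw [edgeForm_act_twist lam hI' hJ', edgeForm_act_scaling μ hI hJ]
  · obtain ⟨x, μ, y, rfl⟩ := eq_twist_mul_scaling_mul_fourier_mul_twist h
    simp only [act_mul] at hI' hJ' ⊢
    rw [act_twist_fst] at hI' hJ'
    rw [edgeForm_act_twist x hI' hJ']
    rw [act_scaling_fst] at hI' hJ'
    rw [edgeForm_act_scaling μ hI' hJ', edgeForm_act_fourier (by rwa [act_twist_fst])
      (by rwa [act_twist_fst]) hI' hJ', edgeForm_act_twist y hI hJ]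

theorem edgeNumber_act (A : SL(2, ℂ)) {I J : ExpCircle} (hI : I.1 = ∞) (hJ : J.1 = ∞)
    (hI' : (act A I).1 = ∞) (hJ' : (act A J).1 = ∞) :
    edgeNumber (act A I).2 (act A J).2 = edgeNumber I.2 J.2 := by
  have h : (act A I).2 = (act A J).2 ↔ I.2 = J.2 := by
    constructor
    · intro h
      rw [(actEquiv A).injective (Prod.ext (hI'.trans hJ'.symm) h)]
    · intro h
      rw [show I = J from Prod.ext (hI.trans hJ.symm) h]
  rw [edgeNumber_eq, edgeNumber_eq, edgeForm_act A hI hJ hI' hJ']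
  congr 1
  by_cases h' : I.2 = J.2
  · rw [if_pos h', if_pos (h.2 h')]
  · rw [if_neg h', if_neg (mt h.1 h')]

/-! ### Markings -/

theorem prod_map_conj_smul_sub {n : ℕ} (M : Matrix (Fin n) (Fin n) ℂ) (u : GL (Fin n) ℂ) (e : ℂ)
    (ξ : List ℂ) :
    ((ξ.map (e * ·)).map fun x => u.val * (e • M) * (u⁻¹).val - Matrix.scalar (Fin n) x).prod
      = e ^ ξ.length • (u.val * (ξ.map fun x => M - Matrix.scalar (Fin n) x).prod
        * (u⁻¹).val) := by
  induction ξ with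
  | nil => simp
  | cons x ξ ih =>
    have h : u.val * (e • M) * (u⁻¹).val - Matrix.scalar (Fin n) (e * x)
        = e • (u.val * (M - Matrix.scalar (Fin n) x) * (u⁻¹).val) := by
      have h1 : Matrix.scalar (Fin n) (e * x) = e • Matrix.scalar (Fin n) x := by
        rw [Matrix.scalar_apply, Matrix.scalar_apply, ← Matrix.diagonal_smul]
        rfl
      have h2 : u.val * Matrix.scalar (Fin n) x * (u⁻¹).val = Matrix.scalar (Fin n) x := by
        rw [← (Matrix.scalar_commute x (fun r => Commute.all x r) u.val).eq, mul_assoc,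
          ← Units.val_mul, mul_inv_cancel, Units.val_one, mul_one]
      rw [mul_sub, sub_mul, h2, smul_sub, h1, Matrix.mul_smul, Matrix.smul_mul]
    rw [List.map_cons, List.map_cons, List.prod_cons, ih, h, List.map_cons, List.prod_cons,
      List.length_cons, Matrix.smul_mul, Matrix.mul_smul, smul_smul, pow_succ']
    congr 1
    simp only [mul_assoc]
    rw [← mul_assoc (u⁻¹).val u.val, ← Units.val_mul, inv_mul_cancel, Units.val_one, one_mul]

theorem smul_conj_eq_zero_iff {n : ℕ} {M : Matrix (Fin n) (Fin n) ℂ} {u : GL (Fin n) ℂ} {e : ℂ}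
    (he : e ≠ 0) : e • (u.val * M * (u⁻¹).val) = 0 ↔ M = 0 := by
  rw [smul_eq_zero_iff_right he, (u⁻¹).isUnit.mul_left_eq_zero, u.isUnit.mul_right_eq_zero]

theorem rank_smul_conj {n : ℕ} {M : Matrix (Fin n) (Fin n) ℂ} {u : GL (Fin n) ℂ} {e : ℂ}
    (he : e ≠ 0) : (e • (u.val * M * (u⁻¹).val)).rank = M.rank := by
  rw [Matrix.rank_smul_of_mem_nonZeroDivisors _ (mem_nonZeroDivisors_of_ne_zero he),
    Matrix.rank_mul_eq_left_of_isUnit_det _ _ ((Matrix.isUnit_iff_isUnit_det _).1 (u⁻¹).isUnit),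
    Matrix.rank_mul_eq_right_of_isUnit_det _ _ ((Matrix.isUnit_iff_isUnit_det _).1 u.isUnit)]

namespace LocSys

/-- The matrices representing the two classes are chosen independently, hence the conjugation; one
`u` serves all lists, in particular all initial segments of a marking. -/
theorem exists_prodSub_sign (c : LocSys) (s : ℕ) : ∃ u : GL (Fin c.1) ℂ, ∀ ξ : List ℂ,
    (c.sign s).prodSub (ξ.map ((-1) ^ s * ·))
      = ((-1) ^ s : ℂ) ^ ξ.length • (u.val * c.prodSub ξ * (u⁻¹).val) := by
  obtain ⟨n, C⟩ := c
  have h1 : LocSys.sign s ⟨n, C⟩ = ⟨n, ConjClasses.mk ((-1) ^ s * Quotient.out C)⟩ := by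
    conv_lhs => rw [← Quotient.out_eq C]
    rfl
  set C' : ConjClasses (GL (Fin n) ℂ) := (LocSys.sign s ⟨n, C⟩).2 with hC'
  have h2 : C' = ConjClasses.mk ((-1) ^ s * Quotient.out C) := eq_of_heq (Sigma.mk.inj_iff.1 h1).2
  obtain ⟨u, hu⟩ := isConj_iff.1 (ConjClasses.mk_eq_mk_iff_isConj.1
    (h2.symm.trans (Quotient.out_eq C').symm))
  refine ⟨u, fun ξ => ?_⟩
  have h3 : (Quotient.out C').val
      = u.val * (((-1) ^ s : ℂ) • (Quotient.out C).val) * (u⁻¹).val := by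
    rw [← hu, Units.val_mul, Units.val_mul]
    rcases Nat.even_or_odd s with hs | hs <;> simp [hs.neg_one_pow]
  change ((ξ.map _).map fun x => (Quotient.out C').val - Matrix.scalar (Fin n) x).prod = _
  rw [h3]
  exact prod_map_conj_smul_sub _ u _ ξ

theorem prodSub_sign_eq_zero_iff {c : LocSys} {s : ℕ} {ξ : List ℂ} :
    (c.sign s).prodSub (ξ.map ((-1) ^ s * ·)) = 0 ↔ c.prodSub ξ = 0 := by
  obtain ⟨u, hu⟩ := exists_prodSub_sign c s
  exact (Eq.congr_left (hu ξ)).trans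
    (smul_conj_eq_zero_iff (pow_ne_zero _ (pow_ne_zero _ (by norm_num))))

theorem rank_prodSub_sign {c : LocSys} {s : ℕ} {ξ : List ℂ} :
    ((c.sign s).prodSub (ξ.map ((-1) ^ s * ·))).rank = (c.prodSub ξ).rank := by
  obtain ⟨u, hu⟩ := exists_prodSub_sign c s
  exact (congrArg Matrix.rank (hu ξ)).trans
    (rank_smul_conj (pow_ne_zero _ (pow_ne_zero _ (by norm_num))))

theorem IsMarking.sign {c : LocSys} {ξ : List ℂ} (h : c.IsMarking ξ) (s : ℕ) :
    (c.sign s).IsMarking (ξ.map ((-1) ^ s * ·)) := by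
  refine ⟨fun x hx => ?_, prodSub_sign_eq_zero_iff.2 h.2⟩
  obtain ⟨y, hy, rfl⟩ := List.mem_map.1 hx
  exact mul_ne_zero (pow_ne_zero _ (by norm_num)) (h.1 y hy)

theorem IsMinimalMarking.sign {c : LocSys} {ξ : List ℂ} (h : c.IsMinimalMarking ξ) (s : ℕ) :
    (c.sign s).IsMinimalMarking (ξ.map ((-1) ^ s * ·)) := by
  refine ⟨h.1.sign s, fun η hη => ?_⟩
  have := hη.sign s
  rw [sign_sign, sign_of_even (Even.add_self s)] at this
  simpa using h.2 _ this

/-- By Cayley–Hamilton the eigenvalues form a marking; they are nonzero because the monodromy is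
invertible. -/
theorem exists_isMarking (c : LocSys) : ∃ ξ, c.IsMarking ξ := by
  refine ⟨c.matrix.charpoly.roots.toList, fun x hx => ?_, ?_⟩
  · rintro rfl
    rw [Multiset.mem_toList, Polynomial.mem_roots c.matrix.charpoly_monic.ne_zero,
      Polynomial.IsRoot, ← Polynomial.coeff_zero_eq_eval_zero] at hx
    have h1 := Matrix.det_eq_sign_charpoly_coeff c.matrix
    rw [hx, mul_zero] at h1
    exact (Matrix.isUnit_iff_isUnit_det _).1 (Quotient.out c.2 : GL (Fin c.1) ℂ).isUnit |>.ne_zero h1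
  · have h := c.matrix.aeval_self_charpoly
    rw [(IsAlgClosed.splits c.matrix.charpoly).eq_prod_roots_of_monic c.matrix.charpoly_monic,
      ← Multiset.coe_toList c.matrix.charpoly.roots, Multiset.map_coe, Multiset.prod_coe,
      map_list_prod, List.map_map] at h
    rw [prodSub, ← h]
    congr 1
    refine List.map_congr_left fun x _ => ?_
    simp [Matrix.algebraMap_eq_diagonal, Matrix.scalar_apply]

theorem exists_isMinimalMarking (c : LocSys) : ∃ ξ, c.IsMinimalMarking ξ := by
  obtain ⟨ξ, hξ, hmin⟩ := exists_minimalFor_of_wellFoundedLT c.IsMarking List.length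
    c.exists_isMarking
  exact ⟨ξ, hξ, fun η hη => (le_total ξ.length η.length).elim id (hmin hη)⟩

end LocSys

/-! ### Invariance of the diagram -/

theorem Transports.loc_act_eq_sign {A : SL(2, ℂ)} {D D' : FormalData} (h : Transports A D D')
    {I : ExpCircle} (hI : I.1 = ∞) (hI' : (act A I).1 = ∞) :
    D'.loc (act A I) = (D.loc I).sign (I.2.ram + (act A I).2.ram) := by
  have h1 := h I
  unfold normalize at h1
  rw [if_pos hI, if_pos hI'] at h1
  exact (LocSys.sign_eq_iff (Even.add_self _)).1 h1

open Classical in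
theorem fullDiagram_isomorphic {D D' : FormalData} (h : D.AtInfinity) (h' : D'.AtInfinity)
    (m : MarkingChoice D) (m' : MarkingChoice D') (e : D.Active ≃ D'.Active)
    (hedge : ∀ I J, edgeNumber (e I).1.2 (e J).1.2 = edgeNumber I.1.2 J.1.2)
    (hlen : ∀ I, (m.seq I).length = (m'.seq (e I)).length)
    (hdim : ∀ I i, ((D'.loc (e I).1).prodSub ((m'.seq (e I)).take i)).rank
      = ((D.loc I.1).prodSub ((m.seq I).take i)).rank) :
    (fullDiagram D h m).Isomorphic (fullDiagram D' h' m') := by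
  refine ⟨Equiv.sigmaCongr e fun I => finCongr (hlen I), fun v => Iff.rfl, fun v w => ?_,
    fun v => hdim v.1 v.2⟩
  change (if (v.2 : ℕ) = 0 ∧ (w.2 : ℕ) = 0 then edgeNumber (e v.1).1.2 (e w.1).1.2
      else if e v.1 = e w.1 ∧ ((v.2 : ℕ) + 1 = w.2 ∨ (w.2 : ℕ) + 1 = v.2) then 1 else 0)
    = (if (v.2 : ℕ) = 0 ∧ (w.2 : ℕ) = 0 then edgeNumber v.1.1.2 w.1.1.2
      else if v.1 = w.1 ∧ ((v.2 : ℕ) + 1 = w.2 ∨ (w.2 : ℕ) + 1 = v.2) then 1 else 0)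
  simp only [hedge, e.apply_eq_iff_eq]

/-- The bijection of active circles. -/
def Transports.activeEquiv {A : SL(2, ℂ)} {D D' : FormalData} (h : Transports A D D') :
    D.Active ≃ D'.Active :=
  (actEquiv A).subtypeEquiv fun I => by
    rw [← h.fst_eq I]
    rfl

/-- Between circles at infinity a class changes only by the sign `(-1) ^ s`; multiplying its marking
by that sign preserves length, minimality and all the ranks. -/
theorem Transports.exists_markingChoice {A : SL(2, ℂ)} {D D' : FormalData}
    (h : Transports A D D') (hD : D.AtInfinity) (hD' : D'.AtInfinity) (m : MarkingChoice D) :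
    ∃ m' : MarkingChoice D', (m.IsMinimal → m'.IsMinimal) ∧
      (fullDiagram D hD m).Isomorphic (fullDiagram D' hD' m') := by
  set e := h.activeEquiv with he
  let s (I : D.Active) : ℕ := I.1.2.ram + (act A I.1).2.ram
  have hsign (I : D.Active) : D'.loc (e I).1 = (D.loc I.1).sign (s I) :=
    h.loc_act_eq_sign (hD _ I.2) (hD' _ (e I).2)
  let seq (J : D'.Active) : List ℂ := (m.seq (e.symm J)).map ((-1) ^ s (e.symm J) * ·)
  have hseq (I : D.Active) : seq (e I) = (m.seq I).map ((-1) ^ s I * ·) := by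
    simp only [seq, e.symm_apply_apply]
  refine ⟨⟨seq, fun J => ?_⟩, fun hm J => ?_, ?_⟩
  · obtain ⟨I, rfl⟩ := e.surjective J
    rw [hsign, hseq]
    exact (m.isMarking I).sign _
  · obtain ⟨I, rfl⟩ := e.surjective J
    change (D'.loc (e I).1).IsMinimalMarking (seq (e I))
    rw [hsign, hseq]
    exact (hm I).sign _
  · refine fullDiagram_isomorphic hD hD' _ _ e (fun I J => ?_) (fun I => ?_) fun I i => ?_
    · exact edgeNumber_act A (hD _ I.2) (hD _ J.2) (hD' _ (e I).2) (hD' _ (e J).2)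
    · change _ = (seq (e I)).length
      rw [hseq, List.length_map]
    · change ((D'.loc (e I).1).prodSub ((seq (e I)).take i)).rank = _
      rw [hsign, hseq, ← List.map_take, LocSys.rank_prodSub_sign]

theorem Transports.of_mul {A B : SL(2, ℂ)} {D D' E : FormalData} (hB : Transports B D D')
    (hA : Transports (A * B) D E) : Transports A D' E := by
  obtain ⟨E', h⟩ := exists_transports A D'
  rwa [hA.unique (hB.mul h)]

theorem exists_isDiagramOf (D : FormalData) : ∃ G, IsDiagramOf D G := by
  obtain ⟨A, D', hA, h⟩ := (dense_genericSet D).nonempty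
  choose ξ hξ using fun c : LocSys => c.exists_isMinimalMarking
  let m : MarkingChoice D' := ⟨fun I => ξ (D'.loc I.1), fun I => (hξ _).1⟩
  exact ⟨fullDiagram D' h m, A, D', h, m, hA, fun I => hξ _, Equiv.refl _, fun _ => Iff.rfl,
    fun _ _ => rfl, fun _ => rfl⟩

theorem Transports.isDiagramOf_iff {B : SL(2, ℂ)} {D D' : FormalData} (hB : Transports B D D')
    (G : Diagram) : IsDiagramOf D G ↔ IsDiagramOf D' G := by
  constructor
  · rintro ⟨A, E, h, m, hA, hm, hG⟩
    refine ⟨A * B⁻¹, E, h, m, acts_iff.2 (hB.of_mul ?_), hm, hG⟩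
    rw [inv_mul_cancel_right]
    exact acts_iff.1 hA
  · rintro ⟨A, E, h, m, hA, hm, hG⟩
    exact ⟨A * B, E, h, m, acts_iff.2 (hB.mul (acts_iff.1 hA)), hm, hG⟩

end

end WildDiagram

theorem mainTheorem2 (D : FormalData) :
    -- the action on formal data is well defined
    (∀ A : SL(2, ℂ), ∃! D' : FormalData, Acts A D D') ∧
    -- genericity
    IsOpen (genericSet D) ∧ Dense (genericSet D) ∧
    -- the full diagram is the same for all generic matrices
    (∀ (A₁ A₂ : SL(2, ℂ)) (D₁ D₂ : FormalData) (h₁ : D₁.AtInfinity) (h₂ : D₂.AtInfinity),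
      Acts A₁ D D₁ → Acts A₂ D D₂ →
      ∀ m₁ : MarkingChoice D₁, ∃ m₂ : MarkingChoice D₂,
        (m₁.IsMinimal → m₂.IsMinimal) ∧
        (fullDiagram D₁ h₁ m₁).Isomorphic (fullDiagram D₂ h₂ m₂)) ∧
    -- the general diagram exists and is invariant
    (∃ G : Diagram, IsDiagramOf D G) ∧
    (∀ (B : SL(2, ℂ)) (D' : FormalData), Acts B D D' →
      ∀ G : Diagram, IsDiagramOf D G ↔ IsDiagramOf D' G) := by
  refine ⟨fun A => existsUnique_acts A D, isOpen_genericSet D, dense_genericSet D, ?_,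
    exists_isDiagramOf D, fun B D' hB G => (acts_iff.1 hB).isDiagramOf_iff G⟩
  intro A₁ A₂ D₁ D₂ h₁ h₂ hA₁ hA₂ m₁
  -- The two generic images are compared directly, so `D` itself need not be supported at infinity.
  refine Transports.exists_markingChoice (A := A₂ * A₁⁻¹) ((acts_iff.1 hA₁).of_mul ?_) h₁ h₂ m₁
  rw [inv_mul_cancel_right]
  exact acts_iff.1 hA₂
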